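/- **Theorem 2 (security of SLP-II).** *Setting.* All algorithms are probabilistic and run in time polynomial in the security parameter $\lambda$ and the length of the messages they receive (PPT). Let $\mathcal G$ be an efficient generator of bilinear groups: on input $\lambda$ it outputs primes $q_1,q_2$, cyclic groups $\mathbb G,\mathbb G_1$ of order $n=q_1q_2$ and a bilinear map $e:\mathbb G\times\mathbb G\to\mathbb G_1$ with $e(g,g)\neq 1$ for every generator $g$ of $\mathbb G$, where the group operations, $e$ and uniform sampling from $\mathbb G$ are efficient. BGN key generation runs $\mathcal G$, draws $g\in\mathbb G$ and $r\in[n]$ uniformly, and puts $h=(g^r)^{q_2}$, $pk=(n,\mathbb G,\mathbb G_1,e,g,h)$, $sk=q_1$; encryption of an integer $a$ with uniform $r\in[n]$ is $g^ah^r$ in $\mathbb G$, and $e(g,g)^a e(g,h)^r$ in $\mathbb G_1$. BGN is semantically secure if no PPT adversary, given $pk$, can distinguish with non-negligible advantage the encryptions in $\mathbb G$ of two messages of its choice. Let $D$ be a set of positive integers (the admissible numbers of vertices, e.g. all of them, or the powers of $2$), and let $F_k$, $k\in\{0,1\}^\lambda$, be efficiently computable permutations of $[N]$, for each $N\in D$.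 $F$ is a PRP if no PPT adversary that chooses $N\in D$ and then asks adaptively for values can distinguish $F_k$, $k$ uniform, from a uniformly random permutation of $[N]$ with non-negligible advantage. *The scheme.* The client of SLP-II holds a BGN key pair $(pk,sk)$ and a uniform key $k\in\{0,1\}^\lambda$. For a simple graph $G$ on $[N]$, $N\in D$, with adjacency matrix $A=(a_{ij})$, it forms in polynomial time a masking matrix $B$ with $b_{ij}=0$ if $i,j$ are not adjacent and $\deg i<b_{ij}<N-\deg i$ if they are (when such an integer exists; otherwise $b_{ij}$ is an arbitrary natural number). It encrypts $A$ entrywise in $\mathbb G$ and $B$ entrywise in $\mathbb G_1$ with fresh randomness, and stores the $i$-th rows of the two encrypted matrices at position $F_k(i)$ of the structures $T$ and $T'$, which the cloud server gets together with $pk$. The trapdoor of a vertex $v$ is $\tau_v=(F_k(v),s)$ with a fresh uniform $s\in\{0,1\}^\lambda$. *Security.* In the real game the adversary chooses a graph $G$, receives $pk$ and $(T,T')$, then asks adaptively for the trapdoors of $q(\lambda)$ vertices ($q$ a polynomial) and outputs a bit. In the ideal game $pk$, $(T,T')$ and the trapdoors are produced by a stateful simulator, which gets only the leakage: $\mathcal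 L_{bld}(G)=|T|=N$ at the beginning, and $\mathcal L_{qry}(v_1),\dots,\mathcal L_{qry}(v_i)$ for the $i$-th query. The scheme is adaptively $\mathcal L$-secure against chosen-query attacks if for every PPT adversary there is a PPT simulator such that the probabilities that the adversary outputs $1$ in the two games differ by a negligible function of $\lambda$. *Claim.* If BGN is semantically secure and $F$ is a PRP, then SLP-II is adaptively $\mathcal L$-secure against chosen-query attacks for $\mathcal L_{bld}(G)=|T|$ and $\mathcal L_{qry}(v)=\tau_v$. Moreover, the simulator can be chosen such that $pk$ is a fresh BGN public key and all entries of $T$ and of $T'$ are fresh independent encryptions of $0$, in $\mathbb G$ and in $\mathbb G_1$ respectively; and such a simulator exists even if $\mathcal L_{qry}$ reveals, instead of the trapdoor, only which earlier queries, if any, were for the same vertex. -/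

import Mathlib

/-! ## A machine model with a step count

Data are finite binary trees whose leaves carry natural numbers written in binary.  Programs form
a small structured language with bounded loops and uniform sampling.  Every instruction costs one
step plus the bit size of its input and of its output (logarithmic cost). -/

/-- The data on which programs work. -/
inductive Data where
  | num (n : ℕ) : Data
  | pair (a b : Data) : Data

/-- Bit size of a datum. -/
def Data.size : Data → ℕ
  | .num n => Nat.size n + 1
  | .pair a b => a.size + b.size + 1

/-- Programs.  A program maps one datum to one datum; on inputs of the wrong shape the basic
operations return `num 0`.  `seq p q` runs `q` on the output of `p`; `both p q` runs `p` and `q` on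
the same input and pairs the outputs; `cond c p q` runs `p` or `q` on the input according to the
truth value of the output of `c`; `loop p` maps a pair of a number `k` and a datum `y` to the result
of running `p` on `y` repeatedly, `k` times; `sample` maps `n` to a uniform number below `n`.
Programs always halt; computations in polynomial time are not restricted by this, since the time
bound can be computed first and used as the number of rounds of a loop. -/
inductive Prog where
  | skip : Prog
  | const (d : Data) : Prog
  | seq (p q : Prog) : Prog
  | both (p q : Prog) : Prog
  | fst : Prog
  | snd : Prog
  | isPair : Prog
  | same : Prog
  | less : Prog
  | plus : Prog
  | minus : Prog
  | times : Prog
  | quot : Prog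
  | rem : Prog
  | bits : Prog
  | cond (c p q : Prog) : Prog
  | loop (p : Prog) : Prog
  | sample : Prog

/-- The truth value of a datum: everything except `num 0` counts as true. -/
def Data.truth : Data → Bool
  | .num 0 => false
  | _ => true

/-- A Boolean as a datum. -/
def Data.ofBool (b : Bool) : Data := .num (if b then 1 else 0)

/-- A binary operation on numbers as an operation on data. -/
def Data.arith (f : ℕ → ℕ → ℕ) : Data → Data
  | .pair (.num a) (.num b) => .num (f a b)
  | _ => .num 0

/-- First component of a pair. -/
def Data.left : Data → Data
  | .pair a _ => a
  | _ => .num 0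

/-- Second component of a pair. -/
def Data.right : Data → Data
  | .pair _ b => b
  | _ => .num 0

/-- Is the datum a pair? -/
def Data.testPair : Data → Data
  | .pair _ _ => .num 1
  | _ => .num 0

open Classical in
/-- Are the two components of the pair equal? -/
noncomputable def Data.testSame : Data → Data
  | .pair a b => Data.ofBool (decide (a = b))
  | _ => .num 0

/-- Length of the binary expansion of a number. -/
def Data.bitLength : Data → Data
  | .num n => .num (Nat.size n)
  | _ => .num 0

/-- Uniform number below `n` (and `0` if there is none). -/
noncomputable def Data.uniformBelow : Data → PMF Data
  | .num (n + 1) => (PMF.uniformOfFintype (Fin (n + 1))).map fun r => .num r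
  | _ => PMF.pure (.num 0)

/-- A deterministic basic instruction, with its cost. -/
noncomputable def Prog.basic (f : Data → Data) (x : Data) : PMF (Data × ℕ) :=
  PMF.pure (f x, 1 + x.size + (f x).size)

/-- `k`-fold iteration of a probabilistic step; the costs add up, plus one per round. -/
noncomputable def Prog.iter (f : Data → PMF (Data × ℕ)) : ℕ → Data → PMF (Data × ℕ)
  | 0, x => PMF.pure (x, 0)
  | k + 1, x => do
      let (y, c) ← f x
      let (z, c') ← Prog.iter f k y
      return (z, c + c' + 1)

/-- Semantics: the joint law of the output and of the number of steps. -/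
noncomputable def Prog.eval : Prog → Data → PMF (Data × ℕ)
  | .skip => Prog.basic fun x => x
  | .const d => Prog.basic fun _ => d
  | .fst => Prog.basic Data.left
  | .snd => Prog.basic Data.right
  | .isPair => Prog.basic Data.testPair
  | .same => Prog.basic Data.testSame
  | .less => Prog.basic (Data.arith fun a b => if a < b then 1 else 0)
  | .plus => Prog.basic (Data.arith fun a b => a + b)
  | .minus => Prog.basic (Data.arith fun a b => a - b)
  | .times => Prog.basic (Data.arith fun a b => a * b)
  | .quot => Prog.basic (Data.arith fun a b => a / b)
  | .rem => Prog.basic (Data.arith fun a b => a % b)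
  | .bits => Prog.basic Data.bitLength
  | .seq p q => fun x => do
      let (y, c) ← p.eval x
      let (z, c') ← q.eval y
      return (z, c + c' + 1 + x.size + z.size)
  | .both p q => fun x => do
      let (y, c) ← p.eval x
      let (z, c') ← q.eval x
      return (.pair y z, c + c' + 1 + x.size + (Data.pair y z).size)
  | .cond b p q => fun x => do
      let (t, c) ← b.eval x
      let (z, c') ← if t.truth then p.eval x else q.eval x
      return (z, c + c' + 1 + x.size + z.size)
  | .loop p => fun x =>
      match x with
      | .pair (.num k) y => do
          let (z, c) ← Prog.iter p.eval k y
          return (z, c + 1 + x.size + z.size)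
      | _ => PMF.pure (.num 0, 2 + x.size)
  | .sample => fun x => do
      let y ← Data.uniformBelow x
      return (y, 1 + x.size + y.size)

/-! ## Encodings and feasible computation -/

/-- Objects that can be written down as data. -/
class Coded (α : Type) where
  code : α → Data

instance : Coded Data := ⟨fun d => d⟩

instance : Coded ℕ := ⟨Data.num⟩

instance : Coded Bool := ⟨Data.ofBool⟩

instance (n : ℕ) : Coded (Fin n) := ⟨fun i => .num i⟩

instance (n : ℕ) : Coded (BitVec n) := ⟨fun s => .num s.toNat⟩

instance (P : ℕ → Prop) : Coded {n : ℕ // P n} := ⟨fun n => .num n⟩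

instance {α β : Type} [Coded α] [Coded β] : Coded (α × β) :=
  ⟨fun x => .pair (Coded.code x.1) (Coded.code x.2)⟩

instance {α : Type} [Coded α] : Coded (List α) :=
  ⟨fun l => l.foldr (fun a d => .pair (Coded.code a) d) (.num 0)⟩

instance {α : Type} [Coded α] (n : ℕ) : Coded (Fin n → α) := ⟨fun f => Coded.code (List.ofFn f)⟩

/-- Bit size of the encoding of an object. -/
def codeSize {α : Type} [Coded α] (a : α) : ℕ := (Coded.code a).size

/-- On input `x` the program `p` produces the distribution `μ` and never takes more than `t`
steps. -/
def Prog.Realizes {α β : Type} [Coded α] [Coded β] (p : Prog) (x : α) (μ : PMF β) (t : ℕ) : Prop :=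
  (p.eval (Coded.code x)).map Prod.fst = μ.map Coded.code ∧
    ∀ r ∈ (p.eval (Coded.code x)).support, r.2 ≤ t

/-- Negligible functions. -/
def Negligible (f : ℕ → ℝ) : Prop :=
  ∀ c : ℕ, ∃ M : ℕ, ∀ n : ℕ, M < n → f n < ((n : ℝ) ^ c)⁻¹

/-- The distance of the probabilities with which two experiments output `1`. -/
noncomputable def gap (X Y : ℕ → PMF Bool) (κ : ℕ) : ℝ :=
  |(X κ true).toReal - (Y κ true).toReal|

/-- Independent sampling of the entries of a vector. -/
noncomputable def sampleVec {α : Type} : {n : ℕ} → (Fin n → PMF α) → PMF (Fin n → α)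
  | 0, _ => PMF.pure Fin.elim0
  | _ + 1, f => do
      let a ← f 0
      let v ← sampleVec fun i => f i.succ
      return Fin.cons a v

/-- Uniform bit strings of length `κ`. -/
noncomputable def randomBits (κ : ℕ) : PMF (BitVec κ) := PMF.uniformOfFintype (BitVec κ)

/-- An adaptive interaction of `k` rounds.  In each round `ask` sees all previous replies and its
own state and chooses a question together with a new state; then `answer`, which has a state of
its own, replies. -/
noncomputable def interact {Q R σ : Type} (ask : List R → Data → PMF (Q × Data))
    (answer : σ → Q → PMF (R × σ)) (st : Data) (s : σ) : ℕ → PMF (List R × Data × σ)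
  | 0 => PMF.pure ([], st, s)
  | k + 1 => do
      let (rs, st', s') ← interact ask answer st s k
      let (v, st'') ← ask rs st'
      let (r, s'') ← answer s' v
      return (rs ++ [r], st'', s'')

/-! ## The BGN encryption scheme -/

/-- An efficient generator of pairs of cyclic groups of order `q₁ q₂` with an admissible
non-degenerate bilinear map.  `desc` is the public description of the groups and of the map; it
is all that the programs for the group operations and for the pairing get to see. -/
structure BilinearGenerator where
  Inst : Type
  G : Inst → Type
  G₁ : Inst → Type
  commGroupG : ∀ i, CommGroup (G i)
  commGroupG₁ : ∀ i, CommGroup (G₁ i)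
  fintypeG : ∀ i, Fintype (G i)
  cyclicG : ∀ i, IsCyclic (G i)
  cyclicG₁ : ∀ i, IsCyclic (G₁ i)
  q₁ : Inst → ℕ
  q₂ : Inst → ℕ
  prime₁ : ∀ i, (q₁ i).Prime
  prime₂ : ∀ i, (q₂ i).Prime
  cardG : ∀ i, Nat.card (G i) = q₁ i * q₂ i
  cardG₁ : ∀ i, Nat.card (G₁ i) = q₁ i * q₂ i
  e : ∀ {i}, G i → G i → G₁ i
  bilinear : ∀ {i} (u v : G i) (a b : ℤ), e (u ^ a) (v ^ b) = e u v ^ (a * b)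
  nondegenerate : ∀ {i} (g : G i), (∀ x, x ∈ Subgroup.zpowers g) → e g g ≠ 1
  desc : Inst → Data
  codedG : ∀ i, Coded (G i)
  codedG₁ : ∀ i, Coded (G₁ i)
  code_injG : ∀ i, Function.Injective (codedG i).code
  code_injG₁ : ∀ i, Function.Injective (codedG₁ i).code
  gen : ℕ → PMF Inst
  gen_efficient : ∃ (p : Prog) (t : Polynomial ℕ), ∀ κ,
    p.Realizes κ ((gen κ).map fun i => (q₁ i, q₂ i, desc i)) (t.eval κ)
  sampleG_efficient : ∃ (p : Prog) (t : Polynomial ℕ), ∀ κ, ∀ i ∈ (gen κ).support,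
    p.Realizes (desc i) (PMF.uniformOfFintype (G i)) (t.eval κ)
  oneG_efficient : ∃ (p : Prog) (t : Polynomial ℕ), ∀ κ, ∀ i ∈ (gen κ).support,
    p.Realizes (desc i) (PMF.pure (1 : G i)) (t.eval κ)
  mulG_efficient : ∃ (p : Prog) (t : Polynomial ℕ), ∀ κ, ∀ i ∈ (gen κ).support, ∀ a b : G i,
    p.Realizes (desc i, a, b) (PMF.pure (a * b)) (t.eval κ)
  oneG₁_efficient : ∃ (p : Prog) (t : Polynomial ℕ), ∀ κ, ∀ i ∈ (gen κ).support,
    p.Realizes (desc i) (PMF.pure (1 : G₁ i)) (t.eval κ)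
  mulG₁_efficient : ∃ (p : Prog) (t : Polynomial ℕ), ∀ κ, ∀ i ∈ (gen κ).support, ∀ a b : G₁ i,
    p.Realizes (desc i, a, b) (PMF.pure (a * b)) (t.eval κ)
  e_efficient : ∃ (p : Prog) (t : Polynomial ℕ), ∀ κ, ∀ i ∈ (gen κ).support, ∀ a b : G i,
    p.Realizes (desc i, a, b) (PMF.pure (e a b)) (t.eval κ)

attribute [instance] BilinearGenerator.commGroupG BilinearGenerator.commGroupG₁
  BilinearGenerator.fintypeG BilinearGenerator.codedG BilinearGenerator.codedG₁

namespace BilinearGenerator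

variable (𝒢 : BilinearGenerator)

/-- The common order of the two groups. -/
def n (i : 𝒢.Inst) : ℕ := 𝒢.q₁ i * 𝒢.q₂ i

instance (i : 𝒢.Inst) : NeZero (𝒢.n i) :=
  ⟨Nat.mul_ne_zero (𝒢.prime₁ i).ne_zero (𝒢.prime₂ i).ne_zero⟩

/-- Public keys `(n, G, G₁, e, g, h)`. -/
structure PublicKey where
  inst : 𝒢.Inst
  g : 𝒢.G inst
  h : 𝒢.G inst

instance : Coded 𝒢.PublicKey := ⟨fun pk => Coded.code (𝒢.n pk.inst, 𝒢.desc pk.inst, pk.g, pk.h)⟩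

/-- Uniform exponent modulo the group order. -/
noncomputable def randomExponent (i : 𝒢.Inst) : PMF (Fin (𝒢.n i)) :=
  PMF.uniformOfFintype (Fin (𝒢.n i))

/-- BGN key generation; the secret key is `q₁`. -/
noncomputable def bgnGen (κ : ℕ) : PMF (𝒢.PublicKey × ℕ) := do
  let i ← 𝒢.gen κ
  let g ← PMF.uniformOfFintype (𝒢.G i)
  let r ← 𝒢.randomExponent i
  let u := g ^ (r : ℕ)
  let h := u ^ 𝒢.q₂ i
  return (⟨i, g, h⟩, 𝒢.q₁ i)

variable {𝒢}

/-- BGN encryption in the group `G`. -/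
noncomputable def encG (pk : 𝒢.PublicKey) (a : ℕ) : PMF (𝒢.G pk.inst) := do
  let r ← 𝒢.randomExponent pk.inst
  return pk.g ^ a * pk.h ^ (r : ℕ)

/-- BGN encryption in the group `G₁`. -/
noncomputable def encG₁ (pk : 𝒢.PublicKey) (a : ℕ) : PMF (𝒢.G₁ pk.inst) := do
  let r ← 𝒢.randomExponent pk.inst
  let g₁ := 𝒢.e pk.g pk.g
  let h₁ := 𝒢.e pk.g pk.h
  return g₁ ^ a * h₁ ^ (r : ℕ)

/-- BGN decryption in `G₁`: the discrete logarithm of `c ^ q₁` to the base `e(g,g) ^ q₁`. -/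
noncomputable def decG₁ (pk : 𝒢.PublicKey) (sk : ℕ) (c : 𝒢.G₁ pk.inst) : ℕ :=
  sInf {s : ℕ | (𝒢.e pk.g pk.g ^ sk) ^ s = c ^ sk}

variable (𝒢)

/-- An adversary in the semantic security game: it sees the public key, chooses two messages, gets
the encryption of one of them and outputs a bit. -/
structure CPAAdversary where
  choose : ℕ → 𝒢.PublicKey → PMF ((ℕ × ℕ) × Data)
  guess : (κ : ℕ) → (pk : 𝒢.PublicKey) → Data → 𝒢.G pk.inst → PMF Bool

variable {𝒢}

/-- Both stages run in time polynomial in the security parameter. -/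
def CPAAdversary.IsPPT (A : 𝒢.CPAAdversary) : Prop :=
  ∃ (pC pG : Prog) (t : Polynomial ℕ), ∀ κ, ∀ pk ∈ ((𝒢.bgnGen κ).map Prod.fst).support,
    pC.Realizes (κ, pk) (A.choose κ pk) (t.eval κ) ∧
    ∀ m ∈ (A.choose κ pk).support, ∀ c : 𝒢.G pk.inst,
      pG.Realizes (κ, pk, m.2, c) (A.guess κ pk m.2 c) (t.eval κ)

/-- The semantic security game; `b` tells which of the two messages is encrypted. -/
noncomputable def cpaGame (A : 𝒢.CPAAdversary) (b : Bool) (κ : ℕ) : PMF Bool := do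
  let (pk, _) ← 𝒢.bgnGen κ
  let (m, st) ← A.choose κ pk
  let c ← encG pk (if b then m.2 else m.1)
  A.guess κ pk st c

variable (𝒢)

/-- BGN (with encryption in `G`) is semantically secure. -/
def BGNSemanticallySecure : Prop :=
  ∀ A : 𝒢.CPAAdversary, A.IsPPT → Negligible (gap (cpaGame A false) (cpaGame A true))

end BilinearGenerator

/-! ## Pseudorandom permutations -/

/-- The admissible domain sizes: positive elements of `D`. -/
abbrev Size (D : Set ℕ) : Type := {N : ℕ // 0 < N ∧ N ∈ D}

/-- A keyed family of permutations of `{0, …, N - 1}`, for all admissible `N`; the keys for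
security parameter `κ` are the bit strings of length `κ`. -/
abbrev KeyedPermutation (D : Set ℕ) : Type :=
  (κ : ℕ) → BitVec κ → (N : Size D) → Equiv.Perm (Fin N.1)

/-- A distinguisher for permutations: it chooses the domain size, asks adaptively for the values
at `rounds κ` points, and outputs a bit. -/
structure PRPDistinguisher (D : Set ℕ) where
  rounds : Polynomial ℕ
  start : ℕ → PMF (Size D × Data)
  query : (κ : ℕ) → (N : Size D) → Data → List (Fin N.1) → PMF (Fin N.1 × Data)
  guess : (κ : ℕ) → (N : Size D) → Data → List (Fin N.1) → PMF Bool

/-- The states that the distinguisher can be in after some replies, whatever these are. -/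
inductive PRPDistinguisher.Reach {D : Set ℕ} (A : PRPDistinguisher D) (κ : ℕ) (N : Size D) :
    List (Fin N.1) → Data → Prop
  | start (st : Data) : (N, st) ∈ (A.start κ).support → Reach A κ N [] st
  | step (ys : List (Fin N.1)) (st : Data) (x : Fin N.1) (st' : Data) (y : Fin N.1) :
      Reach A κ N ys st → (x, st') ∈ (A.query κ N st ys).support → Reach A κ N (ys ++ [y]) st'

/-- All stages run in time polynomial in the security parameter and the length of the replies. -/
def PRPDistinguisher.IsPPT {D : Set ℕ} (A : PRPDistinguisher D) : Prop :=
  ∃ (pS pQ pG : Prog) (t : Polynomial ℕ), ∀ κ,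
    pS.Realizes κ (A.start κ) (t.eval κ) ∧
    ∀ (N : Size D) (ys : List (Fin N.1)) (st : Data), A.Reach κ N ys st →
      (ys.length < A.rounds.eval κ →
        pQ.Realizes (κ, N, st, ys) (A.query κ N st ys) (t.eval (κ + codeSize ys))) ∧
      (ys.length = A.rounds.eval κ →
        pG.Realizes (κ, N, st, ys) (A.guess κ N st ys) (t.eval (κ + codeSize ys)))

/-- The distinguishing game; the permutation is drawn from the law `P`. -/
noncomputable def prpGame {D : Set ℕ} (A : PRPDistinguisher D)
    (P : (κ : ℕ) → (N : Size D) → PMF (Equiv.Perm (Fin N.1))) (κ : ℕ) : PMF Bool := do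
  let (N, st) ← A.start κ
  let f ← P κ N
  let (ys, st', _) ← interact (fun ys st => A.query κ N st ys)
    (fun (_ : Unit) x => PMF.pure (f x, ())) st () (A.rounds.eval κ)
  A.guess κ N st' ys

/-- `F` is a pseudorandom permutation: it is computable in polynomial time, and with a random key
it is indistinguishable from a random permutation. -/
def IsPRP {D : Set ℕ} (F : KeyedPermutation D) : Prop :=
  (∃ (p : Prog) (t : Polynomial ℕ), ∀ κ (k : BitVec κ) (N : Size D) (x : Fin N.1),
    p.Realizes (κ, k, N, x) (PMF.pure (F κ k N x)) (t.eval (κ + codeSize N))) ∧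
  ∀ A : PRPDistinguisher D, A.IsPPT →
    Negligible (gap (prpGame A fun κ N => (randomBits κ).map fun k => F κ k N)
      (prpGame A fun _ N => PMF.uniformOfFintype (Equiv.Perm (Fin N.1))))

/-! ## Secure link prediction schemes and their security -/

/-- Finite simple graphs with vertices `0, …, N - 1`, where `N` is admissible. -/
structure SizedGraph (D : Set ℕ) where
  N : Size D
  graph : SimpleGraph (Fin N.1)

open Classical in
/-- The adjacency matrix. -/
noncomputable def SizedGraph.A {D : Set ℕ} (G : SizedGraph D) (i j : Fin G.N.1) : ℕ :=
  if G.graph.Adj i j then 1 else 0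

/-- The degree of a vertex. -/
noncomputable def SizedGraph.deg {D : Set ℕ} (G : SizedGraph D) (i : Fin G.N.1) : ℕ :=
  (G.graph.neighborSet i).ncard

noncomputable instance (D : Set ℕ) : Coded (SizedGraph D) := ⟨fun G => Coded.code (G.N, G.A)⟩

/-- The algorithms of a link prediction scheme.  The secret key has a part `sk`, known to the
proxy, and a part known to the client only. -/
structure SLPScheme (D : Set ℕ) where
  PK : ℕ → Type
  ProxyKey : ℕ → Type
  ClientKey : ℕ → Type
  Table : (κ : ℕ) → PK κ → Size D → Type
  Trapdoor : ℕ → Size D → Type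
  Scores : (κ : ℕ) → PK κ → Size D → Type
  Answer : Size D → Type
  codedPK : ∀ κ, Coded (PK κ)
  codedTable : ∀ κ pk N, Coded (Table κ pk N)
  codedTrapdoor : ∀ κ N, Coded (Trapdoor κ N)
  keyGen : (κ : ℕ) → PMF (PK κ × ProxyKey κ × ClientKey κ)
  encMatrix : (κ : ℕ) → (G : SizedGraph D) → ProxyKey κ × ClientKey κ → (pk : PK κ) →
    PMF (Table κ pk G.N)
  trapdoorGen : (κ : ℕ) → (N : Size D) → Fin N.1 → ProxyKey κ × ClientKey κ → PMF (Trapdoor κ N)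
  lpQuery : (κ : ℕ) → (pk : PK κ) → (N : Size D) → Trapdoor κ N → Table κ pk N →
    PMF (Scores κ pk N)
  findMaxVertex : (κ : ℕ) → (pk : PK κ) → (N : Size D) → ProxyKey κ → Scores κ pk N → Answer N

attribute [instance] SLPScheme.codedPK SLPScheme.codedTable SLPScheme.codedTrapdoor

/-- A stateful leakage algorithm.  Its first component reveals the number of rows of the encrypted
structure, and nothing else; its second component is `query`, which may keep a secret state. -/
structure Leakage (D : Set ℕ) where
  State : ℕ → Size D → Type
  Out : ℕ → Size D → Type
  codedOut : ∀ κ N, Coded (Out κ N)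
  init : (κ : ℕ) → (N : Size D) → PMF (State κ N)
  query : (κ : ℕ) → (N : Size D) → State κ N → Fin N.1 → PMF (Out κ N × State κ N)

attribute [instance] Leakage.codedOut

/-- The leakage that tells, for each query, at which position the same vertex was queried for the
first time (the position of the current query if it is new), counted from `0`. -/
noncomputable def repetitionLeakage (D : Set ℕ) : Leakage D where
  State _ N := List (Fin N.1)
  Out _ _ := ℕ
  codedOut _ _ := inferInstance
  init _ _ := PMF.pure []
  query _ _ past v := PMF.pure (past.idxOf v, past ++ [v])

namespace SLPScheme

variable {D : Set ℕ} (𝒮 : SLPScheme D)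

/-- What the cloud server stores: the public key and the encrypted structure. -/
abbrev View (κ : ℕ) (N : Size D) : Type := (pk : 𝒮.PK κ) × 𝒮.Table κ pk N

instance (κ : ℕ) (N : Size D) : Coded (𝒮.View κ N) := ⟨fun V => Coded.code (V.1, V.2)⟩

/-- The leakage that consists of the trapdoors of the queried vertices, made with the client's
key. -/
noncomputable def trapdoorLeakage : Leakage D where
  State κ _ := 𝒮.ProxyKey κ × 𝒮.ClientKey κ
  Out κ N := 𝒮.Trapdoor κ N
  codedOut _ _ := inferInstance
  init κ _ := (𝒮.keyGen κ).map Prod.snd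
  query κ N sk v := do
    let τ ← 𝒮.trapdoorGen κ N v sk
    return (τ, sk)

/-- A stateful adversary: it chooses a graph, sees the encrypted structure, asks adaptively for
the trapdoors of `rounds κ` vertices, and outputs a bit. -/
structure Adversary where
  rounds : Polynomial ℕ
  start : ℕ → PMF (SizedGraph D × Data)
  query : (κ : ℕ) → (N : Size D) → Data → 𝒮.View κ N → List (𝒮.Trapdoor κ N) →
    PMF (Fin N.1 × Data)
  guess : (κ : ℕ) → (N : Size D) → Data → 𝒮.View κ N → List (𝒮.Trapdoor κ N) → PMF Bool

variable {𝒮}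

/-- The states that the adversary can be in when it has received the structure `V` and some
trapdoors, whatever these are. -/
inductive Adversary.Reach (A : 𝒮.Adversary) (κ : ℕ) (N : Size D) (V : 𝒮.View κ N) :
    List (𝒮.Trapdoor κ N) → Data → Prop
  | start (G : SizedGraph D) (st : Data) : (G, st) ∈ (A.start κ).support → G.N = N →
      Reach A κ N V [] st
  | step (τs : List (𝒮.Trapdoor κ N)) (st : Data) (v : Fin N.1) (st' : Data)
      (τ : 𝒮.Trapdoor κ N) : Reach A κ N V τs st → (v, st') ∈ (A.query κ N st V τs).support →
      Reach A κ N V (τs ++ [τ]) st'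

/-- All stages run in time polynomial in the security parameter and the length of the messages
received. -/
def Adversary.IsPPT (A : 𝒮.Adversary) : Prop :=
  ∃ (pS pQ pG : Prog) (t : Polynomial ℕ), ∀ κ,
    pS.Realizes κ (A.start κ) (t.eval κ) ∧
    ∀ (N : Size D) (V : 𝒮.View κ N) (τs : List (𝒮.Trapdoor κ N)) (st : Data),
      V.1 ∈ ((𝒮.keyGen κ).map Prod.fst).support → A.Reach κ N V τs st →
      (τs.length < A.rounds.eval κ →
        pQ.Realizes (κ, N, st, V, τs) (A.query κ N st V τs)
          (t.eval (κ + codeSize V + codeSize τs))) ∧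
      (τs.length = A.rounds.eval κ →
        pG.Realizes (κ, N, st, V, τs) (A.guess κ N st V τs)
          (t.eval (κ + codeSize V + codeSize τs)))

variable (𝒮)

/-- A stateful simulator: from the size of the structure it makes up the structure, and from the
leakage of the queries so far (including the current one) it makes up a trapdoor. -/
structure Simulator (L : Leakage D) where
  build : (κ : ℕ) → (N : Size D) → PMF (𝒮.View κ N × Data)
  trapdoor : (κ : ℕ) → (N : Size D) → Data → List (L.Out κ N) → PMF (𝒮.Trapdoor κ N × Data)

variable {𝒮} {L : Leakage D}

/-- The states that the simulator can be in after some leakage, whatever this is. -/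
inductive Simulator.Reach (S : 𝒮.Simulator L) (κ : ℕ) (N : Size D) :
    List (L.Out κ N) → Data → Prop
  | start (V : 𝒮.View κ N) (st : Data) : (V, st) ∈ (S.build κ N).support → Reach S κ N [] st
  | step (os : List (L.Out κ N)) (st : Data) (o : L.Out κ N) (τ : 𝒮.Trapdoor κ N) (st' : Data) :
      Reach S κ N os st → (τ, st') ∈ (S.trapdoor κ N st (os ++ [o])).support →
      Reach S κ N (os ++ [o]) st'

/-- All stages run in time polynomial in the security parameter, the size of the structure and
the length of the leakage. -/
def Simulator.IsPPT (S : 𝒮.Simulator L) : Prop :=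
  ∃ (pB pT : Prog) (t : Polynomial ℕ), ∀ κ (N : Size D),
    pB.Realizes (κ, N) (S.build κ N) (t.eval (κ + N.1)) ∧
    ∀ (os : List (L.Out κ N)) (st : Data) (o : L.Out κ N), S.Reach κ N os st →
      pT.Realizes (κ, N, st, os ++ [o]) (S.trapdoor κ N st (os ++ [o]))
        (t.eval (κ + N.1 + codeSize (os ++ [o])))

/-- The real game. -/
noncomputable def real (A : 𝒮.Adversary) (κ : ℕ) : PMF Bool := do
  let (pk, sk) ← 𝒮.keyGen κ
  let (G, st) ← A.start κ
  let T ← 𝒮.encMatrix κ G sk pk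
  let (τs, st', _) ← interact (fun τs st => A.query κ G.N st ⟨pk, T⟩ τs)
    (fun (_ : Unit) v => do
      let τ ← 𝒮.trapdoorGen κ G.N v sk
      return (τ, ()))
    st () (A.rounds.eval κ)
  A.guess κ G.N st' ⟨pk, T⟩ τs

/-- The ideal game.  The replying side keeps the state of the leakage algorithm, the leakage so
far, and the state of the simulator. -/
noncomputable def ideal (A : 𝒮.Adversary) (S : 𝒮.Simulator L) (κ : ℕ) : PMF Bool := do
  let (G, st) ← A.start κ
  let ℓ ← L.init κ G.N
  let (V, stS) ← S.build κ G.N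
  let (τs, st', _) ← interact (fun τs st => A.query κ G.N st V τs)
    (fun (s : L.State κ G.N × List (L.Out κ G.N) × Data) v => do
      let (o, ℓ') ← L.query κ G.N s.1 v
      let (τ, stS') ← S.trapdoor κ G.N s.2.2 (s.2.1 ++ [o])
      return (τ, (ℓ', s.2.1 ++ [o], stS')))
    st (ℓ, [], stS) (A.rounds.eval κ)
  A.guess κ G.N st' V τs

variable (𝒮) (L)

/-- Adaptive semantic `L`-security against chosen-query attacks. -/
def LSecure : Prop :=
  ∀ A : 𝒮.Adversary, A.IsPPT → ∃ S : 𝒮.Simulator L, S.IsPPT ∧ Negligible (gap (real A) (ideal A S))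

/-- `L`-security with a simulator whose structure has the law `Z`. -/
def LSecureWith (Z : (κ : ℕ) → (N : Size D) → PMF (𝒮.View κ N)) : Prop :=
  ∀ A : 𝒮.Adversary, A.IsPPT → ∃ S : 𝒮.Simulator L, S.IsPPT ∧
    (∀ κ N, (S.build κ N).map Prod.fst = Z κ N) ∧ Negligible (gap (real A) (ideal A S))

end SLPScheme

/-! ## The scheme SLP-II -/

/-- A polynomial-time way to choose the masking matrix `B` of a graph: `B i j = 0` if `i` and `j`
are not adjacent, and otherwise `deg i < B i j < N - deg i`, whenever this range is not empty. -/
structure MaskingAlgorithm (D : Set ℕ) where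
  mask : (G : SizedGraph D) → PMF (Fin G.N.1 → Fin G.N.1 → ℕ)
  mask_zero : ∀ G, ∀ B ∈ (mask G).support, ∀ i j, ¬ G.graph.Adj i j → B i j = 0
  mask_range : ∀ G, ∀ B ∈ (mask G).support, ∀ i j, G.graph.Adj i j →
    (∃ t, G.deg i < t ∧ t + G.deg i < G.N.1) → G.deg i < B i j ∧ B i j + G.deg i < G.N.1
  efficient : ∃ (p : Prog) (t : Polynomial ℕ), ∀ G, p.Realizes G (mask G) (t.eval (codeSize G))

section SLPII

open BilinearGenerator

/-- The pair of structures `(T, T')`: entries of `T` lie in `G`, those of `T'` in `G₁`. -/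
abbrev Tables (𝒢 : BilinearGenerator) (pk : 𝒢.PublicKey) (N : ℕ) : Type :=
  (Fin N → Fin N → 𝒢.G pk.inst) × (Fin N → Fin N → 𝒢.G₁ pk.inst)

/-- Entrywise encryption of two matrices, the first one in `G` and the second one in `G₁`. -/
noncomputable def encTables {𝒢 : BilinearGenerator} (pk : 𝒢.PublicKey) {N : ℕ}
    (A B : Fin N → Fin N → ℕ) : PMF (Tables 𝒢 pk N) := do
  let M ← sampleVec fun i => sampleVec fun j => encG pk (A i j)
  let M' ← sampleVec fun i => sampleVec fun j => encG₁ pk (B i j)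
  return (M, M')

/-- The scores computed by the cloud server for the trapdoor `(i', s)`, in shuffled order, for the
proxy, and the encrypted degree of the queried vertex, for the client. -/
noncomputable def lpQueryII {𝒢 : BilinearGenerator} {D : Set ℕ} (perm : KeyedPermutation D) (κ : ℕ)
    (pk : 𝒢.PublicKey) (N : Size D) (τ : Fin N.1 × BitVec κ) (T : Tables 𝒢 pk N.1) :
    PMF ((Fin N.1 → 𝒢.G₁ pk.inst) × 𝒢.G pk.inst) := do
  let i' := τ.1
  let c ← sampleVec fun i : Fin N.1 => do
    let r ← randomBits κ
    let blind := 𝒢.e pk.g pk.h ^ r.toNat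
    let score := if i = i' then 1 else ∏ k, 𝒢.e (T.1 i' k) (T.1 i k)
    return blind * score * T.2 i' i
  return (fun j => c (perm κ τ.2 N j), ∏ i, T.1 i' i)

/-- The decrypted scores with their indices, largest scores first. -/
noncomputable def findMaxVertexII {𝒢 : BilinearGenerator} (pk : 𝒢.PublicKey) {N : ℕ} (sk : ℕ)
    (c : Fin N → 𝒢.G₁ pk.inst) : List (ℕ × Fin N) :=
  (List.ofFn fun i => (decG₁ pk sk (c i), i)).mergeSort fun a b => decide (b.1 ≤ a.1)

/-- The scheme SLP-II over the bilinear groups `𝒢`, with the permutation families `F` (positions of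
the rows) and `perm` (shuffling of the scores) and masking matrices chosen by `mask`. -/
noncomputable def slpII {D : Set ℕ} (𝒢 : BilinearGenerator) (F perm : KeyedPermutation D)
    (mask : MaskingAlgorithm D) : SLPScheme D where
  PK _ := 𝒢.PublicKey
  ProxyKey _ := ℕ
  ClientKey κ := BitVec κ
  Table _ pk N := Tables 𝒢 pk N.1
  Trapdoor κ N := Fin N.1 × BitVec κ
  Scores _ pk N := (Fin N.1 → 𝒢.G₁ pk.inst) × 𝒢.G pk.inst
  Answer N := List (ℕ × Fin N.1)
  codedPK _ := inferInstance
  codedTable _ _ _ := inferInstance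
  codedTrapdoor _ _ := inferInstance
  keyGen κ := do
    let k ← randomBits κ
    let (pk, sk) ← 𝒢.bgnGen κ
    return (pk, sk, k)
  encMatrix κ G SK pk := do
    let B ← mask.mask G
    let (M, M') ← encTables pk G.A B
    return (fun ind => M ((F κ SK.2 G.N).symm ind), fun ind => M' ((F κ SK.2 G.N).symm ind))
  trapdoorGen κ N v SK := do
    let s ← randomBits κ
    return (F κ SK.2 N v, s)
  lpQuery κ pk N τ T := lpQueryII perm κ pk N τ T
  findMaxVertex _ pk _ sk c := findMaxVertexII pk sk c.1

/-- A fresh public key, and structures `T` and `T'` all of whose entries are encryptions of `0` in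
`G` and in `G₁` respectively. -/
noncomputable def zeroView {D : Set ℕ} (𝒢 : BilinearGenerator) (F perm : KeyedPermutation D)
    (mask : MaskingAlgorithm D) (κ : ℕ) (N : Size D) : PMF ((slpII 𝒢 F perm mask).View κ N) := do
  let (pk, _) ← 𝒢.bgnGen κ
  let T ← encTables (N := N.1) pk (fun _ _ => 0) (fun _ _ => 0)
  return ⟨pk, T⟩

end SLPII

/-! ## Polynomial bounds -/

/-! The real game is transformed into an ideal game in at most two moves.

Emptying the structures. Number the entries of `A` by 0, ..., N² - 1 and those of `B` by N², ...,
2N² - 1, and let hybrid j encrypt 0 in place of all entries with number below j. Neighbouring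
hybrids differ in one ciphertext at most. Semantic security is assumed in `G` only, but by
bilinearity the pairing of g with an encryption of a in `G` is distributed exactly as an encryption
of a in `G₁` (`encG₁_eq_map`). So one adversary against BGN covers both matrices: its challenge u
enters slot j as u or as e(g, u) (`encSlot`, `bind_hybridGuess`). It draws j uniformly from 0, ...,
m, where m is a polynomial in κ that bounds 2N². The differences telescope, and the gap between the
first and the last hybrid is exactly m + 1 times the advantage against BGN
(`negligible_gap_real_zeroGame`). In the last hybrid the entries of each structure are independent
and identically distributed, so that shuffling the rows does not change the law
(`encTables_shuffle_zero`). The structures then depend on the graph only through N and not at all on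
k; what is left is `zeroGame`.

Simulation. If trapdoors are leaked, the zero game with pseudorandom positions equals the ideal game
of the simulator that encrypts zeros and passes the trapdoors on (`ideal_forwardSimulator`). If only
repetitions are leaked, note that the zero game uses F_k through its values at the queried vertices
only; hence it can be played by a distinguisher, and F_k may be replaced by a uniform permutation
(`negligible_gap_zeroGame`). A uniform permutation can be sampled lazily: a new argument gets a
uniform unused value, an old one its old value. For this it suffices to know which queries are
repetitions (`LazyState.bind_extendLaw`, `ideal_lazySimulator`).

Running times. Most of the work is to see that reductions and simulators are polynomial-time
programs. `Feasible` is a property of a whole family of tasks solved by one program, and it is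
closed under sequencing, branching and loops with an invariant. As the cost of a run exceeds the
size of its input plus that of its output (`Prog.size_lt_cost`), every time bound is also a size
bound; this is how graphs, group elements and the states of an adversary are seen to be of
polynomial length. Stages that receive their state as raw data are defined as decoded laws of
programs (`Prog.decodedLaw`) and agree with the intended distributions at the states that can occur.
-/

theorem Polynomial.eval_mono_nat (t : Polynomial ℕ) : Monotone fun n => t.eval n := by
  intro a b hab
  simp only [Polynomial.eval_eq_sum_range]
  gcongr

/-- `f` is bounded by a polynomial in `s`. -/
def PolyBdd {ι : Type} (s f : ι → ℕ) : Prop :=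
  ∃ t : Polynomial ℕ, ∀ i, f i ≤ t.eval (s i)

namespace PolyBdd

variable {ι : Type} {s f g : ι → ℕ}

theorem mono (hf : PolyBdd s f) (h : ∀ i, g i ≤ f i) : PolyBdd s g :=
  let ⟨t, ht⟩ := hf
  ⟨t, fun i => (h i).trans (ht i)⟩

theorem self : PolyBdd s s := ⟨Polynomial.X, fun i => by simp⟩

theorem const (a : ℕ) : PolyBdd s fun _ => a := ⟨Polynomial.C a, fun i => by simp⟩

theorem add (hf : PolyBdd s f) (hg : PolyBdd s g) : PolyBdd s fun i => f i + g i :=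
  let ⟨t, ht⟩ := hf
  let ⟨u, hu⟩ := hg
  ⟨t + u, fun i => by simpa using add_le_add (ht i) (hu i)⟩

theorem mul (hf : PolyBdd s f) (hg : PolyBdd s g) : PolyBdd s fun i => f i * g i :=
  let ⟨t, ht⟩ := hf
  let ⟨u, hu⟩ := hg
  ⟨t * u, fun i => by simpa using Nat.mul_le_mul (ht i) (hu i)⟩

theorem eval (hf : PolyBdd s f) (t : Polynomial ℕ) : PolyBdd s fun i => t.eval (f i) :=
  let ⟨u, hu⟩ := hf
  ⟨t.comp u, fun i => by simpa using t.eval_mono_nat (hu i)⟩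

theorem reindex {ι' : Type} (hf : PolyBdd s f) (φ : ι' → ι) :
    PolyBdd (fun i => s (φ i)) fun i => f (φ i) :=
  let ⟨t, ht⟩ := hf
  ⟨t, fun i => ht (φ i)⟩

end PolyBdd

/-! ## Laws and costs of programs -/

theorem PMF.do_bind {α β : Type} (p : PMF α) (f : α → PMF β) : (p >>= f) = p.bind f := rfl

theorem PMF.do_pure {α : Type} (a : α) : (Pure.pure a : PMF α) = PMF.pure a := rfl

/-- Values outside the support have weight 0, so a continuation matters only at values that can
occur. This is what lets invariants enter equalities of laws. -/
theorem PMF.bind_congr_support {α β : Type} {p : PMF α} {f g : α → PMF β}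
    (h : ∀ a ∈ p.support, f a = g a) : p.bind f = p.bind g := by
  ext z
  simp only [PMF.bind_apply]
  refine tsum_congr fun a => ?_
  by_cases ha : a ∈ p.support
  · rw [h a ha]
  · rw [PMF.mem_support_iff, not_not] at ha
    simp [ha]

/-- The law of the output of a program. -/
noncomputable def Prog.law (p : Prog) (x : Data) : PMF Data := (p.eval x).map Prod.fst

/-- The program never takes more than `t` steps on input `x`. -/
def Prog.CostLe (p : Prog) (x : Data) (t : ℕ) : Prop := ∀ r ∈ (p.eval x).support, r.2 ≤ t

namespace Prog

theorem CostLe.mono {p : Prog} {x : Data} {t u : ℕ} (h : p.CostLe x t) (htu : t ≤ u) :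
    p.CostLe x u := fun r hr => (h r hr).trans htu

theorem mem_support_law {p : Prog} {x y : Data} :
    y ∈ (p.law x).support ↔ ∃ c, (y, c) ∈ (p.eval x).support := by
  simp [law, PMF.support_map]

/-- Pulls the common continuation out of the two branches, so that laws and supports can be computed
without a case distinction. -/
theorem eval_cond (b p q : Prog) (x : Data) :
    (cond b p q).eval x = (b.eval x).bind fun a =>
      (if a.1.truth then p.eval x else q.eval x).bind fun r =>
        PMF.pure (r.1, a.2 + r.2 + 1 + x.size + r.1.size) := by
  simp only [eval, PMF.do_bind, PMF.do_pure]
  congr 1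
  ext1 a
  split <;> rfl

/-- Every instruction is charged for its input and its output, plus at least one step. Hence cost
bounds are size bounds, and the cost of a composite program can be estimated from the costs of its
parts alone. -/
theorem size_lt_cost (p : Prog) (x : Data) (r : Data × ℕ) (hr : r ∈ (p.eval x).support) :
    x.size + r.1.size < r.2 := by
  have one : (Data.num 0).size = 1 := by simp [Data.size]
  cases p with
  | seq p q =>
    simp only [eval, PMF.do_bind, PMF.mem_support_bind_iff, PMF.do_pure,
      PMF.mem_support_pure_iff] at hr
    obtain ⟨a, -, b, -, rfl⟩ := hr
    simp only; omega
  | both p q =>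
    simp only [eval, PMF.do_bind, PMF.mem_support_bind_iff, PMF.do_pure,
      PMF.mem_support_pure_iff] at hr
    obtain ⟨a, -, b, -, rfl⟩ := hr
    simp only; omega
  | cond b p q =>
    simp only [eval_cond, PMF.mem_support_bind_iff, PMF.mem_support_pure_iff] at hr
    obtain ⟨a, -, b, -, rfl⟩ := hr
    simp only; omega
  | loop p =>
    simp only [eval] at hr
    split at hr
    · simp only [PMF.do_bind, PMF.mem_support_bind_iff, PMF.do_pure,
        PMF.mem_support_pure_iff] at hr
      obtain ⟨a, -, rfl⟩ := hr
      simp only; omega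
    · simp only [PMF.mem_support_pure_iff] at hr
      subst hr
      simp only [one]; omega
  | sample =>
    simp only [eval, PMF.do_bind, PMF.mem_support_bind_iff, PMF.do_pure,
      PMF.mem_support_pure_iff] at hr
    obtain ⟨a, -, rfl⟩ := hr
    simp only; omega
  | _ =>
    simp only [eval, basic, PMF.mem_support_pure_iff] at hr
    subst hr
    simp only; omega

theorem CostLe.size_add_size_le {p : Prog} {x y : Data} {t : ℕ} (h : p.CostLe x t)
    (hy : y ∈ (p.law x).support) : x.size + y.size ≤ t := by
  obtain ⟨c, hc⟩ := mem_support_law.1 hy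
  exact (p.size_lt_cost x _ hc).le.trans (h _ hc)

theorem CostLe.size_le {p : Prog} {x : Data} {t : ℕ} (h : p.CostLe x t) : x.size ≤ t := by
  obtain ⟨r, hr⟩ := (p.eval x).support_nonempty
  exact (Nat.le_add_right _ _).trans ((p.size_lt_cost x r hr).le.trans (h r hr))

theorem law_seq (p q : Prog) (x : Data) : (seq p q).law x = (p.law x).bind q.law := by
  simp only [law, eval, PMF.do_bind, PMF.do_pure, PMF.map_bind, PMF.bind_map,
    Function.comp_def, PMF.pure_map]
  rfl

theorem law_both (p q : Prog) (x : Data) :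
    (both p q).law x = (p.law x).bind fun y => (q.law x).map (Data.pair y) := by
  simp only [law, eval, PMF.do_bind, PMF.do_pure, PMF.map_bind, PMF.bind_map,
    Function.comp_def, PMF.pure_map, PMF.map_comp]
  rfl

theorem law_cond (b p q : Prog) (x : Data) :
    (cond b p q).law x = (b.law x).bind fun t => if t.truth then p.law x else q.law x := by
  simp only [law, eval_cond, PMF.map_bind, PMF.bind_map, Function.comp_def, PMF.pure_map]
  congr 1
  ext1 t
  split <;> rfl

theorem law_sample (x : Data) : sample.law x = Data.uniformBelow x := by
  simp only [law, eval, PMF.do_bind, PMF.do_pure, PMF.map_bind,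
    PMF.pure_map, PMF.bind_pure]

/-- The extra charge consists of the sizes of the first input and of the last output. They are below
the costs of the first and of the second run, whence the factors 2. -/
theorem CostLe.seq {p q : Prog} {x : Data} {t u : ℕ} (hp : p.CostLe x t)
    (hq : ∀ y ∈ (p.law x).support, q.CostLe y u) : (seq p q).CostLe x (2 * t + 2 * u + 1) := by
  intro r hr
  simp only [eval, PMF.do_bind, PMF.mem_support_bind_iff, PMF.do_pure,
    PMF.mem_support_pure_iff] at hr
  obtain ⟨⟨y, c⟩, h₁, ⟨z, c'⟩, h₂, rfl⟩ := hr
  have h₃ := hp _ h₁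
  have h₄ := hq y (mem_support_law.2 ⟨c, h₁⟩) _ h₂
  have h₅ := size_lt_cost _ _ _ h₁
  have h₆ := size_lt_cost _ _ _ h₂
  simp only at *; omega

theorem CostLe.both {p q : Prog} {x : Data} {t u : ℕ} (hp : p.CostLe x t) (hq : q.CostLe x u) :
    (both p q).CostLe x (2 * t + 2 * u + 2) := by
  intro r hr
  simp only [eval, PMF.do_bind, PMF.mem_support_bind_iff, PMF.do_pure,
    PMF.mem_support_pure_iff] at hr
  obtain ⟨⟨y, c⟩, h₁, ⟨z, c'⟩, h₂, rfl⟩ := hr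
  have h₃ := hp _ h₁
  have h₄ := hq _ h₂
  have h₅ := size_lt_cost _ _ _ h₁
  have h₆ := size_lt_cost _ _ _ h₂
  simp only [Data.size] at *; omega

/-- Only `u` is doubled: the branch taken has the same input and output as the whole, so its cost
exceeds the extra charge. -/
theorem CostLe.cond {b p q : Prog} {x : Data} {t u : ℕ} (hb : b.CostLe x t)
    (hp : ∀ y ∈ (b.law x).support, y.truth = true → p.CostLe x u)
    (hq : ∀ y ∈ (b.law x).support, y.truth = false → q.CostLe x u) :
    (cond b p q).CostLe x (t + 2 * u + 1) := by
  intro r hr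
  simp only [eval_cond, PMF.mem_support_bind_iff, PMF.mem_support_pure_iff] at hr
  obtain ⟨⟨y, c⟩, h₁, ⟨z, c'⟩, h₂, rfl⟩ := hr
  have h₃ := hb _ h₁
  have hy := mem_support_law.2 ⟨c, h₁⟩
  simp only at h₂ h₃ ⊢
  split at h₂
  · have h₄ := hp y hy ‹_› _ h₂
    have h₆ := size_lt_cost _ _ _ h₂
    simp only at *; omega
  · rename_i hf
    have h₄ := hq y hy (Bool.eq_false_iff.2 hf) _ h₂
    have h₆ := size_lt_cost _ _ _ h₂
    simp only at *; omega

end Prog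

/-! ## Families of tasks that are solved by one program in polynomial time -/

/-- There is a program that, for all `i`, on input `x i` has an output with law `μ i`, in time
polynomial in `s i`. -/
def Feasible {ι : Type} (s : ι → ℕ) (x : ι → Data) (μ : ι → PMF Data) : Prop :=
  ∃ (p : Prog) (t : Polynomial ℕ), ∀ i, p.law (x i) = μ i ∧ p.CostLe (x i) (t.eval (s i))

/-- There is a program that computes `f i` from `x i`, in time polynomial in `s i`. -/
def FeasibleFun {ι : Type} (s : ι → ℕ) (x f : ι → Data) : Prop :=
  Feasible s x fun i => PMF.pure (f i)

section

variable {ι : Type} {s : ι → ℕ} {x : ι → Data}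

namespace Feasible

variable {μ : ι → PMF Data}

theorem congr {ν : ι → PMF Data} (h : Feasible s x μ) (e : ∀ i, μ i = ν i) : Feasible s x ν := by
  obtain rfl : μ = ν := funext e
  exact h

theorem reindex {ι' : Type} (h : Feasible s x μ) (φ : ι' → ι) :
    Feasible (fun i => s (φ i)) (fun i => x (φ i)) fun i => μ (φ i) :=
  let ⟨p, t, hp⟩ := h
  ⟨p, t, fun i => hp (φ i)⟩

theorem rescale {s' : ι → ℕ} (h : Feasible s x μ) (hs : PolyBdd s' s) : Feasible s' x μ :=
  let ⟨p, t, hp⟩ := h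
  let ⟨u, hu⟩ := hs
  ⟨p, t.comp u, fun i => ⟨(hp i).1, (hp i).2.mono (by simpa using t.eval_mono_nat (hu i))⟩⟩

theorem size_input (h : Feasible s x μ) : PolyBdd s fun i => (x i).size :=
  let ⟨_, t, hp⟩ := h
  ⟨t, fun i => (hp i).2.size_le⟩

/-- The index set consists of the pairs of a task and a possible output, so that one polynomial
serves all of them. -/
theorem size_output (h : Feasible s x μ) :
    PolyBdd (ι := Σ i, (μ i).support) (fun j => s j.1) fun j => j.2.1.size := by
  obtain ⟨p, t, hp⟩ := h
  refine ⟨t, fun ⟨i, y, hy⟩ => ?_⟩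
  rw [← (hp i).1] at hy
  exact (Nat.le_add_left _ _).trans ((hp i).2.size_add_size_le hy)

/-- A program whose cost is polynomial in the size of input and output. -/
theorem of_cost (p : Prog) (f : ι → Data) (hp : ∀ i, p.eval (x i) = Prog.basic (fun _ => f i) (x i))
    (hx : PolyBdd s fun i => (x i).size) (hf : PolyBdd s fun i => (f i).size) :
    FeasibleFun s x f := by
  obtain ⟨t, ht⟩ := ((PolyBdd.const 1).add hx).add hf
  refine ⟨p, t, fun i => ⟨?_, ?_⟩⟩
  · simp [Prog.law, hp, Prog.basic, PMF.pure_map]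
  · intro r hr
    rw [hp, Prog.basic, PMF.mem_support_pure_iff] at hr
    subst hr
    exact ht i

/-- The second program has to be correct only on results that the first one can produce, whence the
sigma type of support elements as index set. Membership in supports is thereby passed on to all
later stages. -/
theorem seq {β : ι → Type} {c : ∀ i, β i → Data} {μ : ∀ i, PMF (β i)} {ν : ∀ i, β i → PMF Data}
    (hμ : Feasible s x fun i => (μ i).map (c i))
    (hν : Feasible (ι := Σ i, (μ i).support) (fun j => s j.1) (fun j => c j.1 j.2.1)
      fun j => ν j.1 j.2.1) :
    Feasible s x fun i => (μ i).bind (ν i) := by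
  obtain ⟨p, t, hp⟩ := hμ
  obtain ⟨q, u, hq⟩ := hν
  refine ⟨p.seq q, 2 * t + 2 * u + 1, fun i => ⟨?_, ?_⟩⟩
  · rw [Prog.law_seq, (hp i).1, PMF.bind_map]
    exact PMF.bind_congr_support fun b hb => (hq ⟨i, b, hb⟩).1
  · have := (hp i).2.seq (q := q) (u := u.eval (s i)) fun y hy => by
      rw [(hp i).1, PMF.mem_support_map_iff] at hy
      obtain ⟨b, hb, rfl⟩ := hy
      exact (hq ⟨i, b, hb⟩).2
    simpa using this

theorem both {ν : ι → PMF Data} (hμ : Feasible s x μ) (hν : Feasible s x ν) :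
    Feasible s x fun i => (μ i).bind fun y => (ν i).map (Data.pair y) := by
  obtain ⟨p, t, hp⟩ := hμ
  obtain ⟨q, u, hq⟩ := hν
  refine ⟨p.both q, 2 * t + 2 * u + 2, fun i => ⟨?_, ?_⟩⟩
  · rw [Prog.law_both, (hp i).1, (hq i).1]
  · simpa using (hp i).2.both (hq i).2

end Feasible

namespace FeasibleFun

variable {f g : ι → Data}

theorem congr (h : FeasibleFun s x f) (e : ∀ i, f i = g i) : FeasibleFun s x g :=
  Feasible.congr h fun i => by rw [e]

theorem reindex {ι' : Type} (h : FeasibleFun s x f) (φ : ι' → ι) :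
    FeasibleFun (fun i => s (φ i)) (fun i => x (φ i)) fun i => f (φ i) :=
  Feasible.reindex h φ

theorem size_input (h : FeasibleFun s x f) : PolyBdd s fun i => (x i).size :=
  Feasible.size_input h

theorem size_output (h : FeasibleFun s x f) : PolyBdd s fun i => (f i).size :=
  (Feasible.size_output h).reindex fun i => ⟨i, f i, by simp⟩

/-- Running a program on the result of a computation. -/
theorem comp {μ : ι → PMF Data} (hf : FeasibleFun s x f) (hμ : Feasible s f μ) :
    Feasible s x μ := by
  obtain ⟨p, t, hp⟩ := hf
  obtain ⟨q, u, hq⟩ := hμ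
  refine ⟨p.seq q, 2 * t + 2 * u + 1, fun i => ⟨?_, ?_⟩⟩
  · rw [Prog.law_seq, (hp i).1, PMF.pure_bind, (hq i).1]
  · have := (hp i).2.seq (q := q) (u := u.eval (s i)) fun y hy => by
      rw [(hp i).1, PMF.mem_support_pure_iff] at hy
      rw [hy]
      exact (hq i).2
    simpa using this

theorem comp_fun (hf : FeasibleFun s x f) (hg : FeasibleFun s f g) : FeasibleFun s x g :=
  hf.comp hg

theorem of_basic (p : Prog) (φ : Data → Data) (hp : p.eval = Prog.basic φ)
    (hf : FeasibleFun s x f) (hφ : PolyBdd s fun i => (φ (f i)).size) :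
    FeasibleFun s x fun i => φ (f i) :=
  hf.comp_fun (Feasible.of_cost p _ (fun i => by rw [hp]; rfl) hf.size_output hφ)

theorem id (hx : PolyBdd s fun i => (x i).size) : FeasibleFun s x x :=
  Feasible.of_cost .skip _ (fun _ => rfl) hx hx

theorem const (hx : PolyBdd s fun i => (x i).size) (d : Data) : FeasibleFun s x fun _ => d :=
  Feasible.of_cost (.const d) _ (fun _ => rfl) hx (.const _)

theorem pair (hf : FeasibleFun s x f) (hg : FeasibleFun s x g) :
    FeasibleFun s x fun i => .pair (f i) (g i) :=
  (Feasible.both hf hg).congr fun i => by simp [PMF.pure_bind, PMF.pure_map]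

theorem fst (h : FeasibleFun s x fun i => .pair (f i) (g i)) : FeasibleFun s x f :=
  of_basic .fst Data.left rfl h (h.size_output.mono fun i => by simp [Data.left, Data.size]; omega)

theorem snd (h : FeasibleFun s x fun i => .pair (f i) (g i)) : FeasibleFun s x g :=
  of_basic .snd Data.right rfl h (h.size_output.mono fun i => by
    simp [Data.right, Data.size]; omega)

end FeasibleFun

end

/-! ## Arithmetic, conditionals and sampling -/

theorem Nat.size_add_le (a b : ℕ) : Nat.size (a + b) ≤ Nat.size a + Nat.size b + 1 := by
  rw [Nat.size_le]
  have ha := Nat.lt_size_self a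
  have hb := Nat.lt_size_self b
  have h₁ : 2 ^ Nat.size a ≤ 2 ^ (Nat.size a + Nat.size b) :=
    Nat.pow_le_pow_right (by simp) (by simp)
  have h₂ : 2 ^ Nat.size b ≤ 2 ^ (Nat.size a + Nat.size b) :=
    Nat.pow_le_pow_right (by simp) (by simp)
  rw [pow_succ]
  omega

theorem Nat.size_mul_le (a b : ℕ) : Nat.size (a * b) ≤ Nat.size a + Nat.size b := by
  rw [Nat.size_le, pow_add]
  exact Nat.mul_lt_mul'' (Nat.lt_size_self a) (Nat.lt_size_self b)

theorem Nat.size_le_self (a : ℕ) : Nat.size a ≤ a := Nat.size_le.2 Nat.lt_two_pow_self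

namespace FeasibleFun

variable {ι : Type} {s : ι → ℕ} {x : ι → Data} {a b : ι → ℕ}

theorem size_num (h : FeasibleFun s x fun i => .num (a i)) : PolyBdd s fun i => Nat.size (a i) :=
  h.size_output.mono fun i => by simp [Data.size]

theorem arith (p : Prog) (φ : ℕ → ℕ → ℕ) (hp : p.eval = Prog.basic (Data.arith φ))
    (ha : FeasibleFun s x fun i => .num (a i)) (hb : FeasibleFun s x fun i => .num (b i))
    (hφ : ∀ m n, Nat.size (φ m n) ≤ Nat.size m + Nat.size n + 1) :
    FeasibleFun s x fun i => .num (φ (a i) (b i)) :=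
  of_basic p _ hp (ha.pair hb) (((ha.size_num.add hb.size_num).add (.const 2)).mono fun i => by
    have := hφ (a i) (b i)
    simp only [Data.arith, Data.size]; omega)

theorem add (ha : FeasibleFun s x fun i => .num (a i)) (hb : FeasibleFun s x fun i => .num (b i)) :
    FeasibleFun s x fun i => .num (a i + b i) :=
  arith .plus _ rfl ha hb Nat.size_add_le

theorem mul (ha : FeasibleFun s x fun i => .num (a i)) (hb : FeasibleFun s x fun i => .num (b i)) :
    FeasibleFun s x fun i => .num (a i * b i) :=
  arith .times _ rfl ha hb fun m n => (Nat.size_mul_le m n).trans (Nat.le_succ _)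

theorem sub (ha : FeasibleFun s x fun i => .num (a i)) (hb : FeasibleFun s x fun i => .num (b i)) :
    FeasibleFun s x fun i => .num (a i - b i) :=
  arith .minus _ rfl ha hb fun m n => by
    have := Nat.size_le_size (Nat.sub_le m n); omega

theorem div (ha : FeasibleFun s x fun i => .num (a i)) (hb : FeasibleFun s x fun i => .num (b i)) :
    FeasibleFun s x fun i => .num (a i / b i) :=
  arith .quot _ rfl ha hb fun m n => by
    have := Nat.size_le_size (Nat.div_le_self m n); omega

theorem mod (ha : FeasibleFun s x fun i => .num (a i)) (hb : FeasibleFun s x fun i => .num (b i)) :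
    FeasibleFun s x fun i => .num (a i % b i) :=
  arith .rem _ rfl ha hb fun m n => by
    have := Nat.size_le_size (Nat.mod_le m n); omega

theorem natSize (ha : FeasibleFun s x fun i => .num (a i)) :
    FeasibleFun s x fun i => .num (Nat.size (a i)) :=
  of_basic .bits Data.bitLength rfl ha ((ha.size_num.add (.const 1)).mono fun i => by
    simpa [Data.bitLength, Data.size] using Nat.size_le_self _)

theorem numeral (ha : FeasibleFun s x f) (n : ℕ) : FeasibleFun s x fun _ => .num n :=
  const ha.size_input _

theorem ofBool_size (b : Bool) : (Data.ofBool b).size ≤ 2 := by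
  cases b <;> simp [Data.ofBool, Data.size]

theorem lt (ha : FeasibleFun s x fun i => .num (a i)) (hb : FeasibleFun s x fun i => .num (b i)) :
    FeasibleFun s x fun i => Data.ofBool (decide (a i < b i)) :=
  (of_basic .less _ rfl (ha.pair hb) ((PolyBdd.const 2).mono fun i => by
    simp only [Data.arith]; split <;> simp [Data.size])).congr fun i => by
      simp [Data.arith, Data.ofBool]

theorem eq_num (ha : FeasibleFun s x fun i => .num (a i))
    (hb : FeasibleFun s x fun i => .num (b i)) :
    FeasibleFun s x fun i => Data.ofBool (decide (a i = b i)) :=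
  (of_basic .same _ rfl (ha.pair hb) ((PolyBdd.const 2).mono fun i => ofBool_size _)).congr
    fun i => by simp [Data.testSame]

theorem polynomial (t : Polynomial ℕ) (ha : FeasibleFun s x fun i => .num (a i)) :
    FeasibleFun s x fun i => .num (t.eval (a i)) := by
  induction t using Polynomial.induction_on' with
  | add p q hp hq => exact (hp.add hq).congr fun i => by simp
  | monomial n c =>
    have : FeasibleFun s x fun i => .num (a i ^ n) := by
      induction n with
      | zero => simpa using ha.numeral 1
      | succ n ih => exact (ih.mul ha).congr fun i => by rw [pow_succ]
    exact ((ha.numeral c).mul this).congr fun i => by simp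

end FeasibleFun

namespace Feasible

variable {ι : Type} {s : ι → ℕ} {x : ι → Data}

/-- Each branch is solved on its own subfamily, where `P` or its negation is available as a property
of the index. -/
theorem by_cases {P : ι → Prop} [DecidablePred P] {μ : ι → PMF Data}
    (hP : FeasibleFun s x fun i => Data.ofBool (decide (P i)))
    (h₁ : Feasible (ι := {i // P i}) (fun i => s i.1) (fun i => x i.1) fun i => μ i.1)
    (h₂ : Feasible (ι := {i // ¬ P i}) (fun i => s i.1) (fun i => x i.1) fun i => μ i.1) :
    Feasible s x μ := by
  obtain ⟨r, v, hr⟩ := hP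
  obtain ⟨p, t, hp⟩ := h₁
  obtain ⟨q, u, hq⟩ := h₂
  have htruth : ∀ b, (Data.ofBool b).truth = b := by rintro (_ | _) <;> rfl
  refine ⟨.cond r p q, v + 2 * (t + u) + 1, fun i => ⟨?_, ?_⟩⟩
  · rw [Prog.law_cond, (hr i).1, PMF.pure_bind, htruth]
    by_cases h : P i
    · simpa [h] using (hp ⟨i, h⟩).1
    · simpa [h] using (hq ⟨i, h⟩).1
  · have := (hr i).2.cond (p := p) (q := q) (u := (t + u).eval (s i)) (fun y hy hy' => by
        rw [(hr i).1, PMF.mem_support_pure_iff] at hy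
        rw [hy, htruth, decide_eq_true_iff] at hy'
        exact (hp ⟨i, hy'⟩).2.mono (by simp)) (fun y hy hy' => by
        rw [(hr i).1, PMF.mem_support_pure_iff] at hy
        rw [hy, htruth, decide_eq_false_iff_not] at hy'
        exact (hq ⟨i, hy'⟩).2.mono (by simp))
    simpa using this

theorem _root_.Data.uniformBelow_succ (n : ℕ) : Data.uniformBelow (.num (n + 1)) =
    (PMF.uniformOfFintype (Fin (n + 1))).map fun r : Fin (n + 1) => Data.num r := by
  simp only [Data.uniformBelow, PMF.do_bind, PMF.do_pure, PMF.map_bind, PMF.pure_map]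
  rfl

theorem sample {n : ι → ℕ} (hn : FeasibleFun s x fun i => .num (n i)) :
    Feasible s x fun i => Data.uniformBelow (.num (n i)) := by
  refine hn.comp ?_
  obtain ⟨t, ht⟩ := hn.size_output
  refine ⟨.sample, 1 + 2 * t, fun i => ⟨Prog.law_sample _, fun r hr => ?_⟩⟩
  simp only [Prog.eval, PMF.do_bind, PMF.mem_support_bind_iff, PMF.do_pure,
    PMF.mem_support_pure_iff] at hr
  obtain ⟨y, hy, rfl⟩ := hr
  -- The sampled number does not exceed the input, so its code is not longer.
  have : y.size ≤ (Data.num (n i)).size := by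
    cases h : n i with
    | zero =>
      simp only [h, Data.uniformBelow, PMF.mem_support_pure_iff] at hy
      rw [hy]
    | succ m =>
      rw [h, Data.uniformBelow_succ, PMF.mem_support_map_iff] at hy
      obtain ⟨r, -, rfl⟩ := hy
      simpa [Data.size] using Nat.size_le_size (by omega : (r : ℕ) ≤ m + 1)
  have := ht i
  simp only at this
  simp only [Polynomial.eval_add, Polynomial.eval_mul, Polynomial.eval_one, Polynomial.eval_ofNat]
  omega

theorem uniformFin {n : ι → ℕ} [∀ i, NeZero (n i)] (hn : FeasibleFun s x fun i => .num (n i)) :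
    Feasible s x fun i => (PMF.uniformOfFintype (Fin (n i))).map fun r : Fin (n i) => Data.num r :=
  (sample hn).congr fun i => by
    obtain ⟨m, hm⟩ := Nat.exists_eq_succ_of_ne_zero (NeZero.ne (n i))
    have : ∀ (m k : ℕ) [NeZero k], k = m + 1 → Data.uniformBelow (.num k) =
        (PMF.uniformOfFintype (Fin k)).map fun r : Fin k => Data.num r := by
      rintro m k _ rfl
      exact Data.uniformBelow_succ m
    exact this m _ hm

/-- Running a program after another one, in an environment that includes the first result. -/
theorem bind {β : ι → Type} {c : ∀ i, β i → Data} {μ : ∀ i, PMF (β i)} {ν : ∀ i, β i → PMF Data}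
    (hμ : Feasible s x fun i => (μ i).map (c i))
    (hν : ∀ (s' : (Σ i, (μ i).support) → ℕ) (x' : (Σ i, (μ i).support) → Data),
      (∀ f, FeasibleFun s x f → FeasibleFun s' x' fun j => f j.1) →
      (FeasibleFun s' x' fun j => c j.1 j.2.1) →
      (∀ f, PolyBdd s f → PolyBdd s' fun j => f j.1) →
      Feasible s' x' fun j => ν j.1 j.2.1) :
    Feasible s x fun i => (μ i).bind (ν i) := by
  -- The input is kept next to the first result. Since `s'` and `x'` are arbitrary in `hν`, the
  -- continuation sees the environment through three rules only: earlier computations, the new value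
  -- and earlier bounds remain available.
  have hid := FeasibleFun.id hμ.size_input
  have h₁ := (Feasible.both hid hμ).congr (ν := fun i => (μ i).map fun b => .pair (x i) (c i b))
    fun i => by simp [PMF.pure_bind, PMF.map_comp, Function.comp_def]
  have h₂ := (FeasibleFun.id (s := fun j : Σ i, (μ i).support => s j.1)
    (x := fun j => .pair (x j.1) (c j.1 j.2.1))
    (h₁.size_output.reindex fun j : (Σ i, (μ i).support) => ⟨j.1, _, by
      rw [PMF.mem_support_map_iff]
      exact ⟨j.2.1, j.2.2, rfl⟩⟩))
  exact h₁.seq (hν _ _ (fun f hf => h₂.fst.comp_fun (hf.reindex Sigma.fst)) h₂.snd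
    fun f hf => hf.reindex Sigma.fst)

theorem map {β : ι → Type} {c g : ∀ i, β i → Data} {μ : ∀ i, PMF (β i)}
    (hμ : Feasible s x fun i => (μ i).map (c i))
    (hg : ∀ (s' : (Σ i, (μ i).support) → ℕ) (x' : (Σ i, (μ i).support) → Data),
      (∀ f, FeasibleFun s x f → FeasibleFun s' x' fun j => f j.1) →
      (FeasibleFun s' x' fun j => c j.1 j.2.1) →
      (∀ f, PolyBdd s f → PolyBdd s' fun j => f j.1) →
      FeasibleFun s' x' fun j => g j.1 j.2.1) :
    Feasible s x fun i => (μ i).map (g i) :=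
  hμ.bind (ν := fun i b => PMF.pure (g i b)) hg

end Feasible

theorem FeasibleFun.by_cases {ι : Type} {s : ι → ℕ} {x f : ι → Data} {P : ι → Prop}
    [DecidablePred P] (hP : FeasibleFun s x fun i => Data.ofBool (decide (P i)))
    (h₁ : FeasibleFun (ι := {i // P i}) (fun i => s i.1) (fun i => x i.1) fun i => f i.1)
    (h₂ : FeasibleFun (ι := {i // ¬ P i}) (fun i => s i.1) (fun i => x i.1) fun i => f i.1) :
    FeasibleFun s x f :=
  Feasible.by_cases hP h₁ h₂

/-! ## Loops -/

/-- Iteration of a probabilistic step. -/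
noncomputable def PMF.iter {β : Type} (f : β → PMF β) : ℕ → β → PMF β
  | 0, b => PMF.pure b
  | k + 1, b => (f b).bind (PMF.iter f k)

namespace PMF

variable {β : Type} {f : β → PMF β}

/-- The definition performs the first round first, whereas `interact` splits off the last round. -/
theorem iter_succ (f : β → PMF β) (k : ℕ) (b : β) : iter f (k + 1) b = (iter f k b).bind f := by
  induction k generalizing b with
  | zero => simp [iter, PMF.pure_bind, PMF.bind_pure]
  | succ k ih =>
    change (f b).bind (iter f (k + 1)) = ((f b).bind (iter f k)).bind f
    rw [PMF.bind_bind]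
    congr 1
    exact funext ih

theorem iter_pure (g : β → β) (k : ℕ) (b : β) :
    iter (fun b => PMF.pure (g b)) k b = PMF.pure (g^[k] b) := by
  induction k generalizing b with
  | zero => rfl
  | succ k ih => rw [iter, PMF.pure_bind, ih, Function.iterate_succ_apply]

theorem iter_invariant {P : ℕ → β → Prop} {n k : ℕ} {b b' : β} (hb : P n b)
    (hf : ∀ j b, n ≤ j → j < n + k → P j b → ∀ b' ∈ (f b).support, P (j + 1) b')
    (hb' : b' ∈ (iter f k b).support) : P (n + k) b' := by
  induction k generalizing b' with
  | zero =>
    rw [iter, mem_support_pure_iff] at hb'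
    exact hb' ▸ hb
  | succ k ih =>
    rw [iter_succ, mem_support_bind_iff] at hb'
    obtain ⟨a, ha, hab⟩ := hb'
    exact hf _ a (by omega) (by omega) (ih (fun j b h₁ h₂ => hf j b h₁ (by omega)) ha) _ hab

end PMF

namespace Prog

theorem law_loop (p : Prog) (k : ℕ) (y : Data) :
    (loop p).law (.pair (.num k) y) = PMF.iter p.law k y := by
  have : ∀ k y, (iter p.eval k y).map Prod.fst = PMF.iter p.law k y := by
    intro k
    induction k with
    | zero => intro y; simp [iter, PMF.iter, PMF.pure_map]
    | succ k ih =>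
      intro y
      simp only [iter, PMF.iter, PMF.do_bind, PMF.do_pure, PMF.map_bind, PMF.pure_map, ← ih, law,
        PMF.bind_map, Function.comp_def]
      rfl
  simp only [← this, law, eval, PMF.do_bind, PMF.do_pure, PMF.map_bind, PMF.pure_map]
  rfl

/-- While `P` holds, a round costs at most `t`, which gives k(t + 1) for the rounds. The final state
is either `y` itself or the output of a round, so its size is at most that of `y` plus the cost of
the rounds; hence the factors 2. -/
theorem CostLe.loop {p : Prog} {k t : ℕ} {y : Data} (P : ℕ → Data → Prop) (h₀ : P 0 y)
    (hP : ∀ j z, j < k → P j z → p.CostLe z t ∧ ∀ z' ∈ (p.law z).support, P (j + 1) z') :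
    (loop p).CostLe (.pair (.num k) y)
      (2 * (k * (t + 1)) + 4 + 2 * (Data.pair (.num k) y).size) := by
  have key : ∀ m j z, j + m = k → P j z → ∀ r ∈ (iter p.eval m z).support,
      r.2 ≤ m * (t + 1) ∧ r.1.size ≤ z.size + m * (t + 1) := by
    intro m
    induction m with
    | zero =>
      intro j z _ _ r hr
      simp only [iter, PMF.mem_support_pure_iff] at hr
      subst hr
      simp
    | succ m ih =>
      intro j z hj hz r hr
      simp only [iter, PMF.do_bind, PMF.mem_support_bind_iff, PMF.do_pure,
        PMF.mem_support_pure_iff] at hr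
      obtain ⟨⟨z', c⟩, h₁, ⟨w, c'⟩, h₂, rfl⟩ := hr
      obtain ⟨h₃, h₄⟩ := hP j z (by omega) hz
      have h₅ := ih (j + 1) z' (by omega) (h₄ z' (mem_support_law.2 ⟨c, h₁⟩)) _ h₂
      have h₆ := h₃ _ h₁
      have h₇ := size_lt_cost _ _ _ h₁
      simp only [add_mul, one_mul] at *
      omega
  intro r hr
  simp only [eval, PMF.do_bind, PMF.mem_support_bind_iff, PMF.do_pure,
    PMF.mem_support_pure_iff] at hr
  obtain ⟨⟨z, c⟩, h₁, rfl⟩ := hr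
  have := key k 0 y (by omega) h₀ _ h₁
  simp only [Data.size] at *
  omega

end Prog

namespace Feasible

variable {ι : Type} {s : ι → ℕ} {x : ι → Data}

/-- A polynomial bound for one round in terms of the size of its own input would not do, since it
would be composed `k i` times. Therefore the invariant `P` has to bound all intermediate states in
advance; it also restricts the states on which a round must be correct. -/
theorem loop {β : ι → Type} {c : ∀ i, β i → Data} {k : ι → ℕ} {f : ∀ i, β i → PMF (β i)}
    {b₀ : ∀ i, β i} (P : ∀ i, ℕ → β i → Prop) (hk : FeasibleFun s x fun i => .num (k i))
    (hkb : PolyBdd s k) (h₀ : FeasibleFun s x fun i => c i (b₀ i)) (hP₀ : ∀ i, P i 0 (b₀ i))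
    (hP : ∀ i j b, j < k i → P i j b → ∀ b' ∈ (f i b).support, P i (j + 1) b')
    (hsize : PolyBdd (ι := Σ i, {b : β i // ∃ j < k i, P i j b}) (fun j => s j.1)
      fun j => (c j.1 j.2.1).size)
    (hf : ∀ (s' : (Σ i, {b : β i // ∃ j < k i, P i j b}) → ℕ)
      (x' : (Σ i, {b : β i // ∃ j < k i, P i j b}) → Data),
      (∀ f, FeasibleFun s x f → FeasibleFun s' x' fun j => f j.1) →
      (FeasibleFun s' x' fun j => c j.1 j.2.1) →
      (∀ f, PolyBdd s f → PolyBdd s' fun j => f j.1) →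
      Feasible s' x' fun j => (f j.1 j.2.1).map (c j.1)) :
    Feasible s x fun i => (PMF.iter (f i) (k i) (b₀ i)).map (c i) := by
  have hx := hk.size_input
  -- The loop works on pairs of the input and the state, so that every round has access to the
  -- environment; the input is dropped at the end.
  have hid := FeasibleFun.id (s := fun j : Σ i, {b : β i // ∃ j < k i, P i j b} => s j.1)
    (x := fun j => .pair (x j.1) (c j.1 j.2.1))
    (((PolyBdd.const 1).add ((hx.reindex _).add hsize)).mono fun j => by simp [Data.size])
  have hstep := (Feasible.both hid.fst (hf _ _ (fun f hf => hid.fst.comp_fun (hf.reindex _)) hid.snd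
    fun f hf => hf.reindex _)).congr (ν := fun j => (f j.1 j.2.1).map fun b =>
      .pair (x j.1) (c j.1 b)) fun i => by simp [PMF.pure_bind, PMF.map_comp, Function.comp_def]
  obtain ⟨q, t, hq⟩ := hstep
  have hin := hk.pair ((FeasibleFun.id hx).pair h₀)
  obtain ⟨u, hu⟩ := hin.size_output
  obtain ⟨v, hv⟩ := hkb
  have hloop : Feasible s (fun i => .pair (.num (k i)) (.pair (x i) (c i (b₀ i))))
      fun i => (PMF.iter (f i) (k i) (b₀ i)).map fun b => .pair (x i) (c i b) := by
    refine ⟨.loop q, 2 * (v * (t + 1)) + 4 + 2 * u, fun i => ⟨?_, ?_⟩⟩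
    · rw [Prog.law_loop]
      have : ∀ m j b, j + m = k i → P i j b → PMF.iter q.law m (.pair (x i) (c i b)) =
          (PMF.iter (f i) m b).map fun b => .pair (x i) (c i b) := by
        intro m
        induction m with
        | zero => intro j b _ _; simp [PMF.iter, PMF.pure_map]
        | succ m ih =>
          intro j b hj hb
          rw [PMF.iter, (hq ⟨i, b, j, by omega, hb⟩).1, PMF.iter, PMF.bind_map, PMF.map_bind]
          exact PMF.bind_congr_support fun b' hb' =>
            ih (j + 1) b' (by omega) (hP i j b (by omega) hb b' hb')
      exact this (k i) 0 _ (by omega) (hP₀ i)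
    · have := Prog.CostLe.loop (p := q) (k := k i) (t := t.eval (s i))
        (y := .pair (x i) (c i (b₀ i))) (fun j z => ∃ b, P i j b ∧ z = .pair (x i) (c i b))
        ⟨_, hP₀ i, rfl⟩ (by
          rintro j _ hj ⟨b, hb, rfl⟩
          obtain ⟨h₁, h₂⟩ := hq ⟨i, b, j, hj, hb⟩
          refine ⟨h₂, fun z' hz' => ?_⟩
          rw [h₁, PMF.mem_support_map_iff] at hz'
          obtain ⟨b', hb', rfl⟩ := hz'
          exact ⟨b', hP i j b hj hb b' hb', rfl⟩)
      refine this.mono ?_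
      have h₁ := hu i
      have h₂ := hv i
      simp only [Polynomial.eval_add, Polynomial.eval_mul, Polynomial.eval_one,
        Polynomial.eval_ofNat]
      gcongr
  have hall := hin.comp hloop
  have := hall.seq (ν := fun i b => PMF.pure (c i b)) (FeasibleFun.snd
    (FeasibleFun.id (s := fun j : Σ i, (PMF.iter (f i) (k i) (b₀ i)).support => s j.1)
      (x := fun j => .pair (x j.1) (c j.1 j.2.1)) (hall.size_output.reindex
      fun j : (Σ i, (PMF.iter (f i) (k i) (b₀ i)).support) => ⟨j.1, _, by
      rw [PMF.mem_support_map_iff]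
      exact ⟨j.2.1, j.2.2, rfl⟩⟩)))
  exact this.congr fun i => rfl

end Feasible

theorem FeasibleFun.loop {ι : Type} {s : ι → ℕ} {x : ι → Data} {β : ι → Type}
    {c : ∀ i, β i → Data} {k : ι → ℕ} {f : ∀ i, β i → β i}
    {b₀ : ∀ i, β i} (P : ∀ i, ℕ → β i → Prop) (hk : FeasibleFun s x fun i => .num (k i))
    (hkb : PolyBdd s k) (h₀ : FeasibleFun s x fun i => c i (b₀ i)) (hP₀ : ∀ i, P i 0 (b₀ i))
    (hP : ∀ i j b, j < k i → P i j b → P i (j + 1) (f i b))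
    (hsize : PolyBdd (ι := Σ i, {b : β i // ∃ j < k i, P i j b}) (fun j => s j.1)
      fun j => (c j.1 j.2.1).size)
    (hf : ∀ (s' : (Σ i, {b : β i // ∃ j < k i, P i j b}) → ℕ)
      (x' : (Σ i, {b : β i // ∃ j < k i, P i j b}) → Data),
      (∀ f, FeasibleFun s x f → FeasibleFun s' x' fun j => f j.1) →
      (FeasibleFun s' x' fun j => c j.1 j.2.1) →
      (∀ f, PolyBdd s f → PolyBdd s' fun j => f j.1) →
      FeasibleFun s' x' fun j => c j.1 (f j.1 j.2.1)) :
    FeasibleFun s x fun i => c i ((f i)^[k i] (b₀ i)) :=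
  (Feasible.loop (f := fun i b => PMF.pure (f i b)) P hk hkb h₀ hP₀ (fun i j b hj hb b' hb' => by
    rw [PMF.mem_support_pure_iff] at hb'
    exact hb' ▸ hP i j b hj hb) hsize fun s' x' w v u => Feasible.congr (hf s' x' w v u) fun j => by
      rw [PMF.pure_map]).congr fun i => by rw [PMF.iter_pure, PMF.pure_map]

/-! ## Lists and vectors -/

/-- The code of a list, for a given way to code its entries. -/
def codeList {α : Type} (c : α → Data) (l : List α) : Data :=
  l.foldr (fun a d => .pair (c a) d) (.num 0)

section codeList

variable {α : Type} (c : α → Data)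

theorem length_le_size_codeList (l : List α) : l.length ≤ (codeList c l).size := by
  induction l with
  | nil => simp
  | cons a l ih => simp only [codeList, List.foldr_cons, Data.size, List.length_cons] at *; omega

theorem size_codeList_le {l : List α} {m : ℕ} (h : ∀ a ∈ l, (c a).size ≤ m) :
    (codeList c l).size ≤ l.length * (m + 1) + 1 := by
  induction l with
  | nil => simp [codeList, Data.size]
  | cons a l ih =>
    have h₁ := ih fun b hb => h b (List.mem_cons_of_mem _ hb)
    have h₂ := h a List.mem_cons_self
    simp only [codeList, List.foldr_cons, Data.size, List.length_cons, add_mul, one_mul] at *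
    omega

theorem right_iterate_codeList (l : List α) {m : ℕ} (h : m ≤ l.length) :
    Data.right^[m] (codeList c l) = codeList c (l.drop m) := by
  induction m generalizing l with
  | zero => simp
  | succ m ih =>
    cases l with
    | nil => simp at h
    | cons a l => exact ih l (by simpa using h)

end codeList

/-! ### Independent sampling of vectors -/

/-- Independent sampling of the entries of a list. -/
noncomputable def sampleList {α : Type} : List (PMF α) → PMF (List α)
  | [] => PMF.pure []
  | p :: l => p.bind fun a => (sampleList l).map fun v => a :: v

section sampling

variable {α β : Type} {n : ℕ}

theorem sampleVec_succ (f : Fin (n + 1) → PMF α) : sampleVec f =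
    (f 0).bind fun a => (sampleVec fun i => f i.succ).bind fun v => PMF.pure (Fin.cons a v) := rfl

theorem map_ofFn_sampleVec (f : Fin n → PMF α) :
    (sampleVec f).map List.ofFn = sampleList (List.ofFn f) := by
  induction n with
  | zero => simp [sampleVec, sampleList, PMF.pure_map]
  | succ n ih =>
    rw [sampleVec_succ, List.ofFn_succ, sampleList, ← ih, PMF.map_bind]
    simp only [PMF.map_bind, PMF.pure_map, PMF.map_comp]
    congr 1
    ext1 a
    rw [← PMF.bind_pure_comp]
    congr 1
    ext1 v
    simp [List.ofFn_succ]

theorem length_of_mem_support_sampleList {l : List (PMF α)} {v : List α}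
    (h : v ∈ (sampleList l).support) : v.length = l.length := by
  induction l generalizing v with
  | nil =>
    rw [sampleList, PMF.mem_support_pure_iff] at h
    simp [h]
  | cons p l ih =>
    rw [sampleList, PMF.mem_support_bind_iff] at h
    obtain ⟨a, -, h⟩ := h
    rw [PMF.mem_support_map_iff] at h
    obtain ⟨w, hw, rfl⟩ := h
    simp [ih hw]

theorem sampleVec_pure (v : Fin n → α) : (sampleVec fun i => PMF.pure (v i)) = PMF.pure v := by
  induction n with
  | zero =>
    rw [sampleVec]
    congr 1
    exact Subsingleton.elim _ _
  | succ n ih =>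
    rw [sampleVec_succ, PMF.pure_bind, ih fun i => v i.succ, PMF.pure_bind]
    congr 1
    exact Fin.cons_self_tail v

/-- Independence as a product formula. Exchanging the law of one entry or permuting the entries
becomes a manipulation of finite products. -/
theorem sampleVec_apply (f : Fin n → PMF α) (v : Fin n → α) : sampleVec f v = ∏ i, f i (v i) := by
  classical
  induction n with
  | zero =>
    rw [sampleVec, Subsingleton.elim v Fin.elim0]
    simp
  | succ n ih =>
    rw [sampleVec_succ, PMF.bind_apply, tsum_eq_single (v 0), PMF.bind_apply,
      tsum_eq_single (fun i => v i.succ), ih, Fin.prod_univ_succ]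
    · rw [PMF.pure_apply, if_pos (by ext i; cases i using Fin.cases <;> rfl), mul_one]
    · intro w hw
      rw [PMF.pure_apply, if_neg, mul_zero]
      intro h
      exact hw (by rw [h]; ext i; simp)
    · intro a ha
      refine mul_eq_zero_of_right _ ?_
      rw [PMF.bind_apply, ENNReal.tsum_eq_zero]
      intro w
      rw [PMF.pure_apply, if_neg, mul_zero]
      rintro rfl
      exact ha (by simp)

/-- Drawing the parameter of one entry first. -/
theorem bind_sampleVec_update [DecidableEq (Fin n)] (p : PMF β) (f : Fin n → PMF α) (i : Fin n)
    (ν : β → PMF α) : (p.bind fun b => sampleVec (Function.update f i (ν b))) =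
      sampleVec (Function.update f i (p.bind ν)) := by
  ext v
  -- The density is linear in the factor that belongs to entry `i`, so averaging over `b` affects
  -- this factor only.
  have h : ∀ q : PMF α, sampleVec (Function.update f i q) v =
      q (v i) * ∏ j ∈ Finset.univ.erase i, f j (v j) := by
    intro q
    rw [sampleVec_apply, ← Finset.mul_prod_erase _ _ (Finset.mem_univ i), Function.update_self]
    congr 1
    refine Finset.prod_congr rfl fun j hj => ?_
    rw [Function.update_of_ne (Finset.ne_of_mem_erase hj)]
  simp only [PMF.bind_apply, h, ← ENNReal.tsum_mul_right, mul_assoc]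

theorem PMF.map_equiv_apply (p : PMF α) (e : α ≃ β) (b : β) : p.map e b = p (e.symm b) := by
  classical
  rw [PMF.map_apply, tsum_eq_single (e.symm b)]
  · simp
  · intro a ha
    rw [if_neg]
    rintro rfl
    simp at ha

/-- Independent identically distributed entries can be permuted. -/
theorem map_perm_sampleVec (p : PMF α) (σ : Equiv.Perm (Fin n)) :
    (sampleVec fun _ => p).map (fun v i => v (σ i)) = sampleVec fun _ : Fin n => p := by
  ext v
  have := PMF.map_equiv_apply (sampleVec fun _ : Fin n => p) (Equiv.arrowCongr σ.symm (.refl α)) v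
  refine Eq.trans ?_ (this.trans ?_)
  · rfl
  · rw [sampleVec_apply, sampleVec_apply]
    exact Equiv.prod_comp σ.symm fun i => p (v i)

/-- Sampling the entries of a vector from the last one to the first one. -/
theorem iter_cons_eq_sampleVec (μ : Fin n → PMF α) :
    PMF.iter (fun l : List α => if h : n - 1 - l.length < n then
      (μ ⟨n - 1 - l.length, h⟩).map fun a => a :: l else PMF.pure l) n [] =
      (sampleVec μ).map List.ofFn := by
  -- After `j` rounds the list consists of the last `j` entries, and the entry with index n - 1 - j
  -- is drawn next.
  have key : ∀ j ≤ n, PMF.iter (fun l : List α => if h : n - 1 - l.length < n then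
      (μ ⟨n - 1 - l.length, h⟩).map fun a => a :: l else PMF.pure l) j [] =
      sampleList ((List.ofFn μ).drop (n - j)) := by
    intro j
    induction j with
    | zero =>
      intro _
      rw [List.drop_eq_nil_of_le (by simp)]
      rfl
    | succ j ih =>
      intro hj
      have hlt : n - (j + 1) < (List.ofFn μ).length := by simp; omega
      rw [PMF.iter_succ, ih (by omega), List.drop_eq_getElem_cons hlt, sampleList,
        show n - (j + 1) + 1 = n - j by omega]
      simp only [← PMF.bind_pure_comp]
      -- The loop draws the new entry after the entries that follow it, `sampleList` draws it before
      -- them.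
      rw [PMF.bind_comm]
      refine PMF.bind_congr_support fun l hl => ?_
      have hl := length_of_mem_support_sampleList hl
      simp only [List.length_drop, List.length_ofFn] at hl
      rw [dif_pos (by omega)]
      simp only [List.getElem_ofFn]
      congr 2
      ext1
      simp only
      omega
  rw [key n le_rfl, map_ofFn_sampleVec]
  simp

end sampling

/-! ### Programs for lists and vectors -/

section

variable {ι : Type} {s : ι → ℕ} {x : ι → Data} {α : ι → Type} {c : ∀ i, α i → Data}
  {n m : ι → ℕ} {l : ∀ i, List (α i)}

/-- The program takes `m i` tails and then the head. Tails are never longer than the list, which is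
the invariant of the loop. -/
theorem FeasibleFun.nth (hl : FeasibleFun s x fun i => codeList (c i) (l i))
    (hm : FeasibleFun s x fun i => .num (m i)) (h : ∀ i, m i < (l i).length) :
    FeasibleFun s x fun i => c i ((l i)[m i]'(h i)) := by
  have h₁ := FeasibleFun.loop (β := fun _ => Data) (c := fun _ d => d) (k := m)
    (f := fun _ => Data.right) (b₀ := fun i => codeList (c i) (l i))
    (fun i _ d => d.size ≤ (codeList (c i) (l i)).size) hm
    (hl.size_output.mono fun i => (h i).le.trans (length_le_size_codeList _ _)) hl
    (fun _ => le_rfl) (fun i j d _ hd => le_trans (by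
      cases d with
      | num n => simp [Data.right, Data.size]
      | pair a b => simp [Data.right, Data.size]; omega) hd)
    ((hl.size_output.reindex Sigma.fst).mono fun ⟨_, _, _, _, h⟩ => h)
    fun s' x' w v u => FeasibleFun.of_basic .snd Data.right rfl v (v.size_output.mono fun j => by
      cases j.2.1 with
      | num n => simp [Data.right, Data.size]
      | pair a b => simp [Data.right, Data.size]; omega)
  have h₂ : FeasibleFun s x fun i => .pair (c i ((l i)[m i]'(h i)))
      (codeList (c i) ((l i).drop (m i + 1))) := h₁.congr fun i => by
    rw [right_iterate_codeList _ _ (h i).le, List.drop_eq_getElem_cons (h i)]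
    rfl
  exact h₂.fst

theorem FeasibleFun.apply {v : ∀ i, Fin (n i) → α i} {j : ∀ i, Fin (n i)}
    (hv : FeasibleFun s x fun i => codeList (c i) (List.ofFn (v i)))
    (hj : FeasibleFun s x fun i => .num (j i)) : FeasibleFun s x fun i => c i (v i (j i)) :=
  (hv.nth hj fun i => by simp).congr fun i => by simp

/-- Codes of lists grow at the front, so the entries are drawn from the last to the first. The
length of the partial list is stored with it and tells which entry comes next. -/
theorem Feasible.sampleVec {μ : ∀ i, Fin (n i) → PMF (α i)}
    (hn : FeasibleFun s x fun i => .num (n i)) (hnb : PolyBdd s n)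
    (hμ : ∀ (s' : (Σ i, Fin (n i)) → ℕ) (x' : (Σ i, Fin (n i)) → Data),
      (∀ f, FeasibleFun s x f → FeasibleFun s' x' fun j => f j.1) →
      (FeasibleFun s' x' fun j => .num j.2) →
      (∀ f, PolyBdd s f → PolyBdd s' fun j => f j.1) →
      Feasible s' x' fun j => (μ j.1 j.2).map (c j.1)) :
    Feasible s x fun i => (sampleVec (μ i)).map fun v => codeList (c i) (List.ofFn v) := by
  have hid := FeasibleFun.id (s := fun j : Σ i, Fin (n i) => s j.1)
    (x := fun j => .pair (x j.1) (.num j.2))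
    ((((hn.size_input.add hnb).add (.const 2)).reindex Sigma.fst).mono fun j => by
      have := (Nat.size_le_self j.2).trans j.2.2.le
      simp only [Data.size]; omega)
  have hbase := hμ _ _ (fun f hf => hid.fst.comp_fun (hf.reindex Sigma.fst)) hid.snd
    fun f hf => hf.reindex Sigma.fst
  obtain ⟨t, ht⟩ := hbase.size_output
  -- The invariant remembers that each entry is a possible value of some `μ i r`, because this
  -- bounds its size.
  let P : ∀ i, ℕ → List (α i) → Prop := fun i j l =>
    l.length = j ∧ ∀ a ∈ l, ∃ r, a ∈ (μ i r).support
  have hsize : PolyBdd (ι := Σ i, {l : List (α i) // ∃ j < n i, P i j l}) (fun j => s j.1)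
      fun j => (Data.pair (.num j.2.1.length) (codeList (c j.1) j.2.1)).size := by
    refine ((((hnb.add (hnb.mul ((PolyBdd.self.eval t).add (.const 1)))).add
      (.const 3))).reindex Sigma.fst).mono ?_
    rintro ⟨i, l, k, hk, rfl, hl⟩
    have h₁ := Nat.size_le_self l.length
    have h₂ := size_codeList_le (c i) (l := l) (m := t.eval (s i)) fun a ha => by
      obtain ⟨r, hr⟩ := hl a ha
      refine ht ⟨⟨i, r⟩, _, ?_⟩
      rw [PMF.mem_support_map_iff]
      exact ⟨a, hr, rfl⟩
    have h₃ := Nat.mul_le_mul_right (t.eval (s i) + 1) hk.le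
    simp only [Data.size]
    omega
  have := Feasible.loop (β := fun i => List (α i))
    (c := fun i l => .pair (.num l.length) (codeList (c i) l)) (k := n)
    (f := fun i l => if h : n i - 1 - l.length < n i then
      (μ i ⟨n i - 1 - l.length, h⟩).map fun a => a :: l else PMF.pure l)
    (b₀ := fun i => []) P hn hnb (FeasibleFun.const hn.size_input (.pair (.num 0) (.num 0)))
    (fun i => ⟨rfl, by simp⟩)
    (by
      rintro i j l hj ⟨rfl, hl⟩ l' hl'
      rw [dif_pos (by omega), PMF.mem_support_map_iff] at hl'
      obtain ⟨a, ha, rfl⟩ := hl'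
      refine ⟨rfl, fun b hb => ?_⟩
      rcases List.mem_cons.1 hb with rfl | hb
      · exact ⟨_, ha⟩
      · exact hl b hb) hsize (by
      intro s' x' w v u
      have hlt : ∀ j : Σ i, {l : List (α i) // ∃ j < n i, P i j l},
          n j.1 - 1 - j.2.1.length < n j.1 := fun ⟨i, l, k, hk, h⟩ => by simp only; omega
      have hidx := ((w _ hn).sub (v.fst.numeral 1)).sub v.fst
      have h₁ := ((w _ (FeasibleFun.id hn.size_input)).pair hidx).comp
        ((hbase.reindex fun j : (Σ i, {l : List (α i) // ∃ j < n i, P i j l}) =>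
          ⟨j.1, n j.1 - 1 - j.2.1.length, hlt j⟩).rescale (u _ .self))
      have h₂ := h₁.bind (ν := fun (j : Σ i, {l : List (α i) // ∃ j < n i, P i j l})
        (a : α j.1) => PMF.pure (.pair (.num (j.2.1.length + 1))
        (.pair (c j.1 a) (codeList (c j.1) j.2.1)))) fun s'' x'' w' v' u' =>
        (((w' _ v.fst).add (v'.numeral 1)).pair (v'.pair (w' _ v.snd)))
      refine h₂.congr fun j => ?_
      rw [dif_pos (hlt j), PMF.map_comp]
      rfl)
  have h₂ := this.bind (ν := fun i l => PMF.pure (codeList (c i) l)) fun s' x' w v u => v.snd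
  refine h₂.congr fun i => ?_
  rw [iter_cons_eq_sampleVec, PMF.bind_map]
  rfl

/-- The case of point masses in `Feasible.sampleVec`. -/
theorem FeasibleFun.ofFn {v : ∀ i, Fin (n i) → α i}
    (hn : FeasibleFun s x fun i => .num (n i)) (hnb : PolyBdd s n)
    (hv : ∀ (s' : (Σ i, Fin (n i)) → ℕ) (x' : (Σ i, Fin (n i)) → Data),
      (∀ f, FeasibleFun s x f → FeasibleFun s' x' fun j => f j.1) →
      (FeasibleFun s' x' fun j => .num j.2) →
      (∀ f, PolyBdd s f → PolyBdd s' fun j => f j.1) →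
      FeasibleFun s' x' fun j => c j.1 (v j.1 j.2)) :
    FeasibleFun s x fun i => codeList (c i) (List.ofFn (v i)) :=
  (Feasible.sampleVec (μ := fun i j => PMF.pure (v i j)) hn hnb fun s' x' w v u =>
    Feasible.congr (hv s' x' w v u) fun j => by rw [PMF.pure_map]).congr fun i => by
      rw [sampleVec_pure, PMF.pure_map]

/-- Nested pairs cannot be extended at their inner end in one step, so the list is rebuilt entry by
entry. This needs its length as a number, which is why lengths are stored along with lists in all
states below. -/
theorem FeasibleFun.append {a : ∀ i, α i} (hlen : FeasibleFun s x fun i => .num (l i).length)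
    (hl : FeasibleFun s x fun i => codeList (c i) (l i)) (ha : FeasibleFun s x fun i => c i (a i)) :
    FeasibleFun s x fun i => codeList (c i) (l i ++ [a i]) := by
  have := FeasibleFun.ofFn (c := c) (n := fun i => (l i).length + 1)
    (v := fun i j => if h : j < (l i).length then (l i)[j] else a i) (hlen.add (hlen.numeral 1))
    ((hl.size_output.mono fun i => length_le_size_codeList _ _).add (.const 1))
    fun s' x' w v u => by
      refine FeasibleFun.by_cases (v.lt (w _ hlen))
        ((((w _ hl).reindex _).nth (v.reindex _) fun j => j.2).congr fun j => ?_)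
        (((w _ ha).reindex _).congr fun j => ?_)
      · rw [dif_pos j.2]
        rfl
      · rw [dif_neg j.2]
  refine this.congr fun i => ?_
  congr 1
  refine List.ext_getElem (by simp) fun j h₁ h₂ => ?_
  simp only [List.getElem_ofFn, List.getElem_append]
  split <;> simp

/-- The inverse of a permutation is found by exhaustive search. -/
theorem FeasibleFun.perm_symm {σ : ∀ i, Equiv.Perm (Fin (n i))} {r : ∀ i, Fin (n i)}
    (hn : FeasibleFun s x fun i => .num (n i)) (hnb : PolyBdd s n)
    (hr : FeasibleFun s x fun i => .num (r i))
    (hσ : ∀ (ι' : Type) (φ : ι' → ι) (s' : ι' → ℕ) (x' : ι' → Data) (k : ∀ j, Fin (n (φ j))),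
      (∀ f, FeasibleFun s x f → FeasibleFun s' x' fun j => f (φ j)) →
      (FeasibleFun s' x' fun j => .num (k j)) →
      (∀ f, PolyBdd s f → PolyBdd s' fun j => f (φ j)) →
      FeasibleFun s' x' fun j => .num (σ (φ j) (k j))) :
    FeasibleFun s x fun i => .num ((σ i).symm (r i)) := by
  -- A state consists of the number of candidates tried and of the preimage found, which is 0 as
  -- long as there is none.
  let f : ∀ i, ℕ × ℕ → ℕ × ℕ := fun i b =>
    if h : b.1 < n i then (b.1 + 1, if σ i ⟨b.1, h⟩ = r i then b.1 else b.2) else b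
  have hf : ∀ i m, m ≤ n i →
      (f i)^[m] (0, 0) = (m, if ((σ i).symm (r i) : ℕ) < m then ((σ i).symm (r i) : ℕ) else 0) := by
    intro i m
    induction m with
    | zero => simp
    | succ m ih =>
      intro hm
      rw [Function.iterate_succ_apply', ih (by omega)]
      simp only [f]
      rw [dif_pos (by omega)]
      congr 1
      by_cases h : σ i ⟨m, hm⟩ = r i
      · rw [if_pos h, ← h]
        simp
      · rw [if_neg h]
        have : ((σ i).symm (r i) : ℕ) ≠ m := by
          rintro rfl
          simp at h
        split_ifs <;> first | rfl | omega
  have := FeasibleFun.loop (β := fun _ => ℕ × ℕ) (c := fun _ b => .pair (.num b.1) (.num b.2))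
    (k := n) (f := f) (b₀ := fun _ => (0, 0)) (fun i j b => b.1 = j ∧ b.2 ≤ n i) hn hnb
    (FeasibleFun.const hn.size_input (.pair (.num 0) (.num 0))) (fun i => ⟨rfl, Nat.zero_le _⟩)
    (by
      rintro i j ⟨a, b⟩ hj ⟨rfl, hb⟩
      simp only [f] at *
      rw [dif_pos hj]
      refine ⟨rfl, ?_⟩
      dsimp only
      split_ifs
      · exact hj.le
      · exact hb) ((((hnb.add hnb).add (.const 3)).reindex Sigma.fst).mono (by
      rintro ⟨i, ⟨a, b⟩, j, hj, rfl, hb⟩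
      have h₁ := Nat.size_le_self a
      have h₂ := Nat.size_le_self b
      simp only [Data.size] at *
      omega)) (by
      intro s' x' w v u
      have hlt : ∀ j : Σ i, {b : ℕ × ℕ // ∃ j < n i, b.1 = j ∧ b.2 ≤ n i}, j.2.1.1 < n j.1 :=
        fun ⟨i, b, j, hj, hb⟩ => by simp only; omega
      have hk := hσ _ Sigma.fst s' x' (fun j => ⟨j.2.1.1, hlt j⟩) w v.fst u
      refine ((v.fst.add (v.fst.numeral 1)).pair (g := fun j => .num
        (if σ j.1 ⟨j.2.1.1, hlt j⟩ = r j.1 then j.2.1.1 else j.2.1.2))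
        (FeasibleFun.by_cases (hk.eq_num (w _ hr)) ((v.fst.reindex _).congr fun j => ?_)
          ((v.snd.reindex _).congr fun j => ?_))).congr fun j => ?_
      · rw [if_pos (Fin.ext j.2)]
      · rw [if_neg fun h => j.2 (congrArg Fin.val h)]
      · simp only [f]
        rw [dif_pos (hlt j)])
  refine (this.snd).congr fun i => ?_
  rw [hf i _ le_rfl, if_pos ((σ i).symm (r i)).2]

end

/-! ## Programs for the BGN scheme -/

theorem Feasible.of_realizes {ι : Type} {α β : ι → Type} [∀ i, Coded (α i)] [∀ i, Coded (β i)]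
    {p : Prog} {t : Polynomial ℕ} {m : ι → ℕ} {a : ∀ i, α i} {μ : ∀ i, PMF (β i)}
    (h : ∀ i, p.Realizes (a i) (μ i) (t.eval (m i))) :
    Feasible m (fun i => Coded.code (a i)) fun i => (μ i).map Coded.code :=
  ⟨p, t, h⟩

theorem FeasibleFun.of_realizes {ι : Type} {α β : ι → Type} [∀ i, Coded (α i)] [∀ i, Coded (β i)]
    {p : Prog} {t : Polynomial ℕ} {m : ι → ℕ} {a : ∀ i, α i} {b : ∀ i, β i}
    (h : ∀ i, p.Realizes (a i) (PMF.pure (b i)) (t.eval (m i))) :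
    FeasibleFun m (fun i => Coded.code (a i)) fun i => Coded.code (b i) :=
  (Feasible.of_realizes h).congr fun i => by rw [PMF.pure_map]

theorem PMF.map_uniformOfFintype_equiv {α β : Type} [Fintype α] [Fintype β] [Nonempty α]
    [Nonempty β] (e : α ≃ β) : (uniformOfFintype α).map e = uniformOfFintype β := by
  ext b
  rw [map_equiv_apply, uniformOfFintype_apply, uniformOfFintype_apply, Fintype.card_congr e]

section

variable {ι : Type} {s : ι → ℕ} {x : ι → Data} {κ : ι → ℕ}

/-- Repeated doubling. The result has κ + 1 bits, so it is essential that `hκb` bounds κ itself and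
not just its bit length. -/
theorem FeasibleFun.two_pow (hκ : FeasibleFun s x fun i => .num (κ i)) (hκb : PolyBdd s κ) :
    FeasibleFun s x fun i => .num (2 ^ κ i) := by
  have h : ∀ k, (fun a : ℕ => a + a)^[k] 1 = 2 ^ k := by
    intro k
    induction k with
    | zero => rfl
    | succ k ih => rw [Function.iterate_succ_apply', ih]; ring
  have := FeasibleFun.loop (β := fun _ => ℕ) (c := fun _ => .num) (k := κ)
    (f := fun _ a => a + a) (b₀ := fun _ => 1) (fun _ j a => a = 2 ^ j) hκ hκb (hκ.numeral 1)
    (fun _ => rfl) (by rintro _ j _ _ rfl; ring)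
    (((hκb.add (.const 2)).reindex Sigma.fst).mono (by
      rintro ⟨i, _, j, hj, rfl⟩
      simp only [Data.size, Nat.size_pow]
      omega)) fun s' x' w v u => v.add v
  exact this.congr fun i => by rw [h]

theorem Feasible.randomBits (hκ : FeasibleFun s x fun i => .num (κ i)) (hκb : PolyBdd s κ) :
    Feasible s x fun i => (randomBits (κ i)).map Coded.code := by
  refine (uniformFin (hκ.two_pow hκb)).congr fun i => ?_
  rw [_root_.randomBits, ← PMF.map_uniformOfFintype_equiv
    (⟨BitVec.ofFin, BitVec.toFin, fun _ => rfl, fun _ => rfl⟩ : Fin (2 ^ κ i) ≃ BitVec (κ i)),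
    PMF.map_comp]
  rfl

end

namespace BilinearGenerator

variable {𝒢 : BilinearGenerator}

/-- The field `bilinear` speaks of powers only; since the group is cyclic, all arguments are powers
of one generator. -/
theorem e_mul_right {i : 𝒢.Inst} (u v w : 𝒢.G i) : 𝒢.e u (v * w) = 𝒢.e u v * 𝒢.e u w := by
  obtain ⟨γ, hγ⟩ := (𝒢.cyclicG i).exists_generator
  obtain ⟨a, rfl⟩ := hγ u
  obtain ⟨b, rfl⟩ := hγ v
  obtain ⟨c, rfl⟩ := hγ w
  simp only [← zpow_add, 𝒢.bilinear, mul_add]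

theorem e_pow_right {i : 𝒢.Inst} (u v : 𝒢.G i) (k : ℕ) : 𝒢.e u (v ^ k) = 𝒢.e u v ^ k := by
  have := 𝒢.bilinear u v 1 k
  simpa using this

/-- An encryption in `G₁` is the pairing of `g` with an encryption in `G`. -/
theorem encG₁_eq_map (pk : 𝒢.PublicKey) (a : ℕ) : encG₁ pk a = (encG pk a).map (𝒢.e pk.g) := by
  simp only [encG₁, encG, PMF.do_bind, PMF.do_pure, PMF.map_bind, PMF.pure_map, e_mul_right,
    e_pow_right]

theorem encG_eq (pk : 𝒢.PublicKey) (a : ℕ) : encG pk a =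
    (PMF.uniformOfFintype (Fin (𝒢.n pk.inst))).map
      fun r : Fin (𝒢.n pk.inst) => pk.g ^ a * pk.h ^ (r : ℕ) := rfl

/-- The law of the public keys. -/
noncomputable def pkGen (𝒢 : BilinearGenerator) (κ : ℕ) : PMF 𝒢.PublicKey :=
  (𝒢.bgnGen κ).map Prod.fst

theorem pkGen_eq (κ : ℕ) : 𝒢.pkGen κ = (𝒢.gen κ).bind fun i =>
    (PMF.uniformOfFintype (𝒢.G i)).bind fun g =>
      (PMF.uniformOfFintype (Fin (𝒢.n i))).map fun r => ⟨i, g, (g ^ (r : ℕ)) ^ 𝒢.q₂ i⟩ := by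
  simp only [pkGen, bgnGen, PMF.do_bind, PMF.do_pure, PMF.map_bind, PMF.pure_map]
  rfl

/-- The efficiency assumptions on the group operations hold only for instances that `gen` can
produce. -/
theorem inst_mem_support {κ : ℕ} {pk : 𝒢.PublicKey} (h : pk ∈ (𝒢.pkGen κ).support) :
    pk.inst ∈ (𝒢.gen κ).support := by
  rw [pkGen_eq, PMF.mem_support_bind_iff] at h
  obtain ⟨i, hi, h⟩ := h
  rw [PMF.mem_support_bind_iff] at h
  obtain ⟨g, -, h⟩ := h
  rw [PMF.mem_support_map_iff] at h
  obtain ⟨r, -, rfl⟩ := h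
  exact hi

section

variable {ι : Type} {s : ι → ℕ} {x : ι → Data} {κ : ι → ℕ} {I : ι → 𝒢.Inst}

theorem feasible_mul (hI : ∀ i, I i ∈ (𝒢.gen (κ i)).support) (hκ : PolyBdd s κ)
    {a b : ∀ i, 𝒢.G (I i)} (hd : FeasibleFun s x fun i => 𝒢.desc (I i))
    (ha : FeasibleFun s x fun i => Coded.code (a i))
    (hb : FeasibleFun s x fun i => Coded.code (b i)) :
    FeasibleFun s x fun i => Coded.code (a i * b i) := by
  obtain ⟨p, t, hp⟩ := 𝒢.mulG_efficient
  exact (hd.pair (ha.pair hb)).comp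
    ((FeasibleFun.of_realizes fun i => hp (κ i) (I i) (hI i) (a i) (b i)).rescale hκ)

theorem feasible_one (hI : ∀ i, I i ∈ (𝒢.gen (κ i)).support) (hκ : PolyBdd s κ)
    (hd : FeasibleFun s x fun i => 𝒢.desc (I i)) :
    FeasibleFun s x fun i => Coded.code (1 : 𝒢.G (I i)) := by
  obtain ⟨p, t, hp⟩ := 𝒢.oneG_efficient
  exact hd.comp ((FeasibleFun.of_realizes fun i => hp (κ i) (I i) (hI i)).rescale hκ)

theorem feasible_pairing (hI : ∀ i, I i ∈ (𝒢.gen (κ i)).support) (hκ : PolyBdd s κ)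
    {a b : ∀ i, 𝒢.G (I i)} (hd : FeasibleFun s x fun i => 𝒢.desc (I i))
    (ha : FeasibleFun s x fun i => Coded.code (a i))
    (hb : FeasibleFun s x fun i => Coded.code (b i)) :
    FeasibleFun s x fun i => Coded.code (𝒢.e (a i) (b i)) := by
  obtain ⟨p, t, hp⟩ := 𝒢.e_efficient
  exact (hd.pair (ha.pair hb)).comp
    ((FeasibleFun.of_realizes fun i => hp (κ i) (I i) (hI i) (a i) (b i)).rescale hκ)

/-- The multiplication program pays for reading its arguments. So multiplying an element by itself
shows that its code has polynomial length, although no such length bound is assumed. -/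
theorem size_code_bounded (hI : ∀ i, I i ∈ (𝒢.gen (κ i)).support) (hκ : PolyBdd s κ) :
    PolyBdd (ι := Σ i, 𝒢.G (I i)) (fun j => s j.1) fun j => (Coded.code j.2).size := by
  obtain ⟨p, t, hp⟩ := 𝒢.mulG_efficient
  have := (FeasibleFun.of_realizes fun j : Σ i, 𝒢.G (I i) =>
    hp (κ j.1) (I j.1) (hI j.1) j.2 j.2).rescale (s' := fun j => s j.1) (hκ.reindex Sigma.fst)
  refine this.size_input.mono fun j => ?_
  simp only [Coded.code, Data.size]
  omega

/-- Repeated squaring. -/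
theorem feasible_pow (hI : ∀ i, I i ∈ (𝒢.gen (κ i)).support) (hκ : PolyBdd s κ)
    {a : ∀ i, 𝒢.G (I i)} {e : ι → ℕ} (hd : FeasibleFun s x fun i => 𝒢.desc (I i))
    (ha : FeasibleFun s x fun i => Coded.code (a i)) (he : FeasibleFun s x fun i => .num (e i)) :
    FeasibleFun s x fun i => Coded.code (a i ^ e i) := by
  -- A state (u, v, m) stands for u * v ^ m, which every round preserves while it halves m.
  let f : ∀ i, 𝒢.G (I i) × 𝒢.G (I i) × ℕ → 𝒢.G (I i) × 𝒢.G (I i) × ℕ := fun i b =>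
    (if b.2.2 % 2 = 1 then b.1 * b.2.1 else b.1, b.2.1 * b.2.1, b.2.2 / 2)
  have hf : ∀ i k b, b.2.2 < 2 ^ k → ((f i)^[k] b).1 = b.1 * b.2.1 ^ b.2.2 := by
    intro i k
    induction k with
    | zero => intro b hb; simp_all
    | succ k ih =>
      rintro ⟨u, v, m⟩ hb
      rw [Function.iterate_succ_apply, ih]
      · simp only [f]
        conv_rhs => rw [← Nat.mod_add_div m 2]
        rw [pow_add, pow_mul, pow_two]
        rcases Nat.mod_two_eq_zero_or_one m with h | h <;> simp [h, mul_assoc]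
      · simp only [f]
        simp only [pow_succ] at hb
        omega
  have hone := feasible_one hI hκ hd
  have := FeasibleFun.loop (β := fun i => 𝒢.G (I i) × 𝒢.G (I i) × ℕ)
    (c := fun _ => Coded.code) (k := fun i => Nat.size (e i)) (f := f)
    (b₀ := fun i => (1, a i, e i)) (fun i _ b => b.2.2 ≤ e i) he.natSize he.size_num
    (hone.pair (ha.pair he)) (fun _ => le_rfl)
    (fun i j b _ hb => (Nat.div_le_self _ _).trans hb) (by
      have h₁ := size_code_bounded hI hκ
      let J := Σ i, {b : 𝒢.G (I i) × 𝒢.G (I i) × ℕ // ∃ j < Nat.size (e i), b.2.2 ≤ e i}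
      refine (((h₁.reindex fun j : J => ⟨j.1, j.2.1.1⟩).add
        (h₁.reindex fun j : J => ⟨j.1, j.2.1.2.1⟩)).add
        ((he.size_num.add (.const 3)).reindex fun j : J => j.1)).mono ?_
      rintro ⟨i, ⟨u, v, m⟩, j, hj, hm⟩
      have := Nat.size_le_size hm
      simp only [Coded.code, Data.size] at *
      omega) (by
      intro s' x' w v u
      have hI' := fun j : Σ i, {b : 𝒢.G (I i) × 𝒢.G (I i) × ℕ //
        ∃ j < Nat.size (e i), b.2.2 ≤ e i} => hI j.1
      have hκ' := u _ hκ
      have hd' := w _ hd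
      have h₁ := v.fst
      have h₂ := v.snd.fst
      have h₃ := v.snd.snd
      have h₄ := feasible_mul hI' hκ' hd' h₁ h₂
      refine (FeasibleFun.by_cases ((h₃.mod (h₃.numeral 2)).eq_num (h₃.numeral 1))
        ((h₄.reindex _).congr fun j => ?_) ((h₁.reindex _).congr fun j => ?_)).pair
        ((feasible_mul hI' hκ' hd' h₂ h₂).pair (h₃.div (h₃.numeral 2)))
      · simp only [f]
        rw [if_pos j.2]
      · simp only [f]
        rw [if_neg j.2])
  exact this.fst.congr fun i => by
    have := hf i (Nat.size (e i)) (1, a i, e i) (Nat.lt_size_self _)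
    rw [this, one_mul]

theorem feasible_encG {pk : ι → 𝒢.PublicKey} {a : ι → ℕ}
    (hpk : ∀ i, pk i ∈ (𝒢.pkGen (κ i)).support) (hκ : PolyBdd s κ)
    (hp : FeasibleFun s x fun i => Coded.code (pk i)) (ha : FeasibleFun s x fun i => .num (a i)) :
    Feasible s x fun i => (encG (pk i) (a i)).map Coded.code := by
  have hI := fun i => inst_mem_support (hpk i)
  have hg := feasible_pow hI hκ hp.snd.fst hp.snd.snd.fst ha
  refine ((Feasible.uniformFin (n := fun i => 𝒢.n (pk i).inst) hp.fst).map
    (g := fun i (r : Fin (𝒢.n (pk i).inst)) =>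
    Coded.code ((pk i).g ^ a i * (pk i).h ^ (r : ℕ))) fun s' x' w v u => ?_).congr
    fun i => by rw [encG_eq, PMF.map_comp]; rfl
  exact feasible_mul (fun _ => hI _) (u _ hκ) (w _ hp.snd.fst) (w _ hg)
    (feasible_pow (fun _ => hI _) (u _ hκ) (w _ hp.snd.fst) (w _ hp.snd.snd.snd) v)

theorem feasible_encG₁ {pk : ι → 𝒢.PublicKey} {a : ι → ℕ}
    (hpk : ∀ i, pk i ∈ (𝒢.pkGen (κ i)).support) (hκ : PolyBdd s κ)
    (hp : FeasibleFun s x fun i => Coded.code (pk i)) (ha : FeasibleFun s x fun i => .num (a i)) :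
    Feasible s x fun i => (encG₁ (pk i) (a i)).map Coded.code := by
  have hI := fun i => inst_mem_support (hpk i)
  refine ((feasible_encG hpk hκ hp ha).map (g := fun i u => Coded.code (𝒢.e (pk i).g u))
    fun s' x' w v u => ?_).congr fun i => by rw [encG₁_eq_map, PMF.map_comp]; rfl
  exact feasible_pairing (fun _ => hI _) (u _ hκ) (w _ hp.snd.fst) (w _ hp.snd.snd.fst) v

theorem feasible_pkGen (h : FeasibleFun s x fun i => .num (κ i)) (hκ : PolyBdd s κ) :
    Feasible s x fun i => (𝒢.pkGen (κ i)).map Coded.code := by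
  obtain ⟨p, t, hp⟩ := 𝒢.gen_efficient
  obtain ⟨q, u, hq⟩ := 𝒢.sampleG_efficient
  have h₁ : Feasible s x fun i => (𝒢.gen (κ i)).map fun i =>
      Coded.code (𝒢.q₁ i, 𝒢.q₂ i, 𝒢.desc i) :=
    h.comp (((Feasible.of_realizes fun i => hp (κ i)).rescale hκ).congr fun i => by
      rw [PMF.map_comp]; rfl)
  refine (h₁.bind (ν := fun i I => ((PMF.uniformOfFintype (𝒢.G I)).bind fun g =>
      (PMF.uniformOfFintype (Fin (𝒢.n I))).map fun r : Fin (𝒢.n I) =>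
        (⟨I, g, (g ^ (r : ℕ)) ^ 𝒢.q₂ I⟩ : 𝒢.PublicKey)).map Coded.code)
    fun s₁ x₁ w₁ v₁ u₁ => ?_).congr fun i => by rw [pkGen_eq, PMF.map_bind]
  have hd := v₁.snd.snd
  have hn := v₁.fst.mul v₁.snd.fst
  have h₂ := hd.comp ((Feasible.of_realizes fun j : Σ i, (𝒢.gen (κ i)).support =>
    hq (κ j.1) j.2.1 j.2.2).rescale (u₁ _ hκ))
  refine (h₂.bind (ν := fun j g => (PMF.uniformOfFintype (Fin (𝒢.n j.2.1))).map
    fun r : Fin (𝒢.n j.2.1) => Coded.code (⟨j.2.1, g, (g ^ (r : ℕ)) ^ 𝒢.q₂ j.2.1⟩ : 𝒢.PublicKey))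
    fun s₂ x₂ w₂ v₂ u₂ => ?_).congr fun j => by simp only [PMF.map_bind, PMF.map_comp]; rfl
  have hn₂ := w₂ _ hn
  have h₃ := Feasible.uniformFin (n := fun j : Σ j : (Σ i, (𝒢.gen (κ i)).support),
    (PMF.uniformOfFintype (𝒢.G j.2.1)).support => 𝒢.n j.1.2.1) hn₂
  refine h₃.map fun s₃ x₃ w₃ v₃ u₃ => ?_
  have hd₃ := w₃ _ (w₂ _ hd)
  have hκ₃ := u₃ _ (u₂ _ (u₁ _ hκ))
  have hI := fun j : Σ j : (Σ j : (Σ i, (𝒢.gen (κ i)).support),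
    (PMF.uniformOfFintype (𝒢.G j.2.1)).support), (PMF.uniformOfFintype (Fin (𝒢.n j.1.2.1))).support
    => j.1.1.2.2
  exact (w₃ _ hn₂).pair (hd₃.pair ((w₃ _ v₂).pair (feasible_pow hI hκ₃ hd₃
    (feasible_pow hI hκ₃ hd₃ (w₃ _ v₂) v₃) (w₃ _ (w₂ _ v₁.snd.fst)))))

end

end BilinearGenerator

/-! ## The games -/

open BilinearGenerator

/-- Without a state on the replying side, an interaction is an iteration on the list of replies and
the state of the asking side. -/
theorem interact_eq_iter {Q R : Type} (ask : List R → Data → PMF (Q × Data)) (ans : Q → PMF R)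
    (st : Data) (k : ℕ) :
    interact ask (fun (_ : Unit) v => do
      let τ ← ans v
      return (τ, ())) st () k =
    (PMF.iter (fun b : List R × Data => (ask b.1 b.2).bind fun r =>
      (ans r.1).map fun τ => (b.1 ++ [τ], r.2)) k ([], st)).map fun b => (b.1, b.2, ()) := by
  induction k with
  | zero => rw [interact, PMF.iter, PMF.pure_map]
  | succ k ih =>
    rw [interact, ih, PMF.iter_succ]
    simp only [PMF.do_bind, PMF.do_pure, PMF.bind_bind, PMF.pure_bind, ← PMF.bind_pure_comp,
      Function.comp_def]

section

variable {D : Set ℕ} {𝒢 : BilinearGenerator} {F perm : KeyedPermutation D}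
  {mask : MaskingAlgorithm D}

/-- Rows of both structures, stored at the positions given by a permutation. -/
def shuffle {pk : 𝒢.PublicKey} {N : ℕ} (σ : Equiv.Perm (Fin N)) (T : Tables 𝒢 pk N) :
    Tables 𝒢 pk N :=
  (fun i => T.1 (σ.symm i), fun i => T.2 (σ.symm i))

/-- One round of the interaction when the positions of the vertices are given by `f`. -/
noncomputable def playRound (A : (slpII 𝒢 F perm mask).Adversary) (κ : ℕ) (N : Size D)
    (f : Fin N.1 → Fin N.1) (V : (slpII 𝒢 F perm mask).View κ N)
    (b : List (Fin N.1 × BitVec κ) × Data) : PMF (List (Fin N.1 × BitVec κ) × Data) :=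
  (A.query κ N b.2 V b.1).bind fun r =>
    (randomBits κ).map fun s => (b.1 ++ [(f r.1, s)], r.2)

/-- The interaction when the positions of the vertices are given by `f`. -/
noncomputable def play (A : (slpII 𝒢 F perm mask).Adversary) (κ : ℕ) (N : Size D)
    (f : Fin N.1 → Fin N.1) (V : (slpII 𝒢 F perm mask).View κ N) (st : Data) : PMF Bool :=
  (PMF.iter (playRound A κ N f V) (A.rounds.eval κ) ([], st)).bind fun b => A.guess κ N b.2 V b.1

theorem interact_eq_play (A : (slpII 𝒢 F perm mask).Adversary) (κ : ℕ) (N : Size D)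
    (f : Fin N.1 → Fin N.1) (V : (slpII 𝒢 F perm mask).View κ N) (st : Data) :
    ((interact (fun τs st => A.query κ N st V τs) (fun (_ : Unit) v => do
      let τ ← (randomBits κ).bind fun s => PMF.pure (f v, s)
      return (τ, ())) st () (A.rounds.eval κ)).bind fun r => A.guess κ N r.2.1 V r.1) =
    play A κ N f V st := by
  have := interact_eq_iter (fun τs st => A.query κ N st V τs)
    (fun v => (randomBits κ).bind fun s => PMF.pure (f v, s)) st (A.rounds.eval κ)
  refine (congrArg (fun p => PMF.bind p fun r => A.guess κ N r.2.1 V r.1) this).trans ?_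
  rw [PMF.bind_map, play]
  congr 2
  ext1 b
  refine congrArg (PMF.bind _) (funext fun r => ?_)
  exact (PMF.map_bind _ _ _).trans (congrArg (PMF.bind _) (funext fun s => PMF.pure_map _ _))

/-- The game in which the structures are empty of information and the positions of the vertices
are given by a permutation with law `P`. -/
noncomputable def zeroGame (A : (slpII 𝒢 F perm mask).Adversary)
    (P : (κ : ℕ) → (N : Size D) → PMF (Equiv.Perm (Fin N.1))) (κ : ℕ) : PMF Bool :=
  (A.start κ).bind fun G => (zeroView 𝒢 F perm mask κ G.1.N).bind fun V =>
    (P κ G.1.N).bind fun f => play A κ G.1.N f V G.2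

theorem zeroView_eq (κ : ℕ) (N : Size D) : zeroView 𝒢 F perm mask κ N =
    (𝒢.pkGen κ).bind fun pk => (encTables (N := N.1) pk (fun _ _ => 0) (fun _ _ => 0)).map
      fun T => ⟨pk, T⟩ := by
  rw [pkGen, PMF.bind_map]
  rfl

/-- The matrices whose entries with a number less than `j` are replaced by `0`; the numbers of the
entries start with `o`. -/
def eraseBelow {N : ℕ} (o j : ℕ) (A : Fin N → Fin N → ℕ) (i c : Fin N) : ℕ :=
  if o + (i * N + c) < j then 0 else A i c

/-- The game with the first `j` entries of the two matrices replaced by `0`, for given choices of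
the keys, the graph and the masking matrix. -/
noncomputable def hybridWith (A : (slpII 𝒢 F perm mask).Adversary) (κ : ℕ) (k : BitVec κ)
    (pk : 𝒢.PublicKey) (G : SizedGraph D) (st : Data) (B : Fin G.N.1 → Fin G.N.1 → ℕ) (j : ℕ) :
    PMF Bool :=
  (encTables pk (eraseBelow 0 j G.A) (eraseBelow (G.N.1 * G.N.1) j B)).bind fun T =>
    play A κ G.N (F κ k G.N) ⟨pk, shuffle (F κ k G.N) T⟩ st

/-- The game with the first `j` entries of the two matrices replaced by `0`. -/
noncomputable def hybridGame (A : (slpII 𝒢 F perm mask).Adversary) (j κ : ℕ) : PMF Bool :=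
  (randomBits κ).bind fun k => (𝒢.pkGen κ).bind fun pk => (A.start κ).bind fun G =>
    (mask.mask G.1).bind fun B => hybridWith A κ k pk G.1 G.2 B j

/-- Nothing is erased at threshold 0. The encryption of the matrices and the trapdoors use only the
client's part of the secret key, so the BGN key pair enters through the law of the public key. -/
theorem real_eq_hybridGame (A : (slpII 𝒢 F perm mask).Adversary) (κ : ℕ) :
    SLPScheme.real A κ = hybridGame A 0 κ := by
  have h : ∀ {N : ℕ} (o : ℕ) (M : Fin N → Fin N → ℕ), eraseBelow o 0 M = M := by
    intro N o M
    ext i c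
    simp [eraseBelow]
  simp only [hybridGame, hybridWith, h, ← interact_eq_play, pkGen, PMF.bind_map]
  simp only [SLPScheme.real, slpII, PMF.do_bind, PMF.do_pure, PMF.bind_bind, PMF.pure_bind]
  rfl

/-- The rows of each structure are independent and identically distributed, so their order carries
no information. The two structures are independent and can be permuted one after the other. -/
theorem encTables_shuffle_zero (pk : 𝒢.PublicKey) {N : ℕ} (σ : Equiv.Perm (Fin N)) :
    (encTables pk (fun _ _ => 0) (fun _ _ => 0)).map (shuffle σ) =
      encTables (N := N) pk (fun _ _ => 0) (fun _ _ => 0) := by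
  simp only [encTables, PMF.do_bind, PMF.do_pure, PMF.map_bind, PMF.pure_map]
  conv_rhs => rw [← map_perm_sampleVec _ σ.symm, PMF.bind_map]
  congr 1
  ext1 M
  simp only [Function.comp]
  conv_rhs => rw [← map_perm_sampleVec _ σ.symm, PMF.bind_map]
  rfl

/-- When everything is erased, the masking matrix integrates out, and by `encTables_shuffle_zero`
the key `k` is left in the replies only. -/
theorem hybridGame_eq_zeroGame (A : (slpII 𝒢 F perm mask).Adversary) {j κ : ℕ}
    (hj : ∀ G ∈ (A.start κ).support, 2 * (G.1.N.1 * G.1.N.1) ≤ j) :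
    hybridGame A j κ = zeroGame A (fun κ N => (randomBits κ).map fun k => F κ k N) κ := by
  have h : ∀ {N : ℕ} (M : Fin N → Fin N → ℕ) (o : ℕ), o + N * N ≤ j →
      eraseBelow o j M = fun _ _ => 0 := by
    intro N M o hj
    ext i c
    rw [eraseBelow, if_pos]
    have h₁ : (i + 1) * N ≤ N * N := Nat.mul_le_mul_right N i.2
    have := c.2
    rw [add_mul, one_mul] at h₁
    omega
  have h₁ : ∀ G ∈ (A.start κ).support, ∀ k pk B, hybridWith A κ k pk G.1 G.2 B j =
      (encTables (N := G.1.N.1) pk (fun _ _ => 0) (fun _ _ => 0)).bind fun T =>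
        play A κ G.1.N (F κ k G.1.N) ⟨pk, T⟩ G.2 := by
    intro G hG k pk B
    have := hj G hG
    rw [hybridWith, h _ _ (by omega), h _ _ (by omega)]
    conv_rhs => rw [← encTables_shuffle_zero pk (F κ k G.1.N), PMF.bind_map]
    rfl
  -- The graph is moved to the front, since the bound on its size is known only on the support of
  -- `A.start κ`.
  have h₂ : hybridGame A j κ = (A.start κ).bind fun G => (randomBits κ).bind fun k =>
      (𝒢.pkGen κ).bind fun pk => (mask.mask G.1).bind fun B =>
        hybridWith A κ k pk G.1 G.2 B j := by
    rw [hybridGame, PMF.bind_comm (A.start κ)]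
    congr 1
    ext1 k
    rw [PMF.bind_comm]
  rw [h₂, zeroGame]
  refine PMF.bind_congr_support fun G hG => ?_
  simp only [h₁ G hG, PMF.bind_const, zeroView_eq, PMF.bind_bind, PMF.bind_map, Function.comp_def]
  rw [PMF.bind_comm]
  congr 1
  ext1 pk
  rw [PMF.bind_comm]

/-- Encryption of the two matrices with the first `j` entries replaced by `0`, where the ciphertext
of the entry with number `j` is given. -/
noncomputable def encSlot (pk : 𝒢.PublicKey) {N : ℕ} (A B : Fin N → Fin N → ℕ) (j : ℕ)
    (u : 𝒢.G pk.inst) : PMF (Tables 𝒢 pk N) :=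
  (sampleVec fun i : Fin N => sampleVec fun c : Fin N =>
    if 0 + (i * N + c : ℕ) = j then PMF.pure u else encG pk (eraseBelow 0 j A i c)).bind fun M =>
  (sampleVec fun i : Fin N => sampleVec fun c : Fin N =>
    if N * N + (i * N + c : ℕ) = j then PMF.pure (𝒢.e pk.g u) else
      encG₁ pk (eraseBelow (N * N) j B i c)).map fun M' => (M, M')

/-- The entry with number `j` of the two matrices. -/
def entry {N : ℕ} (A B : Fin N → Fin N → ℕ) (j : ℕ) : ℕ :=
  if h : j < N * N then
    A ⟨j / N, Nat.div_lt_of_lt_mul h⟩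
      ⟨j % N, Nat.mod_lt _ (Nat.pos_of_ne_zero (by rintro rfl; simp at h))⟩
  else if h : j - N * N < N * N then
    B ⟨(j - N * N) / N, Nat.div_lt_of_lt_mul h⟩
      ⟨(j - N * N) % N, Nat.mod_lt _ (Nat.pos_of_ne_zero (by rintro rfl; simp at h))⟩
  else 0

theorem slot_lt {N : ℕ} (i c : Fin N) : (i * N + c : ℕ) < N * N := by
  have h₁ : (i + 1) * N ≤ N * N := Nat.mul_le_mul_right N i.2
  have := c.2
  rw [add_mul, one_mul] at h₁
  omega

/-- At most one position has number `j`. If there is one, drawing `u` beforehand amounts to drawing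
this entry; if there is none, `u` is not used. -/
theorem bind_sampleVec_slot {α β : Type} {N : ℕ} (q : PMF β) (φ : β → α)
    (p : Fin N → Fin N → PMF α) (o j : ℕ) :
    (q.bind fun u => sampleVec fun i : Fin N => sampleVec fun c : Fin N =>
      if o + (i * N + c : ℕ) = j then PMF.pure (φ u) else p i c) =
    sampleVec fun i : Fin N => sampleVec fun c : Fin N =>
      if o + (i * N + c : ℕ) = j then q.map φ else p i c := by
  by_cases hj : ∃ i c : Fin N, o + (i * N + c : ℕ) = j
  · obtain ⟨i, c, rfl⟩ := hj
    -- Division with remainder by `N` recovers row and column from the number.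
    have hiff : ∀ i' c' : Fin N, o + (i' * N + c' : ℕ) = o + (i * N + c : ℕ) ↔
        i' = i ∧ c' = c := by
      intro i' c'
      constructor
      · intro h
        have h : (c' + N * i' : ℕ) = c + N * i := by linarith
        have h₁ := congrArg (· / N) h
        have h₂ := congrArg (· % N) h
        have hN : 0 < N := i.pos
        simp only [Nat.add_mul_div_left _ _ hN, Nat.div_eq_of_lt c.2, Nat.div_eq_of_lt c'.2,
          Nat.add_mul_mod_self_left, Nat.mod_eq_of_lt c.2, Nat.mod_eq_of_lt c'.2, zero_add]
          at h₁ h₂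
        exact ⟨Fin.ext h₁, Fin.ext h₂⟩
      · rintro ⟨rfl, rfl⟩
        rfl
    have key : ∀ r : PMF α, (sampleVec fun i' : Fin N => sampleVec fun c' : Fin N =>
        if o + (i' * N + c' : ℕ) = o + (i * N + c : ℕ) then r else p i' c') =
        sampleVec (Function.update (fun i' => sampleVec (p i')) i
          (sampleVec (Function.update (p i) c r))) := by
      intro r
      congr 1
      ext1 i'
      by_cases hi : i' = i
      · subst hi
        rw [Function.update_self]
        congr 1
        ext1 c'
        simp only [hiff, true_and, Function.update_apply]
      · rw [Function.update_of_ne hi]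
        simp only [hiff, hi, false_and, if_false]
    simp only [key]
    rw [bind_sampleVec_update, bind_sampleVec_update]
    rfl
  · push Not at hj
    simp [hj]

/-- `encSlot` refers to the same `u` in both matrices. This creates no correlation: the numbers of
the two matrices are disjoint, so at least one of the matrices does not involve `u`. -/
theorem bind_encSlot (pk : 𝒢.PublicKey) {N : ℕ} (A B : Fin N → Fin N → ℕ) (j a : ℕ) :
    (encG pk a).bind (encSlot pk A B j) =
      encTables pk (fun i c => if 0 + (i * N + c : ℕ) = j then a else eraseBelow 0 j A i c)
        fun i c => if N * N + (i * N + c : ℕ) = j then a else eraseBelow (N * N) j B i c := by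
  have h₁ := bind_sampleVec_slot (encG pk a) id (fun i c => encG pk (eraseBelow 0 j A i c)) 0 j
  have h₂ := bind_sampleVec_slot (encG pk a) (𝒢.e pk.g)
    (fun i c => encG₁ pk (eraseBelow (N * N) j B i c)) (N * N) j
  rw [PMF.map_id] at h₁
  rw [← encG₁_eq_map] at h₂
  have h₃ : encTables pk (fun i c => if 0 + (i * N + c : ℕ) = j then a else eraseBelow 0 j A i c)
      (fun i c => if N * N + (i * N + c : ℕ) = j then a else eraseBelow (N * N) j B i c) =
      (sampleVec fun i : Fin N => sampleVec fun c : Fin N => if 0 + (i * N + c : ℕ) = j then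
        encG pk a else encG pk (eraseBelow 0 j A i c)).bind fun M =>
      (sampleVec fun i : Fin N => sampleVec fun c : Fin N => if N * N + (i * N + c : ℕ) = j then
        encG₁ pk a else encG₁ pk (eraseBelow (N * N) j B i c)).map fun M' => (M, M') := by
    simp only [← apply_ite]
    rfl
  rw [h₃, ← h₁, ← h₂, show encSlot pk A B j = fun u => encSlot pk A B j u from rfl]
  simp only [encSlot, id]
  rcases lt_or_ge j (N * N) with hj | hj
  · have : ∀ i c : Fin N, N * N + (i * N + c : ℕ) ≠ j := fun i c => by omega
    simp only [this, if_false, PMF.bind_const, PMF.bind_bind]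
  · have : ∀ i c : Fin N, 0 + (i * N + c : ℕ) ≠ j := fun i c => by
      have := slot_lt i c
      omega
    simp only [this, if_false, PMF.bind_const]
    rw [PMF.bind_comm]
    simp only [PMF.map_bind]

/-- Slot `j` is not erased at threshold `j`, so an encryption of its own value reproduces hybrid
`j`; an encryption of 0 gives hybrid `j + 1` in `bind_encSlot_zero`. Beyond the last slot both are
trivial, as `u` is not used. -/
theorem bind_encSlot_entry (pk : 𝒢.PublicKey) {N : ℕ} (A B : Fin N → Fin N → ℕ) (j : ℕ) :
    (encG pk (entry A B j)).bind (encSlot pk A B j) =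
      encTables pk (eraseBelow 0 j A) (eraseBelow (N * N) j B) := by
  rw [bind_encSlot]
  have hdiv : ∀ i c : Fin N, (i * N + c : ℕ) / N = i := fun i c => by
    rw [mul_comm, add_comm, Nat.add_mul_div_left _ _ i.pos, Nat.div_eq_of_lt c.2, zero_add]
  have hmod : ∀ i c : Fin N, (i * N + c : ℕ) % N = c := fun i c => by
    rw [mul_comm, add_comm, Nat.add_mul_mod_self_left, Nat.mod_eq_of_lt c.2]
  congr 1 <;> ext i c <;> split_ifs with h <;> try rfl
  · have := slot_lt i c
    simp only [zero_add] at h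
    subst h
    rw [entry, dif_pos this, eraseBelow, if_neg (by omega)]
    simp only [hdiv, hmod]
  · have := slot_lt i c
    subst h
    rw [entry, dif_neg (by omega), dif_pos (by omega), eraseBelow, if_neg (by omega)]
    simp only [Nat.add_sub_cancel_left, hdiv, hmod]

theorem bind_encSlot_zero (pk : 𝒢.PublicKey) {N : ℕ} (A B : Fin N → Fin N → ℕ) (j : ℕ) :
    (encG pk 0).bind (encSlot pk A B j) =
      encTables pk (eraseBelow 0 (j + 1) A) (eraseBelow (N * N) (j + 1) B) := by
  rw [bind_encSlot]
  congr 1 <;> ext i c <;> simp only [eraseBelow] <;> split_ifs <;> first | rfl | omega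

end

/-! ## Programs for the adversary against BGN -/

section

variable {ι : Type} {s : ι → ℕ} {x : ι → Data} {κ : ι → ℕ}

/-- Serves `T` and `T'` alike, with `enc` as a parameter. Feasibility of `enc` is required in all
later environments, because it is used inside two nested loops. -/
theorem Feasible.slotMatrix {α : ι → Type} {c : ∀ i, α i → Data} {N j o : ι → ℕ}
    {A : ∀ i, Fin (N i) → Fin (N i) → ℕ} {a : ∀ i, α i} {enc : ∀ i, ℕ → PMF (α i)}
    (hN : FeasibleFun s x fun i => .num (N i)) (hNb : PolyBdd s N)
    (hA : FeasibleFun s x fun i => Coded.code (A i)) (hj : FeasibleFun s x fun i => .num (j i))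
    (ho : FeasibleFun s x fun i => .num (o i)) (ha : FeasibleFun s x fun i => c i (a i))
    (henc : ∀ (ι' : Type) (φ : ι' → ι) (s' : ι' → ℕ) (x' : ι' → Data) (m : ι' → ℕ),
      (∀ f, FeasibleFun s x f → FeasibleFun s' x' fun j => f (φ j)) →
      (FeasibleFun s' x' fun j => .num (m j)) →
      (∀ f, PolyBdd s f → PolyBdd s' fun j => f (φ j)) →
      Feasible s' x' fun j => (enc (φ j) (m j)).map (c (φ j))) :
    Feasible s x fun i => (_root_.sampleVec fun r : Fin (N i) => _root_.sampleVec
      fun q : Fin (N i) => if o i + (r * N i + q : ℕ) = j i then PMF.pure (a i) else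
        enc i (eraseBelow (o i) (j i) (A i) r q)).map fun M =>
          codeList (fun v => codeList (c i) (List.ofFn v)) (List.ofFn M) := by
  refine Feasible.sampleVec (α := fun i => Fin (N i) → α i)
    (c := fun i v => codeList (c i) (List.ofFn v)) hN hNb fun s₁ x₁ w₁ v₁ u₁ => ?_
  refine Feasible.sampleVec (α := fun i : Σ i, Fin (N i) => α i.1) (c := fun i => c i.1)
    (w₁ _ hN) (u₁ _ hNb) fun s₂ x₂ w₂ v₂ u₂ => ?_
  have w := fun f hf => w₂ _ (w₁ f hf)
  have hidx := (w _ ho).add (((w₂ _ v₁).mul (w _ hN)).add v₂)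
  have hAe := ((w _ hA).apply (c := fun i v => codeList .num (List.ofFn v)) (w₂ _ v₁)).apply v₂
  have hent : FeasibleFun s₂ x₂ fun i => .num
      (eraseBelow (o i.1.1) (j i.1.1) (A i.1.1) i.1.2 i.2) :=
    FeasibleFun.by_cases (hidx.lt (w _ hj))
      (((hidx.numeral 0).reindex Subtype.val).congr fun i => by rw [eraseBelow, if_pos i.2])
      ((hAe.reindex Subtype.val).congr fun i => by rw [eraseBelow, if_neg i.2])
  have he := henc _ (fun j => j.1.1) s₂ x₂ _ w hent fun f hf => u₂ _ (u₁ f hf)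
  refine Feasible.by_cases (hidx.eq_num (w _ hj)) (Feasible.congr ((w _ ha).reindex Subtype.val)
    fun i => ?_) ((he.reindex Subtype.val).congr fun i => ?_)
  · rw [if_pos i.2, PMF.pure_map]
  · rw [if_neg i.2]

end

section

variable {D : Set ℕ} {𝒢 : BilinearGenerator} {F perm : KeyedPermutation D}
  {mask : MaskingAlgorithm D} {ι : Type} {s : ι → ℕ} {x : ι → Data} {κ : ι → ℕ}

theorem feasible_encSlot {pk : ι → 𝒢.PublicKey} {N j : ι → ℕ}
    {A B : ∀ i, Fin (N i) → Fin (N i) → ℕ} {u : ∀ i, 𝒢.G (pk i).inst}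
    (hpk : ∀ i, pk i ∈ (𝒢.pkGen (κ i)).support) (hκ : PolyBdd s κ)
    (hp : FeasibleFun s x fun i => Coded.code (pk i)) (hN : FeasibleFun s x fun i => .num (N i))
    (hNb : PolyBdd s N) (hA : FeasibleFun s x fun i => Coded.code (A i))
    (hB : FeasibleFun s x fun i => Coded.code (B i)) (hj : FeasibleFun s x fun i => .num (j i))
    (hu : FeasibleFun s x fun i => Coded.code (u i)) :
    Feasible s x fun i => (encSlot (pk i) (A i) (B i) (j i) (u i)).map Coded.code := by
  have h₁ := Feasible.slotMatrix (c := fun _ => Coded.code) (a := u)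
    (enc := fun i m => encG (pk i) m) hN hNb hA hj (hN.numeral 0) hu fun ι' φ s' x' m w hm u' =>
      feasible_encG (fun j => hpk (φ j)) (u' _ hκ) (w _ hp) hm
  have hv : FeasibleFun s x fun i => Coded.code (𝒢.e (pk i).g (u i)) :=
    feasible_pairing (fun i => inst_mem_support (hpk i)) hκ hp.snd.fst hp.snd.snd.fst hu
  have h₂ := Feasible.slotMatrix (c := fun _ => Coded.code) (enc := fun i m => encG₁ (pk i) m)
    hN hNb hB hj (hN.mul hN) hv fun ι' φ s' x' m w hm u' =>
      feasible_encG₁ (fun j => hpk (φ j)) (u' _ hκ) (w _ hp) hm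
  refine (h₁.both h₂).congr fun i => ?_
  rw [encSlot, PMF.map_bind, PMF.bind_map]
  simp only [PMF.map_comp]
  rfl

theorem feasible_encTables_zero {pk : ι → 𝒢.PublicKey} {N : ι → ℕ}
    (hpk : ∀ i, pk i ∈ (𝒢.pkGen (κ i)).support) (hκ : PolyBdd s κ)
    (hp : FeasibleFun s x fun i => Coded.code (pk i)) (hN : FeasibleFun s x fun i => .num (N i))
    (hNb : PolyBdd s N) : Feasible s x fun i =>
      (encTables (N := N i) (pk i) (fun _ _ => 0) (fun _ _ => 0)).map Coded.code := by
  have h₁ := Feasible.sampleVec (α := fun i => Fin (N i) → 𝒢.G (pk i).inst)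
    (c := fun i v => Coded.code v) (μ := fun i _ => sampleVec fun _ => encG (pk i) 0) hN hNb
    fun s₁ x₁ w₁ v₁ u₁ => Feasible.sampleVec (c := fun j => Coded.code) (w₁ _ hN) (u₁ _ hNb)
      fun s₂ x₂ w₂ v₂ u₂ => feasible_encG (fun j => hpk j.1.1) (u₂ _ (u₁ _ hκ)) (w₂ _ (w₁ _ hp))
        (v₂.numeral 0)
  have h₂ := Feasible.sampleVec (α := fun i => Fin (N i) → 𝒢.G₁ (pk i).inst)
    (c := fun i v => Coded.code v) (μ := fun i _ => sampleVec fun _ => encG₁ (pk i) 0) hN hNb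
    fun s₁ x₁ w₁ v₁ u₁ => Feasible.sampleVec (c := fun j => Coded.code) (w₁ _ hN) (u₁ _ hNb)
      fun s₂ x₂ w₂ v₂ u₂ => feasible_encG₁ (fun j => hpk j.1.1) (u₂ _ (u₁ _ hκ)) (w₂ _ (w₁ _ hp))
        (v₂.numeral 0)
  refine (h₁.both h₂).congr fun i => ?_
  simp only [encTables, PMF.do_bind, PMF.do_pure, PMF.map_bind, PMF.bind_map, PMF.pure_map,
    PMF.map_comp, Function.comp_def]
  rfl

theorem feasible_zeroView (F perm : KeyedPermutation D) (mask : MaskingAlgorithm D)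
    {N : ι → Size D} (hκ : FeasibleFun s x fun i => .num (κ i))
    (hκb : PolyBdd s κ) (hN : FeasibleFun s x fun i => .num (N i).1)
    (hNb : PolyBdd s fun i => (N i).1) :
    Feasible s x fun i => (zeroView 𝒢 F perm mask (κ i) (N i)).map Coded.code := by
  refine ((feasible_pkGen (𝒢 := 𝒢) hκ hκb).bind (ν := fun i pk =>
    (encTables (N := (N i).1) pk (fun _ _ => 0) (fun _ _ => 0)).map fun T => Coded.code (pk, T))
    fun s₁ x₁ w₁ v₁ u₁ => ?_).congr fun i => ?_
  · exact (feasible_encTables_zero (fun j => j.2.2) (u₁ _ hκb) v₁ (w₁ _ hN) (u₁ _ hNb)).map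
      fun s₂ x₂ w₂ v₂ u₂ => (w₂ _ v₁).pair v₂
  · simp only [zeroView_eq, PMF.map_bind, PMF.map_comp]
    rfl

theorem feasible_keyedPermutation (hF : IsPRP F) {k : ∀ i, BitVec (κ i)} {N : ι → Size D}
    {v : ∀ i, Fin (N i).1} (hκ : FeasibleFun s x fun i => .num (κ i)) (hκb : PolyBdd s κ)
    (hk : FeasibleFun s x fun i => Coded.code (k i))
    (hN : FeasibleFun s x fun i => .num (N i).1) (hv : FeasibleFun s x fun i => .num (v i)) :
    FeasibleFun s x fun i => .num (F (κ i) (k i) (N i) (v i)) := by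
  obtain ⟨p, t, hp⟩ := hF.1
  exact (hκ.pair (hk.pair (hN.pair hv))).comp ((FeasibleFun.of_realizes fun i =>
    hp (κ i) (k i) (N i) (v i)).rescale (hκb.add hN.size_output))

/-- Each position needs the vertex that is stored there, hence the inverse of F_k. The assumption on
`F` provides a program for F_k only, but the number of vertices is polynomially bounded, so a search
is affordable. -/
theorem feasible_shuffle (hF : IsPRP F) {k : ∀ i, BitVec (κ i)} {N : ι → Size D}
    {pk : ι → 𝒢.PublicKey} {T : ∀ i, Tables 𝒢 (pk i) (N i).1}
    (hκ : FeasibleFun s x fun i => .num (κ i)) (hκb : PolyBdd s κ)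
    (hk : FeasibleFun s x fun i => Coded.code (k i))
    (hN : FeasibleFun s x fun i => .num (N i).1) (hNb : PolyBdd s fun i => (N i).1)
    (hT : FeasibleFun s x fun i => Coded.code (T i)) :
    FeasibleFun s x fun i => Coded.code (shuffle (F (κ i) (k i) (N i)) (T i)) := by
  have hsymm : ∀ (s' : (Σ i, Fin (N i).1) → ℕ) (x' : (Σ i, Fin (N i).1) → Data),
      (∀ f, FeasibleFun s x f → FeasibleFun s' x' fun j => f j.1) →
      (FeasibleFun s' x' fun j => .num j.2) →
      (∀ f, PolyBdd s f → PolyBdd s' fun j => f j.1) →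
      FeasibleFun s' x' fun j => .num ((F (κ j.1) (k j.1) (N j.1)).symm j.2) :=
    fun s' x' w v u => FeasibleFun.perm_symm (w _ hN) (u _ hNb) v fun ι' φ s'' x'' r w' v' u' =>
      feasible_keyedPermutation hF (w' _ (w _ hκ)) (u' _ (u _ hκb)) (w' _ (w _ hk))
        (w' _ (w _ hN)) v'
  have h₁ := FeasibleFun.ofFn (c := fun i v => Coded.code v)
    (v := fun i r => (T i).1 ((F (κ i) (k i) (N i)).symm r)) hN hNb fun s' x' w v u =>
      (w _ hT.fst).apply (c := fun i v => Coded.code v) (hsymm s' x' w v u)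
  have h₂ := FeasibleFun.ofFn (c := fun i v => Coded.code v)
    (v := fun i r => (T i).2 ((F (κ i) (k i) (N i)).symm r)) hN hNb fun s' x' w v u =>
      (w _ hT.snd).apply (c := fun i v => Coded.code v) (hsymm s' x' w v u)
  exact h₁.pair h₂

theorem map_keyGen (κ : ℕ) : ((slpII 𝒢 F perm mask).keyGen κ).map Prod.fst = 𝒢.pkGen κ := by
  simp only [slpII, PMF.do_bind, PMF.do_pure, PMF.map_bind, PMF.pure_map, PMF.bind_const, pkGen]
  rfl

theorem size_trapdoors {κ N : ℕ} (l : List (Fin N × BitVec κ)) :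
    (codeList Coded.code l).size ≤ l.length * (N + κ + 4) + 1 := by
  refine size_codeList_le _ fun a _ => ?_
  have h₁ := (Nat.size_le_self a.1).trans a.1.2.le
  have h₂ : Nat.size a.2.toNat ≤ κ := Nat.size_le.2 a.2.isLt
  simp only [Coded.code, Data.size]
  omega

/-- The reduction runs the programs of `A`. Their laws and time bounds are guaranteed at reachable
states with the right number of trapdoors, so these two facts form the invariant. The states remain
small because the query program of `A` has to read them. -/
theorem feasible_play (hF : IsPRP F) {A : (slpII 𝒢 F perm mask).Adversary} (hA : A.IsPPT)
    {k : ∀ i, BitVec (κ i)} {G : ι → SizedGraph D} {st : ι → Data}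
    {V : ∀ i, (slpII 𝒢 F perm mask).View (κ i) (G i).N}
    (hG : ∀ i, (G i, st i) ∈ (A.start (κ i)).support)
    (hV : ∀ i, (V i).1 ∈ (𝒢.pkGen (κ i)).support)
    (hκ : FeasibleFun s x fun i => .num (κ i)) (hκb : PolyBdd s κ)
    (hk : FeasibleFun s x fun i => Coded.code (k i))
    (hN : FeasibleFun s x fun i => .num (G i).N.1) (hNb : PolyBdd s fun i => (G i).N.1)
    (hst : FeasibleFun s x st) (hVc : FeasibleFun s x fun i => Coded.code (V i)) :
    Feasible s x fun i =>
      (play A (κ i) (G i).N (F (κ i) (k i) (G i).N) (V i) (st i)).map Coded.code := by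
  obtain ⟨pS, pQ, pG, t, hA⟩ := hA
  simp only [map_keyGen] at hA
  let β := fun i => List (Fin (G i).N.1 × BitVec (κ i)) × Data
  -- The number of trapdoors is stored as well, since `FeasibleFun.append` needs it.
  let c : ∀ i, β i → Data := fun i b =>
    .pair (.num b.1.length) (.pair (codeList Coded.code b.1) b.2)
  let P : ∀ i, ℕ → β i → Prop := fun i j b => b.1.length = j ∧ A.Reach (κ i) (G i).N (V i) b.1 b.2
  let J := Σ i, {b : β i // ∃ j < A.rounds.eval (κ i), P i j b}
  have hτ : PolyBdd (fun j : J => s j.1) fun j => (codeList Coded.code j.2.1.1).size := by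
    refine ((((hκb.eval A.rounds).mul ((hNb.add hκb).add (.const 4))).add
      (.const 1)).reindex fun j : J => j.1).mono ?_
    rintro ⟨i, b, _, hj, rfl, _⟩
    exact (size_trapdoors b.1).trans
      (Nat.add_le_add_right (Nat.mul_le_mul_right _ hj.le) _)
  have hQ := Feasible.of_realizes fun j : J =>
    ((hA (κ j.1)).2 (G j.1).N (V j.1) j.2.1.1 j.2.1.2 (hV j.1) (by
      obtain ⟨i, b, _, hj, rfl, h⟩ := j; exact h)).1 (by
      obtain ⟨i, b, _, hj, rfl, h⟩ := j; exact hj)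
  have hQ := hQ.rescale (s' := fun j => s j.1)
    (((hκb.add hVc.size_output).reindex fun j : J => j.1).add hτ)
  have hsize : PolyBdd (fun j : J => s j.1) fun j => (c j.1 j.2.1).size := by
    refine ((hQ.size_input.add ((hκb.eval A.rounds).reindex fun j : J => j.1)).add
      (.const 3)).mono ?_
    rintro ⟨i, b, _, hj, rfl, h⟩
    have := Nat.size_le_self b.1.length
    have h' : (codeList Coded.code b.1).size =
      (Coded.code (α := List ((slpII 𝒢 F perm mask).Trapdoor (κ i) (G i).N)) b.1).size := rfl
    have h'' : (Coded.code (α := Data) b.2).size = b.2.size := rfl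
    simp only [c, Data.size, Coded.code] at *
    omega
  have hstep : ∀ i j b, P i j b → ∀ b' ∈ (playRound A (κ i) (G i).N (F (κ i) (k i) (G i).N) (V i)
      b).support, P i (j + 1) b' := by
    rintro i _ b ⟨rfl, hb⟩ b' hb'
    rw [playRound, PMF.mem_support_bind_iff] at hb'
    obtain ⟨r, hr, hb'⟩ := hb'
    rw [PMF.mem_support_map_iff] at hb'
    obtain ⟨q, -, rfl⟩ := hb'
    exact ⟨by simp, .step _ _ r.1 _ _ hb hr⟩
  have hloop := Feasible.loop (β := β) (c := c) (k := fun i => A.rounds.eval (κ i))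
    (f := fun i => playRound A (κ i) (G i).N (F (κ i) (k i) (G i).N) (V i))
    (b₀ := fun i => ([], st i)) P (hκ.polynomial _) (hκb.eval _)
    ((hκ.numeral 0).pair ((hκ.numeral 0).pair hst))
    (fun i => ⟨rfl, .start (G i) (st i) (hG i) rfl⟩) (fun i j b _ => hstep i j b) hsize
    (by
      intro s₁ x₁ w₁ v₁ u₁
      have hq := ((w₁ _ hκ).pair ((w₁ _ hN).pair (v₁.snd.snd.pair
        ((w₁ _ hVc).pair v₁.snd.fst)))).comp (hQ.rescale (s' := s₁) (u₁ _ .self))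
      refine (hq.bind (ν := fun j r => (randomBits (κ j.1)).map fun q =>
        c j.1 (j.2.1.1 ++ [(F (κ j.1) (k j.1) (G j.1).N r.1, q)], r.2))
        fun s₂ x₂ w₂ v₂ u₂ => ?_).congr fun j => ?_
      · refine (Feasible.randomBits (w₂ _ (w₁ _ hκ)) (u₂ _ (u₁ _ hκb))).map
          fun s₃ x₃ w₃ v₃ u₃ => ?_
        have hf := feasible_keyedPermutation hF (w₃ _ (w₂ _ (w₁ _ hκ))) (u₃ _ (u₂ _ (u₁ _ hκb)))
          (w₃ _ (w₂ _ (w₁ _ hk))) (w₃ _ (w₂ _ (w₁ _ hN))) (w₃ _ v₂.fst)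
        have hl := w₃ _ (w₂ _ v₁.fst)
        have hp : FeasibleFun s₃ x₃ fun j => Coded.code
            (F (κ j.1.1.1) (k j.1.1.1) (G j.1.1.1).N j.1.2.1.1, j.2.1) := hf.pair v₃
        have happ := hl.append (w₃ _ (w₂ _ v₁.snd.fst)) hp
        refine ((hl.add (hl.numeral 1)).pair (happ.pair (w₃ _ v₂.snd))).congr fun j => ?_
        simp only [c, List.length_append, List.length_singleton]
        rfl
      · simp only [playRound, PMF.map_bind, PMF.map_comp]
        rfl)
  refine (hloop.bind (ν := fun i b => (A.guess (κ i) (G i).N b.2 (V i) b.1).map Coded.code)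
    fun s₁ x₁ w₁ v₁ u₁ => ?_).congr fun i => by rw [play, PMF.map_bind]
  let K := Σ i, (PMF.iter (playRound A (κ i) (G i).N (F (κ i) (k i) (G i).N) (V i))
      (A.rounds.eval (κ i)) ([], st i)).support
  have hP : ∀ j : K, P j.1 (A.rounds.eval (κ j.1)) j.2.1 := fun j => by
    have := PMF.iter_invariant (P := P j.1) (n := 0)
      ⟨rfl, .start (G j.1) (st j.1) (hG j.1) rfl⟩ (fun m b _ _ => hstep j.1 m b) j.2.2
    rwa [zero_add] at this
  have hr := fun j : K => ((hA (κ j.1)).2 (G j.1).N (V j.1) j.2.1.1 j.2.1.2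
    (hV j.1) (hP j).2).2 (hP j).1
  have hg := Feasible.of_realizes (β := fun _ => Bool) hr
  exact ((w₁ _ hκ).pair ((w₁ _ hN).pair (v₁.snd.snd.pair ((w₁ _ hVc).pair v₁.snd.fst)))).comp
    (hg.rescale ((u₁ _ (hκb.add hVc.size_output)).add v₁.snd.fst.size_output))

end

/-! ## Negligible functions -/

namespace Negligible

theorem mono {f g : ℕ → ℝ} (hf : Negligible f) (h : ∀ n, g n ≤ f n) : Negligible g := fun c =>
  let ⟨M, hM⟩ := hf c
  ⟨M, fun n hn => (h n).trans_lt (hM n hn)⟩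

/-- If d is the degree of `t`, then t(n) < n ^ (d + 1) as soon as n exceeds the sum of the
coefficients; so the exponent c + d + 1 for `f` is enough. -/
theorem polynomial_mul {f : ℕ → ℝ} (hf : Negligible f) (t : Polynomial ℕ) :
    Negligible fun n => (t.eval n : ℕ) * f n := by
  intro c
  obtain ⟨M, hM⟩ := hf (c + (t.natDegree + 1))
  refine ⟨max M (∑ i ∈ Finset.range (t.natDegree + 1), t.coeff i), fun n hn => ?_⟩
  have hn₁ := (le_max_left _ _).trans_lt hn
  have hn₂ := (le_max_right _ _).trans_lt hn
  have hpos : 0 < n := by omega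
  have ht : t.eval n < n ^ (t.natDegree + 1) := by
    calc t.eval n ≤ (∑ i ∈ Finset.range (t.natDegree + 1), t.coeff i) * n ^ t.natDegree := by
          rw [Polynomial.eval_eq_sum_range, Finset.sum_mul]
          refine Finset.sum_le_sum fun i hi => Nat.mul_le_mul_left _ ?_
          exact Nat.pow_le_pow_right hpos (by simpa [Nat.lt_succ_iff] using hi)
      _ < n * n ^ t.natDegree := Nat.mul_lt_mul_of_pos_right hn₂ (by positivity)
      _ = n ^ (t.natDegree + 1) := by ring
  have hpos' : (0 : ℝ) < n := by exact_mod_cast hpos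
  calc ((t.eval n : ℕ) : ℝ) * f n ≤ (t.eval n : ℕ) * ((n : ℝ) ^ (c + (t.natDegree + 1)))⁻¹ :=
        mul_le_mul_of_nonneg_left (hM n hn₁).le (Nat.cast_nonneg _)
    _ < (n : ℝ) ^ (t.natDegree + 1) * ((n : ℝ) ^ (c + (t.natDegree + 1)))⁻¹ :=
        mul_lt_mul_of_pos_right (by exact_mod_cast ht) (by positivity)
    _ = ((n : ℝ) ^ c)⁻¹ := by
        rw [pow_add]
        field_simp
        ring

/-- Twice a negligible function is negligible, so both summands are eventually below half of the
required bound. -/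
theorem add {f g : ℕ → ℝ} (hf : Negligible f) (hg : Negligible g) :
    Negligible fun n => f n + g n := by
  have key : ∀ {f : ℕ → ℝ}, Negligible f → ∀ c, ∃ M, ∀ n : ℕ, M < n →
      2 * f n < ((n : ℝ) ^ c)⁻¹ := fun hf c => by
    simpa using polynomial_mul hf 2 c
  intro c
  obtain ⟨M₁, h₁⟩ := key hf c
  obtain ⟨M₂, h₂⟩ := key hg c
  refine ⟨max M₁ M₂, fun n hn => ?_⟩
  have := h₁ n ((le_max_left _ _).trans_lt hn)
  have := h₂ n ((le_max_right _ _).trans_lt hn)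
  linarith

end Negligible

theorem gap_triangle (X Y Z : ℕ → PMF Bool) (κ : ℕ) : gap X Z κ ≤ gap X Y κ + gap Y Z κ :=
  abs_sub_le _ _ _

/-! ## Laws given by programs -/

/-- The law of the object that is coded by the output of a program. -/
noncomputable def Prog.decodedLaw {β : Type} [Coded β] [Nonempty β] (p : Prog) (x : Data) : PMF β :=
  (p.law x).map (Function.invFun Coded.code)

/-- A stage of an adversary must be defined for all raw data, also for meaningless states. The
decoded law of a program is such a definition; where the program is correct, it is the intended law
by injectivity of the coding. -/
theorem Prog.decodedLaw_eq {β : Type} [Coded β] [Nonempty β]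
    (hinj : Function.Injective (Coded.code : β → Data)) {p : Prog} {x : Data} {ν : PMF β}
    (h : p.law x = ν.map Coded.code) : p.decodedLaw x = ν := by
  rw [decodedLaw, h, PMF.map_comp, Function.invFun_comp hinj, PMF.map_id]

theorem code_bool_injective : Function.Injective (Coded.code : Bool → Data) := by
  rintro (_ | _) (_ | _) h <;> first | rfl | simp [Coded.code, Data.ofBool] at h

/-! ## The adversary against BGN -/

section

variable {ι : Type} {s : ι → ℕ} {x : ι → Data}

theorem FeasibleFun.entry {N j : ι → ℕ} {A B : ∀ i, Fin (N i) → Fin (N i) → ℕ}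
    (hN : FeasibleFun s x fun i => .num (N i)) (hA : FeasibleFun s x fun i => Coded.code (A i))
    (hB : FeasibleFun s x fun i => Coded.code (B i)) (hj : FeasibleFun s x fun i => .num (j i)) :
    FeasibleFun s x fun i => .num (entry (A i) (B i) (j i)) := by
  have hNN := hN.mul hN
  -- Common to both matrices: a number below N² is split into row and column by division with
  -- remainder.
  have key : ∀ {ι' : Type} (φ : ι' → ι) (j : ι' → ℕ)
      (M : ∀ i, Fin (N i) → Fin (N i) → ℕ) (_ : FeasibleFun s x fun i => Coded.code (M i))
      (_ : FeasibleFun (fun i => s (φ i)) (fun i => x (φ i)) fun i => .num (j i))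
      (h : ∀ i, j i < N (φ i) * N (φ i)),
      FeasibleFun (fun i => s (φ i)) (fun i => x (φ i)) fun i => .num (M (φ i)
        ⟨j i / N (φ i), Nat.div_lt_of_lt_mul (h i)⟩ ⟨j i % N (φ i), Nat.mod_lt _
          (Nat.pos_of_ne_zero fun h₀ => by have := h i; simp [h₀] at this)⟩) := by
    intro ι' φ j M hM hj h
    have h₁ := (hM.reindex φ).apply (c := fun i v => codeList .num (List.ofFn v))
      (j := fun i => ⟨j i / N (φ i), Nat.div_lt_of_lt_mul (h i)⟩) (hj.div (hN.reindex φ))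
    exact h₁.apply (j := fun i => ⟨j i % N (φ i), Nat.mod_lt _
      (Nat.pos_of_ne_zero fun h₀ => by have := h i; simp [h₀] at this)⟩) (hj.mod (hN.reindex φ))
  refine FeasibleFun.by_cases (hj.lt hNN)
    ((key Subtype.val _ A hA (hj.reindex _) fun i => i.2).congr fun i => ?_) ?_
  · rw [_root_.entry, dif_pos i.2]
  · refine FeasibleFun.by_cases (P := fun i : {i // ¬ j i < N i * N i} =>
      j i.1 - N i.1 * N i.1 < N i.1 * N i.1)
      (((hj.sub hNN).lt hNN).reindex _)
      ((key (fun i : {i : {i // ¬ j i < N i * N i} // j i.1 - N i.1 * N i.1 < N i.1 * N i.1} =>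
        i.1.1) _ B hB ((hj.sub hNN).reindex _) fun i => i.2).congr fun i => ?_)
      (((hj.numeral 0).reindex fun i : {i : {i // ¬ j i < N i * N i} //
        ¬ j i.1 - N i.1 * N i.1 < N i.1 * N i.1} => i.1.1).congr fun i => ?_)
    · rw [_root_.entry, dif_neg i.1.2, dif_pos i.2]
    · rw [_root_.entry, dif_neg i.1.2, dif_neg i.2]

end

section

variable {D : Set ℕ} {𝒢 : BilinearGenerator} {F perm : KeyedPermutation D}
  {mask : MaskingAlgorithm D}

/-- What the adversary against BGN remembers. -/
noncomputable def hybridState {κ : ℕ} (G : SizedGraph D × Data) (B : Fin G.1.N.1 → Fin G.1.N.1 → ℕ)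
    (k : BitVec κ) (j : ℕ) : Data :=
  .pair (Coded.code G) (.pair (Coded.code B) (.pair (Coded.code k) (.num j)))

/-- The first stage of the adversary against BGN: it chooses one of the hybrids at random. -/
noncomputable def hybridChoose (A : (slpII 𝒢 F perm mask).Adversary) (m : Polynomial ℕ) (κ : ℕ) :
    PMF ((ℕ × ℕ) × Data) :=
  (A.start κ).bind fun G => (mask.mask G.1).bind fun B => (randomBits κ).bind fun k =>
    (PMF.uniformOfFintype (Fin (m.eval κ + 1))).map fun j : Fin (m.eval κ + 1) =>
      ((entry G.1.A B j, 0), hybridState G B k j)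

/-- The second stage of the adversary against BGN: it plays the hybrid game with the challenge as
one of the entries. -/
noncomputable def hybridGuess (A : (slpII 𝒢 F perm mask).Adversary) (κ : ℕ) (pk : 𝒢.PublicKey)
    (G : SizedGraph D × Data) (B : Fin G.1.N.1 → Fin G.1.N.1 → ℕ) (k : BitVec κ) (j : ℕ)
    (u : 𝒢.G pk.inst) : PMF Bool :=
  (encSlot pk G.1.A B j u).bind fun T =>
    play A κ G.1.N (F κ k G.1.N) ⟨pk, shuffle (F κ k G.1.N) T⟩ G.2

theorem bind_hybridGuess (A : (slpII 𝒢 F perm mask).Adversary) (κ : ℕ) (pk : 𝒢.PublicKey)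
    (G : SizedGraph D × Data) (B : Fin G.1.N.1 → Fin G.1.N.1 → ℕ) (k : BitVec κ) (j : ℕ)
    (b : Bool) :
    (encG pk (if b then 0 else entry G.1.A B j)).bind (hybridGuess A κ pk G B k j) =
      hybridWith A κ k pk G.1 G.2 B (j + b.toNat) := by
  rw [show hybridGuess A κ pk G B k j = fun u => hybridGuess A κ pk G B k j u from rfl]
  simp only [hybridGuess, hybridWith]
  rw [← PMF.bind_bind]
  cases b
  · simp [bind_encSlot_entry]
  · simp [bind_encSlot_zero]

/-- All that the second stage of the adversary against BGN gets to see. -/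
structure HybridContext (A : (slpII 𝒢 F perm mask).Adversary) (m : Polynomial ℕ) where
  κ : ℕ
  pk : 𝒢.PublicKey
  mem_pk : pk ∈ (𝒢.pkGen κ).support
  G : SizedGraph D × Data
  mem_G : G ∈ (A.start κ).support
  B : Fin G.1.N.1 → Fin G.1.N.1 → ℕ
  mem_B : B ∈ (mask.mask G.1).support
  k : BitVec κ
  j : Fin (m.eval κ + 1)
  u : 𝒢.G pk.inst

theorem feasible_start {A : (slpII 𝒢 F perm mask).Adversary} (hA : A.IsPPT) {ι : Type} {s : ι → ℕ}
    {x : ι → Data} {κ : ι → ℕ} (hκ : FeasibleFun s x fun i => .num (κ i)) (hκb : PolyBdd s κ) :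
    Feasible s x fun i => (A.start (κ i)).map Coded.code := by
  obtain ⟨pS, pQ, pG, t, hA⟩ := hA
  exact hκ.comp ((Feasible.of_realizes fun i => (hA (κ i)).1).rescale hκb)

theorem polyBdd_size {ι : Type} {s : ι → ℕ} {x : ι → Data} {N : ι → Size D}
    {M : ∀ i, Fin (N i).1 → Fin (N i).1 → ℕ} (h : FeasibleFun s x fun i => Coded.code (M i)) :
    PolyBdd s fun i => (N i).1 :=
  h.size_output.mono fun i => by
    have := length_le_size_codeList Coded.code (List.ofFn (M i))
    rwa [List.length_ofFn] at this

theorem code_mem_support {α β : Type} {p : PMF α} {c : α → β} {a : α} (h : a ∈ p.support) :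
    c a ∈ (p.map c).support := by
  rw [PMF.mem_support_map_iff]
  exact ⟨a, h, rfl⟩

/-- Time is measured by κ alone. The graph is written by a program that is polynomial in κ, and the
masking algorithm is polynomial in the code of the graph. -/
theorem feasible_hybridChoose {A : (slpII 𝒢 F perm mask).Adversary} (hA : A.IsPPT)
    (m : Polynomial ℕ) : Feasible (ι := Σ κ, (𝒢.pkGen κ).support) (fun i => i.1)
      (fun i => Coded.code (i.1, i.2.1)) fun i => (hybridChoose A m i.1).map Coded.code := by
  have hid := FeasibleFun.id (s := fun i : Σ κ, (𝒢.pkGen κ).support => i.1)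
    (x := fun i => Coded.code (i.1, i.2.1)) (by
      -- The public key does not influence the choice, but it is part of the input and has to be
      -- paid for; its length is bounded because it can be generated in polynomial time.
      have := (feasible_pkGen (𝒢 := 𝒢) (s := fun κ : ℕ => κ) (x := Data.num)
        (FeasibleFun.id ((PolyBdd.self.add (.const 1)).mono fun κ =>
          Nat.add_le_add_right (Nat.size_le_self κ) 1)) .self).size_output
      refine ((this.reindex fun i : Σ κ, (𝒢.pkGen κ).support =>
        ⟨i.1, _, code_mem_support i.2.2⟩).add (PolyBdd.self.add (.const 2))).mono fun i => ?_
      have := Nat.size_le_self i.1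
      simp only [Coded.code, Data.size] at *
      omega)
  have hκ : FeasibleFun (fun i : Σ κ, (𝒢.pkGen κ).support => i.1) _ fun i => .num i.1 := hid.fst
  refine ((feasible_start hA hκ .self).bind (ν := fun i G => (mask.mask G.1).bind fun B =>
    (randomBits i.1).bind fun k => (PMF.uniformOfFintype (Fin (m.eval i.1 + 1))).map
      fun j : Fin (m.eval i.1 + 1) => Coded.code ((entry G.1.A B j, 0), hybridState G B k j))
    fun s₁ x₁ w₁ v₁ u₁ => ?_).congr fun i => by
      simp only [hybridChoose, PMF.map_bind, PMF.map_comp]; rfl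
  obtain ⟨p, t, hp⟩ := mask.efficient
  have hmask := v₁.fst.comp ((Feasible.of_realizes fun i : Σ i : (Σ κ, (𝒢.pkGen κ).support),
    (A.start i.1).support => hp i.2.1.1).rescale v₁.fst.size_output)
  refine hmask.bind fun s₂ x₂ w₂ v₂ u₂ => ?_
  refine (Feasible.randomBits (w₂ _ (w₁ _ hκ)) (u₂ _ (u₁ _ .self))).bind fun s₃ x₃ w₃ v₃ u₃ => ?_
  have hκ₃ := w₃ _ (w₂ _ (w₁ _ hκ))
  refine (Feasible.uniformFin ((hκ₃.polynomial m).add (hκ₃.numeral 1))).map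
    fun s₄ x₄ w₄ v₄ u₄ => ?_
  have hG := w₄ _ (w₃ _ (w₂ _ v₁))
  have hB := w₄ _ (w₃ _ v₂)
  exact ((hG.fst.fst.entry hG.fst.snd hB v₄).pair (v₄.numeral 0)).pair
    (hG.pair (hB.pair ((w₄ _ v₃).pair v₄)))

/-- The remembered state is a possible output of the choosing stage, which bounds its size; the size
of the challenge is bounded by `size_code_bounded`. -/
theorem feasible_hybridGuess (hF : IsPRP F) {A : (slpII 𝒢 F perm mask).Adversary} (hA : A.IsPPT)
    (m : Polynomial ℕ) : Feasible (ι := HybridContext A m) (fun i => i.κ)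
      (fun i => Coded.code (i.κ, i.pk, hybridState i.G i.B i.k i.j, i.u))
      fun i => (hybridGuess A i.κ i.pk i.G i.B i.k i.j i.u).map Coded.code := by
  have hc := feasible_hybridChoose hA m
  have hmem : ∀ i : HybridContext A m, ((entry i.G.1.A i.B i.j, 0), hybridState i.G i.B i.k i.j) ∈
      (hybridChoose A m i.κ).support := fun i => by
    simp only [hybridChoose, PMF.mem_support_bind_iff, PMF.mem_support_map_iff]
    exact ⟨i.G, i.mem_G, i.B, i.mem_B, i.k, by simp [randomBits], i.j, by simp, rfl⟩
  have hu := size_code_bounded (I := fun i : HybridContext A m => i.pk.inst)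
    (fun i => inst_mem_support i.mem_pk) .self
  have hid := FeasibleFun.id (s := fun i : HybridContext A m => i.κ)
    (x := fun i => Coded.code (i.κ, i.pk, hybridState i.G i.B i.k i.j, i.u)) (by
      refine (((hc.size_output.reindex fun i : HybridContext A m => ⟨⟨i.κ, i.pk, i.mem_pk⟩, _,
        code_mem_support (hmem i)⟩).add (hc.size_input.reindex fun i : HybridContext A m =>
          ⟨i.κ, i.pk, i.mem_pk⟩)).add ((hu.reindex fun i : HybridContext A m => ⟨i, i.u⟩).add
            (.const 2))).mono fun i => ?_
      simp only [Coded.code, Data.size] at *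
      omega)
  have hκ := hid.fst
  have hpk := hid.snd.fst
  have hG := hid.snd.snd.fst.fst
  have hN := hG.fst.fst
  have hB := hid.snd.snd.fst.snd.fst
  have hk := hid.snd.snd.fst.snd.snd.fst
  have hj := hid.snd.snd.fst.snd.snd.snd
  have hNb := polyBdd_size hB
  refine ((feasible_encSlot (fun i => i.mem_pk) .self hpk hN hNb hG.fst.snd hB hj
    hid.snd.snd.snd).bind (ν := fun i T => (play A i.κ i.G.1.N (F i.κ i.k i.G.1.N)
      ⟨i.pk, shuffle (F i.κ i.k i.G.1.N) T⟩ i.G.2).map Coded.code)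
    fun s₁ x₁ w₁ v₁ u₁ => ?_).congr fun i => by rw [hybridGuess, PMF.map_bind]
  have hsh := feasible_shuffle hF (w₁ _ hκ) (u₁ _ .self) (w₁ _ hk) (w₁ _ hN) (u₁ _ hNb) v₁
  let J := Σ i : HybridContext A m, (encSlot i.pk i.G.1.A i.B i.j i.u).support
  let V : ∀ i : J, (slpII 𝒢 F perm mask).View i.1.κ i.1.G.1.N :=
    fun i => ⟨i.1.pk, shuffle (F i.1.κ i.1.k i.1.G.1.N) i.2.1⟩
  exact feasible_play hF hA (κ := fun i : J => i.1.κ) (k := fun i => i.1.k)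
    (G := fun i => i.1.G.1) (st := fun i => i.1.G.2) (V := V) (fun i => i.1.mem_G)
    (fun i => i.1.mem_pk) (w₁ _ hκ) (u₁ _ .self) (w₁ _ hk) (w₁ _ hN) (u₁ _ hNb) (w₁ _ hG.snd) ((w₁ _ hpk).pair hsh)

end

theorem toReal_bind_uniformOfFintype {n : ℕ} [NeZero n] (f : Fin n → PMF Bool) :
    ((PMF.uniformOfFintype (Fin n)).bind f true).toReal = (∑ j, (f j true).toReal) / n := by
  rw [PMF.bind_apply, tsum_fintype, ENNReal.toReal_sum, Finset.sum_div]
  · refine Finset.sum_congr rfl fun j _ => ?_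
    rw [PMF.uniformOfFintype_apply, ENNReal.toReal_mul, ENNReal.toReal_inv, Fintype.card_fin,
      ENNReal.toReal_natCast, div_eq_inv_mul]
  · exact fun j _ => ENNReal.mul_ne_top (PMF.apply_ne_top _ _) (PMF.apply_ne_top _ _)

section

variable {D : Set ℕ} {𝒢 : BilinearGenerator} {F perm : KeyedPermutation D}
  {mask : MaskingAlgorithm D}

/-- The adversary against BGN that is made from an adversary against SLP-II. -/
noncomputable def hybridAdversary (A : (slpII 𝒢 F perm mask).Adversary) (m : Polynomial ℕ)
    (p : Prog) : 𝒢.CPAAdversary where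
  choose κ _ := hybridChoose A m κ
  guess κ pk d c := p.decodedLaw (Coded.code (κ, pk, d, c))

/-- By `bind_hybridGuess`, each choice of `j` gives a hybrid. All draws but those of graph and
masking matrix are mutually independent, so `j` can be drawn first, and the game becomes a uniform
mixture of hybrids. -/
theorem cpaGame_hybridAdversary {A : (slpII 𝒢 F perm mask).Adversary} {m : Polynomial ℕ} {p : Prog}
    (hp : ∀ i : HybridContext A m,
      p.law (Coded.code (i.κ, i.pk, hybridState i.G i.B i.k i.j, i.u)) =
        (hybridGuess A i.κ i.pk i.G i.B i.k i.j i.u).map Coded.code) (b : Bool) (κ : ℕ) :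
    cpaGame (hybridAdversary A m p) b κ = (PMF.uniformOfFintype (Fin (m.eval κ + 1))).bind
      fun j : Fin (m.eval κ + 1) => hybridGame A (j + b.toNat) κ := by
  have h₁ : cpaGame (hybridAdversary A m p) b κ = (𝒢.pkGen κ).bind fun pk =>
      (hybridChoose A m κ).bind fun m => (encG pk (if b then m.1.2 else m.1.1)).bind fun c =>
        p.decodedLaw (Coded.code (κ, pk, m.2, c)) := by
    rw [pkGen, PMF.bind_map]
    rfl
  have h₂ : cpaGame (hybridAdversary A m p) b κ = (𝒢.pkGen κ).bind fun pk =>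
      (A.start κ).bind fun G => (mask.mask G.1).bind fun B => (randomBits κ).bind fun k =>
        (PMF.uniformOfFintype (Fin (m.eval κ + 1))).bind fun j : Fin (m.eval κ + 1) =>
          hybridWith A κ k pk G.1 G.2 B (j + b.toNat) := by
    rw [h₁]
    refine PMF.bind_congr_support fun pk hpk => ?_
    simp only [hybridChoose, PMF.bind_bind, PMF.bind_map, Function.comp_def]
    refine PMF.bind_congr_support fun G hG => PMF.bind_congr_support fun B hB =>
      PMF.bind_congr_support fun k _ => PMF.bind_congr_support fun j _ => ?_
    rw [← bind_hybridGuess]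
    refine PMF.bind_congr_support fun u _ => ?_
    exact Prog.decodedLaw_eq code_bool_injective (hp ⟨κ, pk, hpk, G, hG, B, hB, k, j, u⟩)
  rw [h₂]
  simp only [hybridGame]
  rw [PMF.bind_comm (PMF.uniformOfFintype _)]
  conv_lhs =>
    enter [2, pk]
    simp only [PMF.bind_comm (mask.mask _) (randomBits κ)]
    rw [PMF.bind_comm (A.start κ)]
  rw [PMF.bind_comm (𝒢.pkGen κ)]
  congr 1
  ext1 k
  rw [PMF.bind_comm (PMF.uniformOfFintype _)]
  congr 1
  ext1 pk
  rw [PMF.bind_comm (PMF.uniformOfFintype _)]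
  congr 1
  ext1 G
  rw [PMF.bind_comm (PMF.uniformOfFintype _)]

/-- The code of a graph contains its adjacency matrix row by row. So the number of vertices itself,
and not just its bit length, is bounded by the length of what the start stage writes. -/
theorem exists_bound_size {A : (slpII 𝒢 F perm mask).Adversary} (hA : A.IsPPT) :
    ∃ t : Polynomial ℕ, ∀ κ, ∀ G ∈ (A.start κ).support, G.1.N.1 ≤ t.eval κ := by
  have h := (feasible_start (s := fun κ : ℕ => κ) hA (FeasibleFun.id ((PolyBdd.self.add
    (.const 1)).mono fun κ => Nat.add_le_add_right (Nat.size_le_self κ) 1)) .self).size_output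
  obtain ⟨t, ht⟩ := h
  refine ⟨t, fun κ G hG => ?_⟩
  have h₁ := ht ⟨κ, _, code_mem_support (c := Coded.code) hG⟩
  have h₂ := length_le_size_codeList Coded.code (List.ofFn G.1.A)
  rw [List.length_ofFn] at h₂
  have h₃ : (codeList Coded.code (List.ofFn G.1.A)).size ≤ (Coded.code G).size := by
    have : (Coded.code G).size = (Data.size (.num G.1.N.1) +
      (codeList Coded.code (List.ofFn G.1.A)).size + 1) + G.2.size + 1 := rfl
    omega
  exact h₂.trans (h₃.trans h₁)

/-- Emptying the structures changes the success probability by a negligible amount. -/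
theorem negligible_gap_real_zeroGame (hBGN : 𝒢.BGNSemanticallySecure) (hF : IsPRP F)
    {A : (slpII 𝒢 F perm mask).Adversary} (hA : A.IsPPT) :
    Negligible (gap (SLPScheme.real A)
      (zeroGame A fun κ N => (randomBits κ).map fun k => F κ k N)) := by
  obtain ⟨t, ht⟩ := exists_bound_size hA
  -- A bound for the number of entries of both structures.
  let m : Polynomial ℕ := 2 * (t * t)
  obtain ⟨pC, tC, hC⟩ := feasible_hybridChoose hA m
  obtain ⟨pG, tG, hG⟩ := feasible_hybridGuess hF hA m
  have hguess : ∀ i : HybridContext A m,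
      pG.decodedLaw (Coded.code (i.κ, i.pk, hybridState i.G i.B i.k i.j, i.u)) =
        hybridGuess A i.κ i.pk i.G i.B i.k i.j i.u :=
    fun i => Prog.decodedLaw_eq code_bool_injective (hG i).1
  have hppt : (hybridAdversary A m pG).IsPPT := by
    refine ⟨pC, pG, tC + tG, fun κ pk hpk => ⟨⟨(hC ⟨κ, pk, hpk⟩).1,
      (hC ⟨κ, pk, hpk⟩).2.mono (by simp)⟩, ?_⟩⟩
    intro d hd u
    simp only [hybridAdversary, hybridChoose, PMF.mem_support_bind_iff,
      PMF.mem_support_map_iff] at hd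
    obtain ⟨G, hG', B, hB, k, -, j, -, rfl⟩ := hd
    have h := hG ⟨κ, pk, hpk, G, hG', B, hB, k, j, u⟩
    refine ⟨?_, h.2.mono (by simp)⟩
    have h' := hguess ⟨κ, pk, hpk, G, hG', B, hB, k, j, u⟩
    simp only at h'
    simp only [hybridAdversary, h']
    exact h.1
  refine ((hBGN _ hppt).polynomial_mul (m + 1)).mono fun κ => le_of_eq ?_
  have hlast : ∀ G ∈ (A.start κ).support, 2 * (G.1.N.1 * G.1.N.1) ≤ m.eval κ + 1 := by
    intro G hG
    have := ht κ G hG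
    have h₁ := Nat.mul_le_mul this this
    simp only [m, Polynomial.eval_mul, Polynomial.eval_ofNat]
    omega
  simp only [gap, real_eq_hybridGame, ← hybridGame_eq_zeroGame A hlast,
    cpaGame_hybridAdversary (fun i => (hG i).1), toReal_bind_uniformOfFintype]
  -- The differences of neighbouring hybrids telescope to the difference of hybrids 0 and m + 1; the
  -- factor m + 1 cancels the probability of each `j`.
  rw [← sub_div, ← Finset.sum_sub_distrib,
    Fin.sum_univ_eq_sum_range (fun j => (hybridGame A (j + false.toNat) κ true).toReal -
      (hybridGame A (j + true.toNat) κ true).toReal) (m.eval κ + 1)]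
  simp only [Bool.toNat_false, Bool.toNat_true, add_zero]
  rw [Finset.sum_range_sub', abs_div, Nat.abs_cast, Polynomial.eval_add, Polynomial.eval_one]
  field_simp

end

/-! ### Ideal games and the simulator that forwards trapdoors -/

/-- Iterations of two steps that correspond to each other along `π`. -/
theorem PMF.map_iter {β γ : Type} {f : β → PMF β} {g : γ → PMF γ} (π : β → γ) {P : ℕ → β → Prop}
    {n k : ℕ} {b : β} (hb : P n b)
    (hP : ∀ j b, n ≤ j → j < n + k → P j b → ∀ b' ∈ (f b).support, P (j + 1) b')
    (hfg : ∀ j b, n ≤ j → j < n + k → P j b → (f b).map π = g (π b)) :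
    (PMF.iter f k b).map π = PMF.iter g k (π b) := by
  induction k generalizing n b with
  | zero => simp [PMF.iter, PMF.pure_map]
  | succ k ih =>
    rw [PMF.iter, PMF.iter, ← hfg n b le_rfl (by omega) hb, PMF.map_bind, PMF.bind_map]
    exact PMF.bind_congr_support fun b' hb' => ih (hP n b le_rfl (by omega) hb b' hb')
      (fun j b h₁ h₂ => hP j b (by omega) (by omega))
      (fun j b h₁ h₂ => hfg j b (by omega) (by omega))

/-- One round of an interaction. -/
noncomputable def interactRound {Q R σ : Type} (ask : List R → Data → PMF (Q × Data))
    (answer : σ → Q → PMF (R × σ)) (b : List R × Data × σ) : PMF (List R × Data × σ) :=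
  (ask b.1 b.2.1).bind fun r => (answer b.2.2 r.1).map fun a => (b.1 ++ [a.1], r.2, a.2)

theorem interact_eq_iter_round {Q R σ : Type} (ask : List R → Data → PMF (Q × Data))
    (answer : σ → Q → PMF (R × σ)) (st : Data) (s : σ) (k : ℕ) :
    interact ask answer st s k = PMF.iter (interactRound ask answer) k ([], st, s) := by
  induction k with
  | zero => rfl
  | succ k ih =>
    rw [interact, ih, PMF.iter_succ]
    rfl

/-- The state of the replying side can be dropped if its replies do not depend on it. -/
theorem map_iter_interactRound {Q R σ : Type} {ask : List R → Data → PMF (Q × Data)}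
    {answer : σ → Q → PMF (R × σ)} (reply : Q → PMF R) (inv : σ → Prop)
    (h : ∀ s, inv s → ∀ v, ∃ φ : R → σ,
      answer s v = ((reply v).map fun r => (r, φ r)) ∧ ∀ r, inv (φ r))
    {s : σ} (hs : inv s) (rs : List R) (st : Data) (k : ℕ) :
    (PMF.iter (interactRound ask answer) k (rs, st, s)).map (fun b => (b.1, b.2.1)) =
      PMF.iter (fun b : List R × Data => (ask b.1 b.2).bind fun r =>
        (reply r.1).map fun τ => (b.1 ++ [τ], r.2)) k (rs, st) := by
  refine PMF.map_iter _ (P := fun _ b => inv b.2.2) (n := 0) hs (fun j b _ _ hb b' hb' => ?_)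
    fun j b _ _ hb => ?_
  · rw [interactRound, PMF.mem_support_bind_iff] at hb'
    obtain ⟨r, -, hb'⟩ := hb'
    obtain ⟨φ, hφ, hi⟩ := h _ hb r.1
    rw [hφ, PMF.map_comp, PMF.mem_support_map_iff] at hb'
    obtain ⟨τ, -, rfl⟩ := hb'
    exact hi τ
  · rw [interactRound, PMF.map_bind]
    refine congrArg (PMF.bind _) (funext fun r => ?_)
    obtain ⟨φ, hφ, -⟩ := h _ hb r.1
    rw [hφ, PMF.map_comp, PMF.map_comp]
    rfl

section

variable {D : Set ℕ} {𝒢 : BilinearGenerator} {F perm : KeyedPermutation D}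
  {mask : MaskingAlgorithm D}

theorem play_eq (A : (slpII 𝒢 F perm mask).Adversary) (κ : ℕ) (N : Size D)
    (f : Fin N.1 → Fin N.1) (V : (slpII 𝒢 F perm mask).View κ N) (st : Data) :
    play A κ N f V st = (PMF.iter (fun b : List (Fin N.1 × BitVec κ) × Data =>
      (A.query κ N b.2 V b.1).bind fun r => ((randomBits κ).map fun s => (f r.1, s)).map fun τ =>
        (b.1 ++ [τ], r.2)) (A.rounds.eval κ) ([], st)).bind fun b => A.guess κ N b.2 V b.1 := by
  simp only [PMF.map_comp]
  rfl

/-- An ideal game is a zero game if the replies of leakage algorithm and simulator can be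
described without their states. -/
theorem ideal_eq_play {L : Leakage D} (A : (slpII 𝒢 F perm mask).Adversary)
    (S : (slpII 𝒢 F perm mask).Simulator L) (κ : ℕ) :
    SLPScheme.ideal A S κ = (A.start κ).bind fun G => (L.init κ G.1.N).bind fun ℓ =>
      (S.build κ G.1.N).bind fun V =>
        (PMF.iter (interactRound (fun τs st => A.query κ G.1.N st V.1 τs)
          (fun (s : L.State κ G.1.N × List (L.Out κ G.1.N) × Data) v =>
            (L.query κ G.1.N s.1 v).bind fun o =>
              (S.trapdoor κ G.1.N s.2.2 (s.2.1 ++ [o.1])).map fun τ =>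
                (τ.1, (o.2, s.2.1 ++ [o.1], τ.2)))) (A.rounds.eval κ) ([], G.2, (ℓ, [], V.2))).bind
          fun b => A.guess κ G.1.N b.2.1 V.1 b.1 := by
  simp only [SLPScheme.ideal, interact_eq_iter_round]
  rfl

/-- The simulator that passes on the trapdoors it is told. -/
noncomputable def forwardSimulator (𝒢 : BilinearGenerator) (F perm : KeyedPermutation D)
    (mask : MaskingAlgorithm D) :
    (slpII 𝒢 F perm mask).Simulator (slpII 𝒢 F perm mask).trapdoorLeakage where
  build κ N := (zeroView 𝒢 F perm mask κ N).map fun V => (V, .num 0)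
  trapdoor _ N _ os := match os.getLast? with
    | some o => PMF.pure (o, .num os.length)
    | none => PMF.pure ((⟨0, N.2.1⟩, 0), .num 0)

theorem forwardSimulator_trapdoor (κ : ℕ) (N : Size D) (st : Data)
    (os : List ((slpII 𝒢 F perm mask).trapdoorLeakage.Out κ N))
    (o : (slpII 𝒢 F perm mask).trapdoorLeakage.Out κ N) :
    (forwardSimulator 𝒢 F perm mask).trapdoor κ N st (os ++ [o]) =
      PMF.pure (o, .num (os.length + 1)) := by
  have h : (os ++ [o]).getLast? = some o := by simp
  have h' : (os ++ [o]).length = os.length + 1 := by simp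
  simp only [forwardSimulator]
  erw [h]
  simp only
  erw [h']
  rfl

theorem polyBdd_natSize {ι : Type} {s a : ι → ℕ} (h : PolyBdd s a) :
    PolyBdd s fun i => (Data.num (a i)).size :=
  (h.add (.const 1)).mono fun _ => Nat.add_le_add_right (Nat.size_le_self _) 1

/-- Building a structure of encryptions of `0` from its size, together with some state. -/
theorem feasible_zeroView_pair (𝒢 : BilinearGenerator) (F perm : KeyedPermutation D)
    (mask : MaskingAlgorithm D) {st : ℕ → Size D → Data}
    (hst : ∀ (s : ℕ × Size D → ℕ) (x : ℕ × Size D → Data),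
      (FeasibleFun s x fun i => .num i.2.1) → (PolyBdd s fun i => i.2.1) →
      FeasibleFun s x fun i => st i.1 i.2) :
    Feasible (ι := ℕ × Size D) (fun i => i.1 + i.2.1) (fun i => Coded.code i)
      fun i => ((zeroView 𝒢 F perm mask i.1 i.2).map fun V => (V, st i.1 i.2)).map Coded.code := by
  have hκb : PolyBdd (fun i : ℕ × Size D => i.1 + i.2.1) fun i => i.1 :=
    PolyBdd.self.mono fun i => Nat.le_add_right _ _
  have hNb : PolyBdd (fun i : ℕ × Size D => i.1 + i.2.1) fun i => i.2.1 :=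
    PolyBdd.self.mono fun i => Nat.le_add_left _ _
  have hid := FeasibleFun.id (s := fun i : ℕ × Size D => i.1 + i.2.1) (x := fun i => Coded.code i)
    (((polyBdd_natSize hκb).add (polyBdd_natSize hNb)).add (.const 1))
  refine ((feasible_zeroView (𝒢 := 𝒢) F perm mask hid.fst hκb hid.snd hNb).map
    (g := fun i V => .pair (Coded.code V) (st i.1 i.2)) fun s₁ x₁ w₁ v₁ u₁ =>
      v₁.pair (w₁ _ (hst _ _ hid.snd hNb))).congr fun i => ?_
  rw [PMF.map_comp]
  rfl

/-- At every reachable state the stored number is that of the earlier queries. It tells the program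
at which position of the list the current leakage stands. -/
theorem forwardSimulator_isPPT : (forwardSimulator 𝒢 F perm mask).IsPPT := by
  obtain ⟨pB, tB, hB⟩ := feasible_zeroView_pair 𝒢 F perm mask (st := fun _ _ => .num 0)
    fun _ _ hN _ => hN.numeral 0
  have hT : FeasibleFun
      (ι := Σ i : ℕ × Size D, List (Fin i.2.1 × BitVec i.1) × (Fin i.2.1 × BitVec i.1))
      (fun i => i.1.1 + i.1.2.1 + codeSize (i.2.1 ++ [i.2.2]))
      (fun i => Coded.code (i.1.1, i.1.2, Data.num i.2.1.length, i.2.1 ++ [i.2.2]))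
      (fun i => Coded.code (i.2.2, Data.num (i.2.1.length + 1))) := by
    have hid := FeasibleFun.id
      (ι := Σ i : ℕ × Size D, List (Fin i.2.1 × BitVec i.1) × (Fin i.2.1 × BitVec i.1))
      (s := fun i => i.1.1 + i.1.2.1 + codeSize (i.2.1 ++ [i.2.2]))
      (x := fun i => Coded.code (i.1.1, i.1.2, Data.num i.2.1.length, i.2.1 ++ [i.2.2])) (by
        refine ((PolyBdd.self.mul (.const 2)).add (.const 6)).mono fun i => ?_
        have h₁ := Nat.size_le_self i.1.1
        have h₂ := Nat.size_le_self i.1.2.1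
        have h₃ := Nat.size_le_self i.2.1.length
        have h₄ := length_le_size_codeList Coded.code (i.2.1 ++ [i.2.2])
        rw [List.length_append] at h₄
        simp only [Coded.code, Data.size, codeSize, codeList] at *
        omega)
    have hlen := hid.snd.snd.fst
    have hlast := hid.snd.snd.snd.nth (c := fun _ => Coded.code) (l := fun i => i.2.1 ++ [i.2.2])
      hlen fun i => by simp
    exact (hlast.pair (hlen.add (hlen.numeral 1))).congr fun i => by simp; rfl
  obtain ⟨pT, tT, hT⟩ := hT
  refine ⟨pB, pT, tB + tT, fun κ N => ⟨⟨(hB (κ, N)).1, (hB (κ, N)).2.mono (by simp)⟩, ?_⟩⟩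
  intro os st o hst
  have hst : st = .num os.length := by
    cases hst with
    | start V st h =>
      simp only [forwardSimulator, PMF.mem_support_map_iff, Prod.mk.injEq] at h
      obtain ⟨_, _, _, rfl⟩ := h
      rfl
    | step os st o τ st' _ h =>
      rw [forwardSimulator_trapdoor] at h
      rw [(Prod.mk.inj ((PMF.mem_support_pure_iff _ _).1 h)).2]
      simp
  have h := hT ⟨(κ, N), os, o⟩
  rw [hst]
  refine ⟨?_, h.2.mono (by simp only [Polynomial.eval_add]; exact Nat.le_add_left _ _)⟩
  rw [forwardSimulator_trapdoor]
  exact h.1.trans (PMF.pure_map _ _).symm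

/-- The reply of the forwarding simulator together with the leakage algorithm. -/
theorem forwardSimulator_answer (κ : ℕ) (N : Size D) (ℓ : ℕ × BitVec κ) (v : Fin N.1)
    (os : List ((slpII 𝒢 F perm mask).trapdoorLeakage.Out κ N)) (st : Data) :
    ((slpII 𝒢 F perm mask).trapdoorLeakage.query κ N ℓ v).bind (fun o =>
      ((forwardSimulator 𝒢 F perm mask).trapdoor κ N st (os ++ [o.1])).map fun τ =>
        (τ.1, (o.2, os ++ [o.1], τ.2))) =
    ((randomBits κ).map fun s => (F κ ℓ.2 N v, s)).map
      fun τ : (slpII 𝒢 F perm mask).trapdoorLeakage.Out κ N =>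
        (τ, (ℓ, os ++ [τ], .num (os.length + 1))) := by
  have hq : (slpII 𝒢 F perm mask).trapdoorLeakage.query κ N ℓ v =
      ((randomBits κ).map fun s => (F κ ℓ.2 N v, s)).map fun τ => (τ, ℓ) := by
    rw [PMF.map_comp]
    simp only [SLPScheme.trapdoorLeakage, slpII, PMF.do_bind, PMF.do_pure, PMF.bind_bind,
      PMF.pure_bind]
    rfl
  refine (congrArg (fun p => PMF.bind p _) hq).trans ((PMF.bind_map _ _ _).trans ?_)
  refine congrArg (PMF.bind _) (funext fun τ => ?_)
  exact (congrArg (PMF.map _) (forwardSimulator_trapdoor κ N st os _)).trans (PMF.pure_map _ _)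

/-- The leakage algorithm has a key of its own, of which only the client's part matters. Structures
of encrypted zeros do not involve this part, so it makes no difference that it is drawn
independently of them and in a different order. -/
theorem ideal_forwardSimulator (A : (slpII 𝒢 F perm mask).Adversary) (κ : ℕ) :
    SLPScheme.ideal A (forwardSimulator 𝒢 F perm mask) κ =
      zeroGame A (fun κ N => (randomBits κ).map fun k => F κ k N) κ := by
  rw [ideal_eq_play, zeroGame]
  refine congrArg (PMF.bind _) (funext fun G => ?_)
  have hinit : ∀ g : BitVec κ → PMF Bool,
      ((slpII 𝒢 F perm mask).trapdoorLeakage.init κ G.1.N).bind (fun ℓ => g ℓ.2) =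
        (randomBits κ).bind g := by
    intro g
    simp only [SLPScheme.trapdoorLeakage, slpII, PMF.do_bind, PMF.do_pure, PMF.map_bind,
      PMF.pure_map, PMF.bind_bind, PMF.pure_bind, PMF.bind_const]
  rw [PMF.bind_comm, show (forwardSimulator 𝒢 F perm mask).build κ G.1.N =
    (zeroView 𝒢 F perm mask κ G.1.N).map fun V => (V, .num 0) from rfl, PMF.bind_map]
  refine congrArg (PMF.bind _) (funext fun V => ?_)
  refine Eq.trans ?_ ((hinit fun k => play A κ G.1.N (F κ k G.1.N) V G.2).trans
    (PMF.bind_map (randomBits κ) (fun k => F κ k G.1.N) fun f => play A κ G.1.N f V G.2).symm)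
  refine congrArg (PMF.bind _) (funext fun (ℓ : ℕ × BitVec κ) => ?_)
  have := map_iter_interactRound (ask := fun τs st => A.query κ G.1.N st V τs)
    (answer := fun (s : (slpII 𝒢 F perm mask).trapdoorLeakage.State κ G.1.N ×
      List ((slpII 𝒢 F perm mask).trapdoorLeakage.Out κ G.1.N) × Data) v =>
        ((slpII 𝒢 F perm mask).trapdoorLeakage.query κ G.1.N s.1 v).bind fun o =>
          ((forwardSimulator 𝒢 F perm mask).trapdoor κ G.1.N s.2.2 (s.2.1 ++ [o.1])).map fun τ =>
            (τ.1, (o.2, s.2.1 ++ [o.1], τ.2)))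
    (fun v => (randomBits κ).map fun s => (F κ ℓ.2 G.1.N v, s)) (fun s => s.1 = ℓ)
    (fun s hs v => ⟨fun (τ : (slpII 𝒢 F perm mask).trapdoorLeakage.Out κ G.1.N) =>
      (ℓ, s.2.1 ++ [τ], .num (s.2.1.length + 1)), by
      subst hs
      exact forwardSimulator_answer κ G.1.N s.1 v s.2.1 s.2.2,
      fun _ => rfl⟩)
    (s := (ℓ, [], .num 0)) rfl [] G.2 (A.rounds.eval κ)
  rw [play_eq]
  exact (PMF.bind_map (PMF.iter _ _ _) (fun b : List (Fin G.1.N.1 × BitVec κ) × Data × _ =>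
    (b.1, b.2.1)) fun b : List (Fin G.1.N.1 × BitVec κ) × Data =>
      A.guess κ G.1.N b.2 V b.1).symm.trans (congrArg (fun p => PMF.bind p _) this)

end

/-! ## The distinguisher for the permutations -/

/-- The distinguisher rebuilds the trapdoors in this way, from the replies it gets and the strings
it has drawn itself. -/
theorem FeasibleFun.zip {ι : Type} {s : ι → ℕ} {x : ι → Data} {α β : ι → Type}
    {c : ∀ i, α i → Data} {c' : ∀ i, β i → Data} {l : ∀ i, List (α i)} {l' : ∀ i, List (β i)}
    (hlen : FeasibleFun s x fun i => .num (l i).length) (h : ∀ i, (l' i).length = (l i).length)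
    (hl : FeasibleFun s x fun i => codeList (c i) (l i))
    (hl' : FeasibleFun s x fun i => codeList (c' i) (l' i)) :
    FeasibleFun s x fun i =>
      codeList (fun a : α i × β i => .pair (c i a.1) (c' i a.2)) ((l i).zip (l' i)) := by
  have := FeasibleFun.ofFn (c := fun i (a : α i × β i) => .pair (c i a.1) (c' i a.2))
    (n := fun i => (l i).length)
    (v := fun i j => ((l i)[j], (l' i)[(j : ℕ)]'((h i).symm ▸ j.2))) hlen
    (hl.size_output.mono fun i => length_le_size_codeList _ _) fun s' x' w v u =>
      ((w _ hl).nth v fun j => j.2.2).pair ((w _ hl').nth v fun j => (h j.1).symm ▸ j.2.2)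
  refine this.congr fun i => congrArg _ (List.ext_getElem (by simp [h i]) fun j h₁ h₂ => by simp)

section

variable {D : Set ℕ} {𝒢 : BilinearGenerator} {F perm : KeyedPermutation D}
  {mask : MaskingAlgorithm D}

/-- What the distinguisher remembers: the state of the adversary against SLP-II, its view and the
second components of the trapdoors. -/
noncomputable def relayState {κ : ℕ} {N : Size D} (V : (slpII 𝒢 F perm mask).View κ N)
    (ss : List (BitVec κ)) (st : Data) : Data :=
  .pair st (.pair (Coded.code V) (.pair (.num ss.length) (Coded.code ss)))

/-- The first stage of the distinguisher. -/
noncomputable def relayStart (A : (slpII 𝒢 F perm mask).Adversary) (κ : ℕ) :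
    PMF (Size D × Data) :=
  (A.start κ).bind fun G => (zeroView 𝒢 F perm mask κ G.1.N).map fun V =>
    (G.1.N, relayState V [] G.2)

/-- The query of the distinguisher. -/
noncomputable def relayQuery (A : (slpII 𝒢 F perm mask).Adversary) (κ : ℕ) (N : Size D)
    (V : (slpII 𝒢 F perm mask).View κ N) (ys : List (Fin N.1)) (ss : List (BitVec κ)) (st : Data) :
    PMF (Fin N.1 × Data) :=
  (A.query κ N st V (ys.zip ss)).bind fun r =>
    (randomBits κ).map fun s => (r.1, relayState V (ss ++ [s]) r.2)

/-- The situations in which the distinguisher may have to act. -/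
structure RelayContext (A : (slpII 𝒢 F perm mask).Adversary) where
  κ : ℕ
  N : Size D
  exists_start : ∃ G ∈ (A.start κ).support, G.1.N = N
  V : (slpII 𝒢 F perm mask).View κ N
  mem_V : V ∈ (zeroView 𝒢 F perm mask κ N).support
  ys : List (Fin N.1)
  ss : List (BitVec κ)
  length_ss : ss.length = ys.length
  st : Data
  reach : A.Reach κ N V (ys.zip ss) st
  length_ys : ys.length ≤ A.rounds.eval κ

/-- The input of the distinguisher. -/
noncomputable def RelayContext.input {A : (slpII 𝒢 F perm mask).Adversary} (i : RelayContext A) :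
    Data :=
  Coded.code (i.κ, i.N, relayState i.V i.ss i.st, i.ys)

theorem RelayContext.length_zip {A : (slpII 𝒢 F perm mask).Adversary} (i : RelayContext A) :
    (i.ys.zip i.ss).length = i.ys.length := by
  simp [i.length_ss]

theorem RelayContext.size_messages_le {A : (slpII 𝒢 F perm mask).Adversary} (i : RelayContext A) :
    i.κ + codeSize i.V + codeSize (α := List ((slpII 𝒢 F perm mask).Trapdoor i.κ i.N))
      (i.ys.zip i.ss) ≤ i.κ + (Coded.code (i.κ, i.N, i.st, i.V, i.ys.zip i.ss)).size := by
  have : (Coded.code (i.κ, i.N, i.st, i.V, i.ys.zip i.ss)).size = (Nat.size i.κ + 1) +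
    ((Nat.size i.N.1 + 1) + (i.st.size + (codeSize i.V +
      codeSize (α := List ((slpII 𝒢 F perm mask).Trapdoor i.κ i.N)) (i.ys.zip i.ss) + 1) + 1) + 1)
        + 1 := rfl
  omega

theorem fst_mem_support_of_zeroView {κ : ℕ} {N : Size D} {V : (slpII 𝒢 F perm mask).View κ N}
    (h : V ∈ (zeroView 𝒢 F perm mask κ N).support) : V.1 ∈ (𝒢.pkGen κ).support := by
  rw [zeroView_eq, PMF.mem_support_bind_iff] at h
  obtain ⟨pk, hpk, h⟩ := h
  rw [PMF.mem_support_map_iff] at h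
  obtain ⟨T, -, rfl⟩ := h
  exact hpk

/-- All components are bounded in terms of κ: N by the start stage, the structures by the program
that makes them, the lists by the number of rounds, and the state of `A` because the next stage of
`A`, query or guess, has to read it. -/
theorem RelayContext.polyBdd_size {A : (slpII 𝒢 F perm mask).Adversary} (hA : A.IsPPT) :
    PolyBdd (fun i : RelayContext A => i.κ) fun i => i.input.size := by
  obtain ⟨b, hb⟩ := exists_bound_size hA
  have hN : PolyBdd (fun i : RelayContext A => i.κ) fun i => i.N.1 := ⟨b, fun i => by
    obtain ⟨G, hG, h⟩ := i.exists_start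
    exact (congrArg Subtype.val h).symm.trans_le (hb _ G hG)⟩
  have hV : PolyBdd (fun i : RelayContext A => i.κ) fun i => (Coded.code i.V).size := by
    have hid := FeasibleFun.id (s := fun i : RelayContext A => i.κ)
      (x := fun i => .pair (.num i.κ) (.num i.N.1))
      (((polyBdd_natSize .self).add (polyBdd_natSize hN)).add (.const 1))
    exact (feasible_zeroView (𝒢 := 𝒢) F perm mask hid.fst .self hid.snd hN).size_output.reindex
      fun i : RelayContext A => ⟨i, _, code_mem_support i.mem_V⟩
  have hr : PolyBdd (fun i : RelayContext A => i.κ) fun i => A.rounds.eval i.κ :=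
    PolyBdd.self.eval A.rounds
  have hτ : PolyBdd (fun i : RelayContext A => i.κ)
      fun i => (codeList Coded.code (i.ys.zip i.ss)).size := by
    refine ((hr.mul ((hN.add .self).add (.const 4))).add (.const 1)).mono fun i => ?_
    refine (size_trapdoors _).trans (Nat.add_le_add_right (Nat.mul_le_mul_right _ ?_) _)
    rw [List.length_zip]
    exact (min_le_left _ _).trans i.length_ys
  have hss : PolyBdd (fun i : RelayContext A => i.κ)
      fun i => (codeList Coded.code i.ss).size := by
    refine ((hr.mul (PolyBdd.self.add (.const 2))).add (.const 1)).mono fun i => ?_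
    refine (size_codeList_le (m := i.κ + 1) _ fun a _ => ?_).trans (Nat.add_le_add_right
      (Nat.mul_le_mul_right _ (i.length_ss.trans_le i.length_ys)) _)
    exact Nat.add_le_add_right (Nat.size_le.2 a.isLt) 1
  have hys : PolyBdd (fun i : RelayContext A => i.κ)
      fun i => (codeList Coded.code i.ys).size := by
    refine ((hr.mul (hN.add (.const 2))).add (.const 1)).mono fun i => ?_
    refine (size_codeList_le (m := i.N.1 + 1) _ fun a _ => ?_).trans (Nat.add_le_add_right
      (Nat.mul_le_mul_right _ i.length_ys) _)
    exact Nat.add_le_add_right ((Nat.size_le_self _).trans a.2.le) 1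
  have hst : PolyBdd (fun i : RelayContext A => i.κ) fun i => i.st.size := by
    obtain ⟨pS, pQ, pG, t, hA⟩ := hA
    refine (((PolyBdd.self.add hV).add hτ).eval t).mono fun i => ?_
    have h := (hA i.κ).2 i.N i.V _ i.st (by
      rw [map_keyGen]
      exact fst_mem_support_of_zeroView i.mem_V) i.reach
    have hs : i.st.size ≤ (Coded.code (i.κ, i.N, i.st, i.V, i.ys.zip i.ss)).size := by
      simp only [Coded.code, Data.size]
      omega
    refine hs.trans ?_
    rcases i.length_ys.lt_or_eq with h' | h'
    · exact Prog.CostLe.size_le (h.1 (i.length_zip.trans_lt h')).2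
    · exact Prog.CostLe.size_le (h.2 (i.length_zip.trans h')).2
  refine ((((((PolyBdd.self.add hN).add hst).add hV).add hr).add (hss.add hys)).add
    (.const 9)).mono fun i => ?_
  have h₁ := Nat.size_le_self i.κ
  have h₂ := Nat.size_le_self i.N.1
  have h₃ := (Nat.size_le_self i.ss.length).trans (i.length_ss.trans_le i.length_ys)
  have h₄ : i.input.size = (Nat.size i.κ + 1) + ((Nat.size i.N.1 + 1) + ((i.st.size +
    ((Coded.code i.V).size + ((Nat.size i.ss.length + 1) + (codeList Coded.code i.ss).size + 1) + 1)
      + 1) + (codeList Coded.code i.ys).size + 1) + 1) + 1 := rfl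
  omega

/-- The programs of the distinguisher have access to all data of the game. -/
theorem RelayContext.feasible_components {A : (slpII 𝒢 F perm mask).Adversary} (hA : A.IsPPT) :
    (FeasibleFun (fun i : RelayContext A => i.κ) RelayContext.input fun i => .num i.κ) ∧
    (FeasibleFun (fun i : RelayContext A => i.κ) RelayContext.input fun i =>
      Coded.code (i.κ, i.N, i.st, i.V, i.ys.zip i.ss)) ∧
    (FeasibleFun (fun i : RelayContext A => i.κ) RelayContext.input fun i => Coded.code i.V) ∧
    (FeasibleFun (fun i : RelayContext A => i.κ) RelayContext.input fun i => .num i.ss.length) ∧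
    (FeasibleFun (fun i : RelayContext A => i.κ) RelayContext.input fun i =>
      codeList Coded.code i.ss) := by
  have hid := FeasibleFun.id (RelayContext.polyBdd_size hA)
  have hs := hid.snd.snd.fst
  have hlen := hs.snd.snd.fst
  have hz := FeasibleFun.zip (hlen.congr fun i => by rw [i.length_ss]) (fun i => i.length_ss)
    (c := fun _ => Coded.code) (l := fun i : RelayContext A => i.ys) hid.snd.snd.snd
    (c' := fun _ => Coded.code) (l' := fun i : RelayContext A => i.ss) hs.snd.snd.snd
  exact ⟨hid.fst, hid.fst.pair (hid.snd.fst.pair (hs.fst.pair (hs.snd.fst.pair hz))), hs.snd.fst,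
    hlen, hs.snd.snd.snd⟩

theorem feasible_relayStart {A : (slpII 𝒢 F perm mask).Adversary} (hA : A.IsPPT) :
    Feasible (fun κ : ℕ => κ) (fun κ => Coded.code κ)
      fun κ => (relayStart A κ).map Coded.code := by
  obtain ⟨b, hb⟩ := exists_bound_size hA
  have hκ := FeasibleFun.id (s := fun κ : ℕ => κ) (x := fun κ => .num κ) (polyBdd_natSize .self)
  refine ((feasible_start hA hκ .self).bind (ν := fun κ G =>
    (zeroView 𝒢 F perm mask κ G.1.N).map fun V => Coded.code (G.1.N, relayState V [] G.2))
    fun s₁ x₁ w₁ v₁ u₁ => ?_).congr fun κ => by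
      simp only [relayStart, PMF.map_bind, PMF.map_comp]; rfl
  have hN := v₁.fst.fst
  refine ((feasible_zeroView (𝒢 := 𝒢) F perm mask (w₁ _ hκ) (u₁ _ .self) hN ?_).map
    fun s₂ x₂ w₂ v₂ u₂ => ?_)
  · exact ((u₁ _ .self).eval b).mono fun j => hb j.1 j.2.1 j.2.2
  · exact (w₂ _ hN).pair ((w₂ _ v₁.snd).pair (v₂.pair ((v₂.numeral 0).pair (v₂.numeral 0))))

theorem feasible_relayQuery {A : (slpII 𝒢 F perm mask).Adversary} (hA : A.IsPPT) :
    Feasible (fun i : {i : RelayContext A // i.ys.length < A.rounds.eval i.κ} => i.1.κ)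
      (fun i => i.1.input) fun i =>
        (relayQuery A i.1.κ i.1.N i.1.V i.1.ys i.1.ss i.1.st).map Coded.code := by
  obtain ⟨hκ, hin, hV, hlen, hss⟩ := RelayContext.feasible_components hA
  have hin := hin.reindex fun i : {i : RelayContext A // i.ys.length < A.rounds.eval i.κ} => i.1
  have hs := hin.size_output
  obtain ⟨pS, pQ, pG, t, hA⟩ := hA
  have hQ := Feasible.of_realizes
    fun i : {i : RelayContext A // i.ys.length < A.rounds.eval i.κ} =>
      ((hA i.1.κ).2 i.1.N i.1.V (i.1.ys.zip i.1.ss) i.1.st (by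
        rw [map_keyGen]
        exact fst_mem_support_of_zeroView i.1.mem_V) i.1.reach).1 (by
          exact i.1.length_zip.trans_lt i.2)
  have hQ := hQ.rescale (s' := fun i => i.1.κ)
    ((PolyBdd.self.add hs).mono fun i => i.1.size_messages_le)
  refine ((hin.comp hQ).bind (ν := fun i r => (randomBits i.1.κ).map fun s =>
    Coded.code (r.1, relayState i.1.V (i.1.ss ++ [s]) r.2)) fun s₁ x₁ w₁ v₁ u₁ => ?_).congr
      fun i => by simp only [relayQuery, PMF.map_bind, PMF.map_comp]; rfl
  refine (Feasible.randomBits (w₁ _ (hκ.reindex _)) (u₁ _ .self)).map fun s₂ x₂ w₂ v₂ u₂ => ?_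
  have hl := w₂ _ (w₁ _ (hlen.reindex _))
  refine (w₂ _ v₁.fst).pair ((w₂ _ v₁.snd).pair ((w₂ _ (w₁ _ (hV.reindex _))).pair
    (((hl.add (hl.numeral 1)).congr fun j => ?_).pair
      (hl.append (w₂ _ (w₁ _ (hss.reindex _))) v₂))))
  simp

theorem feasible_relayGuess {A : (slpII 𝒢 F perm mask).Adversary} (hA : A.IsPPT) :
    Feasible (fun i : {i : RelayContext A // i.ys.length = A.rounds.eval i.κ} => i.1.κ)
      (fun i => i.1.input) fun i =>
        (A.guess i.1.κ i.1.N i.1.st i.1.V (i.1.ys.zip i.1.ss)).map Coded.code := by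
  obtain ⟨hκ, hin, -⟩ := RelayContext.feasible_components hA
  have hin := hin.reindex fun i : {i : RelayContext A // i.ys.length = A.rounds.eval i.κ} => i.1
  have hs := hin.size_output
  obtain ⟨pS, pQ, pG, t, hA⟩ := hA
  have hG := Feasible.of_realizes (β := fun _ => Bool)
    fun i : {i : RelayContext A // i.ys.length = A.rounds.eval i.κ} =>
      ((hA i.1.κ).2 i.1.N i.1.V (i.1.ys.zip i.1.ss) i.1.st (by
        rw [map_keyGen]
        exact fst_mem_support_of_zeroView i.1.mem_V) i.1.reach).2 (by
          exact i.1.length_zip.trans i.2)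
  exact hin.comp (hG.rescale ((PolyBdd.self.add hs).mono fun i => i.1.size_messages_le))

/-- The distinguisher for the permutations that plays the zero game. -/
noncomputable def relay (A : (slpII 𝒢 F perm mask).Adversary) (pQ pG : Prog) :
    PRPDistinguisher D where
  rounds := A.rounds
  start := relayStart A
  query κ N st ys :=
    haveI : Nonempty (Fin N.1 × Data) := ⟨(⟨0, N.2.1⟩, .num 0)⟩
    pQ.decodedLaw (Coded.code (κ, N, st, ys))
  guess κ N st ys := pG.decodedLaw (Coded.code (κ, N, st, ys))


/-- Programs for the query and for the guess of the distinguisher. -/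
structure RelayPrograms (A : (slpII 𝒢 F perm mask).Adversary) (pQ pG : Prog) : Prop where
  query : ∀ i : RelayContext A, i.ys.length < A.rounds.eval i.κ →
    pQ.law i.input = (relayQuery A i.κ i.N i.V i.ys i.ss i.st).map Coded.code
  guess : ∀ i : RelayContext A, i.ys.length = A.rounds.eval i.κ →
    pG.law i.input = (A.guess i.κ i.N i.st i.V (i.ys.zip i.ss)).map Coded.code

section

variable {A : (slpII 𝒢 F perm mask).Adversary} {pQ pG : Prog}

theorem code_query_injective (N : ℕ) :
    Function.Injective (Coded.code : Fin N × Data → Data) := by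
  rintro ⟨a, d⟩ ⟨b, e⟩ h
  have h : Data.pair (.num a) d = .pair (.num b) e := h
  obtain ⟨h₁, rfl⟩ := Data.pair.inj h
  rw [Fin.ext (Data.num.inj h₁)]

theorem relay_query (hp : RelayPrograms A pQ pG) (i : RelayContext A)
    (hi : i.ys.length < A.rounds.eval i.κ) :
    (relay A pQ pG).query i.κ i.N (relayState i.V i.ss i.st) i.ys =
      relayQuery A i.κ i.N i.V i.ys i.ss i.st :=
  haveI : Nonempty (Fin i.N.1 × Data) := ⟨(⟨0, i.N.2.1⟩, .num 0)⟩
  Prog.decodedLaw_eq (code_query_injective _) (hp.query i hi)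

theorem relay_guess (hp : RelayPrograms A pQ pG) (i : RelayContext A)
    (hi : i.ys.length = A.rounds.eval i.κ) :
    (relay A pQ pG).guess i.κ i.N (relayState i.V i.ss i.st) i.ys =
      A.guess i.κ i.N i.st i.V (i.ys.zip i.ss) :=
  Prog.decodedLaw_eq code_bool_injective (hp.guess i hi)

/-- The time bounds are required at all reachable states, for arbitrary replies. Each of them
encodes a state of `A` that is itself reachable, with trapdoors made of these replies; this is where
the programs are known to be correct. -/
theorem relay_reach (hp : RelayPrograms A pQ pG) {κ : ℕ} {N : Size D} {ys : List (Fin N.1)}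
    {d : Data} (h : (relay A pQ pG).Reach κ N ys d) (hys : ys.length ≤ A.rounds.eval κ) :
    ∃ (V : (slpII 𝒢 F perm mask).View κ N) (ss : List (BitVec κ)) (st : Data),
      (∃ G ∈ (A.start κ).support, G.1.N = N) ∧ V ∈ (zeroView 𝒢 F perm mask κ N).support ∧
      ss.length = ys.length ∧ A.Reach κ N V (ys.zip ss) st ∧ d = relayState V ss st := by
  induction h with
  | start d h =>
    simp only [relay, relayStart, PMF.mem_support_bind_iff, PMF.mem_support_map_iff] at h
    obtain ⟨G, hG, V, hV, h⟩ := h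
    obtain ⟨rfl, rfl⟩ := Prod.mk.inj h
    exact ⟨V, [], G.2, ⟨G, hG, rfl⟩, hV, rfl, .start G.1 G.2 hG rfl, rfl⟩
  | step ys d x d' y _ h ih =>
    rw [List.length_append, List.length_singleton] at hys
    obtain ⟨V, ss, st, hG, hV, hss, hr, rfl⟩ := ih (by omega)
    rw [relay_query hp ⟨κ, N, hG, V, hV, ys, ss, hss, st, hr, by omega⟩
      (Nat.lt_of_succ_le hys), relayQuery, PMF.mem_support_bind_iff] at h
    obtain ⟨r, hr', h⟩ := h
    rw [PMF.mem_support_map_iff] at h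
    obtain ⟨s, -, h⟩ := h
    obtain ⟨rfl, rfl⟩ := Prod.mk.inj h
    refine ⟨V, ss ++ [s], r.2, hG, hV, by simp [hss], ?_, rfl⟩
    rw [List.zip_append hss.symm]
    exact .step _ _ _ _ (y, s) hr hr'

/-- Rounds of the two games correspond to each other along `π`, which splits the trapdoors into
positions, the replies of the distinguisher's game, and strings, which are kept in its state. No
property of the law `P` is needed. -/
theorem prpGame_relay (hp : RelayPrograms A pQ pG)
    (P : (κ : ℕ) → (N : Size D) → PMF (Equiv.Perm (Fin N.1))) (κ : ℕ) :
    prpGame (relay A pQ pG) P κ = zeroGame A P κ := by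
  have h₁ : ∀ (N : Size D) (st : Data) (f : Equiv.Perm (Fin N.1)),
      (interact (fun ys st => (relay A pQ pG).query κ N st ys)
        (fun (_ : Unit) x => PMF.pure (f x, ())) st () (A.rounds.eval κ)) = _ :=
    fun N st f => (congrArg (fun q => interact _ q st () _) (funext fun _ => funext fun x =>
      (PMF.pure_bind (f x) fun τ => PMF.pure (τ, ())).symm)).trans
        (interact_eq_iter (fun ys st => (relay A pQ pG).query κ N st ys)
          (fun x => PMF.pure (f x)) st (A.rounds.eval κ))
  have h₂ : prpGame (relay A pQ pG) P κ = (A.start κ).bind fun G =>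
      (zeroView 𝒢 F perm mask κ G.1.N).bind fun V => (P κ G.1.N).bind fun f =>
        (PMF.iter (fun b : List (Fin G.1.N.1) × Data =>
          ((relay A pQ pG).query κ G.1.N b.2 b.1).bind fun r =>
            (PMF.pure (f r.1)).map fun τ => (b.1 ++ [τ], r.2)) (A.rounds.eval κ)
              ([], relayState V [] G.2)).bind fun b => (relay A pQ pG).guess κ G.1.N b.2 b.1 := by
    have : prpGame (relay A pQ pG) P κ = (relayStart A κ).bind fun G => (P κ G.1).bind fun f =>
      (interact (fun ys st => (relay A pQ pG).query κ G.1 st ys)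
        (fun (_ : Unit) x => PMF.pure (f x, ())) G.2 () (A.rounds.eval κ)).bind fun b =>
          (relay A pQ pG).guess κ G.1 b.2.1 b.1 := rfl
    rw [this]
    simp only [relayStart, PMF.bind_bind, PMF.bind_map, Function.comp_def, h₁]
  rw [h₂, zeroGame]
  refine PMF.bind_congr_support fun G hG => PMF.bind_congr_support fun V hV =>
    congrArg (PMF.bind _) (funext fun f => ?_)
  let I : ℕ → List (Fin G.1.N.1 × BitVec κ) × Data → Prop := fun j b =>
    b.1.length = j ∧ A.Reach κ G.1.N V b.1 b.2
  have h₀ : I 0 ([], G.2) := ⟨rfl, .start G.1 G.2 hG rfl⟩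
  have hI : ∀ j b, I j b → ∀ b' ∈ (playRound A κ G.1.N f V b).support, I (j + 1) b' := by
    rintro _ b ⟨rfl, hb⟩ b' hb'
    rw [playRound, PMF.mem_support_bind_iff] at hb'
    obtain ⟨r, hr, hb'⟩ := hb'
    rw [PMF.mem_support_map_iff] at hb'
    obtain ⟨q, -, rfl⟩ := hb'
    exact ⟨by simp, .step _ _ r.1 _ _ hb hr⟩
  have hzip : ∀ l : List (Fin G.1.N.1 × BitVec κ), (l.map Prod.fst).zip (l.map Prod.snd) = l :=
    fun l => by induction l <;> simp_all
  let ctx : ∀ b : List (Fin G.1.N.1 × BitVec κ) × Data, b.1.length ≤ A.rounds.eval κ →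
      A.Reach κ G.1.N V b.1 b.2 → RelayContext A := fun b hb hr =>
    ⟨κ, G.1.N, ⟨G, hG, rfl⟩, V, hV, b.1.map Prod.fst, b.1.map Prod.snd, by simp, b.2,
      by rw [hzip]; exact hr, by simpa using hb⟩
  let π : List (Fin G.1.N.1 × BitVec κ) × Data → List (Fin G.1.N.1) × Data := fun b =>
    (b.1.map Prod.fst, relayState V (b.1.map Prod.snd) b.2)
  have hiter := PMF.map_iter (f := playRound A κ G.1.N f V) (g := fun b =>
      ((relay A pQ pG).query κ G.1.N b.2 b.1).bind fun r =>
        (PMF.pure (f r.1)).map fun τ => (b.1 ++ [τ], r.2)) π (n := 0) (k := A.rounds.eval κ) h₀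
    (fun j b _ _ => hI j b) (fun j b _ hj hb => by
      have h := relay_query hp (ctx b (by have := hb.1; omega) hb.2) (by
        have := hb.1
        simp only [ctx, List.length_map]
        omega)
      simp only [ctx] at h
      simp only [π, h, relayQuery, hzip, playRound, PMF.bind_bind, Function.comp_def,
        ← PMF.bind_pure_comp]
      simp)
  rw [show ([], relayState V [] G.2) = π ([], G.2) from rfl, ← hiter, PMF.bind_map, play]
  refine PMF.bind_congr_support fun b hb => ?_
  have hb : I (A.rounds.eval κ) b := by
    have := PMF.iter_invariant (P := I) (n := 0) h₀ (fun j b _ _ => hI j b) hb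
    rwa [zero_add] at this
  have h := relay_guess hp (ctx b hb.1.le hb.2) (by
    simp only [ctx, List.length_map]
    exact hb.1)
  simp only [ctx, hzip] at h
  exact h

end

/-- Pseudorandom and random positions are indistinguishable in the zero game. -/
theorem negligible_gap_zeroGame (hF : IsPRP F) {A : (slpII 𝒢 F perm mask).Adversary}
    (hA : A.IsPPT) :
    Negligible (gap (zeroGame A fun κ N => (randomBits κ).map fun k => F κ k N)
      (zeroGame A fun _ N => PMF.uniformOfFintype (Equiv.Perm (Fin N.1)))) := by
  obtain ⟨pS, tS, hS⟩ := feasible_relayStart hA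
  obtain ⟨pQ, tQ, hQ⟩ := feasible_relayQuery hA
  obtain ⟨pG, tG, hG⟩ := feasible_relayGuess hA
  have hp : RelayPrograms A pQ pG := ⟨fun i hi => (hQ ⟨i, hi⟩).1, fun i hi => (hG ⟨i, hi⟩).1⟩
  have hppt : (relay A pQ pG).IsPPT := by
    refine ⟨pS, pQ, pG, tS + tQ + tG, fun κ => ⟨⟨(hS κ).1, (hS κ).2.mono ?_⟩, ?_⟩⟩
    · simp only [Polynomial.eval_add]
      omega
    intro N ys d hd
    refine ⟨fun hys => ?_, fun hys => ?_⟩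
    · obtain ⟨V, ss, st, hG, hV, hss, hr, rfl⟩ := relay_reach hp hd hys.le
      let i : RelayContext A := ⟨κ, N, hG, V, hV, ys, ss, hss, st, hr, hys.le⟩
      refine ⟨?_, (hQ ⟨i, hys⟩).2.mono ?_⟩
      · rw [relay_query hp i hys]
        exact hp.query i hys
      · have := tQ.eval_mono_nat (Nat.le_add_right κ (codeSize ys))
        simp only [Polynomial.eval_add]
        exact this.trans (by beta_reduce; omega)
    · obtain ⟨V, ss, st, hN, hV, hss, hr, rfl⟩ := relay_reach hp hd hys.le
      let i : RelayContext A := ⟨κ, N, hN, V, hV, ys, ss, hss, st, hr, hys.le⟩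
      refine ⟨?_, (hG ⟨i, hys⟩).2.mono ?_⟩
      · rw [relay_guess hp i hys]
        exact hp.guess i hys
      · have := tG.eval_mono_nat (Nat.le_add_right κ (codeSize ys))
        simp only [Polynomial.eval_add]
        exact this.trans (by beta_reduce; omega)
  have h := hF.2 _ hppt
  have hg : ∀ P, prpGame (relay A pQ pG) P = zeroGame A P := fun P =>
    funext (prpGame_relay hp P)
  rwa [hg, hg] at h

end

/-! ## Lazy sampling of a permutation -/

section

variable {N : ℕ}

/-- The permutations that map the elements of `past` to those of `hist`. -/
def permsExtending (past hist : List (Fin N)) : Finset (Equiv.Perm (Fin N)) :=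
  Finset.univ.filter fun f => past.map f = hist

theorem mem_permsExtending {past hist : List (Fin N)} {f : Equiv.Perm (Fin N)} :
    f ∈ permsExtending past hist ↔ past.map f = hist := by
  simp [permsExtending]

theorem mem_permsExtending_append {past hist : List (Fin N)} {v y : Fin N}
    {f : Equiv.Perm (Fin N)} : f ∈ permsExtending (past ++ [v]) (hist ++ [y]) ↔
      f ∈ permsExtending past hist ∧ f v = y := by
  simp only [mem_permsExtending, List.map_append, List.map_cons, List.map_nil]
  constructor
  · intro h
    obtain ⟨h₁, h₂⟩ := List.append_inj' h rfl
    exact ⟨h₁, by simpa using h₂⟩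
  · rintro ⟨rfl, rfl⟩
    rfl

theorem swap_mul_mem_permsExtending {past hist : List (Fin N)} {v y y' : Fin N}
    (hy : y ∉ hist) (hy' : y' ∉ hist) {f : Equiv.Perm (Fin N)}
    (hf : f ∈ permsExtending (past ++ [v]) (hist ++ [y])) :
    Equiv.swap y y' * f ∈ permsExtending (past ++ [v]) (hist ++ [y']) := by
  rw [mem_permsExtending_append, mem_permsExtending] at *
  obtain ⟨rfl, rfl⟩ := hf
  refine ⟨List.map_congr_left fun a ha => ?_, by simp⟩
  exact Equiv.swap_apply_of_ne_of_ne (fun h => hy (h ▸ List.mem_map_of_mem ha))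
    fun h => hy' (h ▸ List.mem_map_of_mem ha)

/-- Composition with the transposition of `y` and `y'` is a bijection between the two sets. It
respects the earlier assignments, as neither value has been used. So all unused values are equally
likely at `v`. -/
theorem card_permsExtending_append {past hist : List (Fin N)} {v y y' : Fin N}
    (hy : y ∉ hist) (hy' : y' ∉ hist) :
    (permsExtending (past ++ [v]) (hist ++ [y])).card =
      (permsExtending (past ++ [v]) (hist ++ [y'])).card := by
  refine Finset.card_bij' (fun f _ => Equiv.swap y y' * f) (fun f _ => Equiv.swap y' y * f)
    (fun f hf => swap_mul_mem_permsExtending hy hy' hf)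
    (fun f hf => swap_mul_mem_permsExtending hy' hy hf) (fun f _ => ?_) fun f _ => ?_
  all_goals
    rw [← mul_assoc, Equiv.swap_comm, Equiv.swap_mul_self, one_mul]

/-- A uniform permutation that maps the elements of `past` to those of `hist`. -/
noncomputable def extendLaw (past hist : List (Fin N)) : PMF (Equiv.Perm (Fin N)) :=
  open Classical in
  if h : (permsExtending past hist).Nonempty then .uniformOfFinset _ h else .pure 1

theorem mem_support_extendLaw {past hist : List (Fin N)} (h : (permsExtending past hist).Nonempty)
    {f : Equiv.Perm (Fin N)} :
    f ∈ (extendLaw past hist).support ↔ f ∈ permsExtending past hist := by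
  rw [extendLaw, dif_pos h, PMF.mem_support_uniformOfFinset_iff]

theorem extendLaw_nil : extendLaw ([] : List (Fin N)) [] = PMF.uniformOfFintype _ := by
  have h : permsExtending ([] : List (Fin N)) [] = Finset.univ := by
    ext f
    simp [mem_permsExtending]
  have hne : (permsExtending ([] : List (Fin N)) []).Nonempty := h ▸ Finset.univ_nonempty
  ext f
  rw [extendLaw, dif_pos hne, PMF.uniformOfFinset_apply, PMF.uniformOfFintype_apply, h]
  simp

/-- The values `hist` were given to the arguments `past`, and `pool` has the unused values. -/
structure LazyState (past pool hist : List (Fin N)) : Prop where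
  nonempty : (permsExtending past hist).Nonempty
  nodup : pool.Nodup
  mem_pool : ∀ y, y ∈ pool ↔ y ∉ hist

theorem LazyState.length_eq {past pool hist : List (Fin N)} (h : LazyState past pool hist) :
    hist.length = past.length := by
  obtain ⟨f, hf⟩ := h.nonempty
  rw [← mem_permsExtending.1 hf, List.length_map]

theorem LazyState.apply_mem_pool {past pool hist : List (Fin N)} (h : LazyState past pool hist)
    {v : Fin N} (hv : v ∉ past) {f : Equiv.Perm (Fin N)} (hf : f ∈ permsExtending past hist) :
    f v ∈ pool := by
  rw [h.mem_pool, ← mem_permsExtending.1 hf, List.mem_map]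
  rintro ⟨a, ha, hav⟩
  exact hv (f.injective hav ▸ ha)

/-- At a new argument the value is unused by injectivity. Sorting the permutations by this value
gives one fibre for each element of the pool, all of the same size. -/
theorem LazyState.card_eq {past pool hist : List (Fin N)} (h : LazyState past pool hist)
    {v y : Fin N} (hv : v ∉ past) (hy : y ∈ pool) : (permsExtending past hist).card =
      pool.length * (permsExtending (past ++ [v]) (hist ++ [y])).card := by
  rw [Finset.card_eq_sum_card_fiberwise (f := fun f => f v) (t := pool.toFinset)
    fun f hf => List.mem_toFinset.2 (h.apply_mem_pool hv hf),
    Finset.sum_congr rfl (g := fun _ => (permsExtending (past ++ [v]) (hist ++ [y])).card)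
      fun y' hy' => ?_, Finset.sum_const, List.toFinset_card_of_nodup h.nodup, smul_eq_mul]
  rw [card_permsExtending_append ((h.mem_pool y).1 hy)
    ((h.mem_pool y').1 (List.mem_toFinset.1 hy'))]
  congr 1
  ext f
  rw [Finset.mem_filter, mem_permsExtending_append]

theorem LazyState.nonempty_append {past pool hist : List (Fin N)} (h : LazyState past pool hist)
    {v y : Fin N} (hv : v ∉ past) (hy : y ∈ pool) :
    (permsExtending (past ++ [v]) (hist ++ [y])).Nonempty := by
  rw [← Finset.card_pos]
  have := h.nonempty.card_pos
  rw [h.card_eq hv hy] at this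
  exact Nat.pos_of_mul_pos_left this

/-- A uniform choice from a set divided into equal parts is a uniform choice of a part followed by a
uniform choice within it. The default value `z` is never taken, as `r` is below the length of the
pool. -/
theorem LazyState.extendLaw_eq {past pool hist : List (Fin N)} (h : LazyState past pool hist)
    {v : Fin N} (hv : v ∉ past) (z : Fin N) {m : ℕ} (hm : pool.length = m + 1) :
    extendLaw past hist = (PMF.uniformOfFintype (Fin (m + 1))).bind fun r : Fin (m + 1) =>
      extendLaw (past ++ [v]) (hist ++ [pool.getD r z]) := by
  have hget : ∀ r : Fin (m + 1), pool.getD r z = pool[(r : ℕ)]'(by omega) := fun r => by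
    rw [List.getD_eq_getElem]
  have hmem : ∀ r : Fin (m + 1), pool.getD r z ∈ pool := fun r => by
    rw [hget]
    exact List.getElem_mem _
  ext f
  rw [extendLaw, dif_pos h.nonempty, PMF.uniformOfFinset_apply, PMF.bind_apply, tsum_fintype]
  by_cases hf : f ∈ permsExtending past hist
  · obtain ⟨i, hi, hiv⟩ := List.getElem_of_mem (h.apply_mem_pool hv hf)
    obtain ⟨j, rfl⟩ : ∃ j : Fin (m + 1), (j : ℕ) = i := ⟨⟨i, by omega⟩, rfl⟩
    rw [Finset.sum_eq_single j]
    · have hf' : f ∈ permsExtending (past ++ [v]) (hist ++ [pool.getD j z]) := by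
        rw [mem_permsExtending_append, hget]
        exact ⟨hf, hiv.symm⟩
      rw [if_pos hf, extendLaw, dif_pos (h.nonempty_append hv (hmem j)),
        PMF.uniformOfFinset_apply, if_pos hf', PMF.uniformOfFintype_apply,
        h.card_eq hv (hmem j), hm, Fintype.card_fin, Nat.cast_mul,
        ENNReal.mul_inv (by simp) (by simp)]
    · intro r _ hr
      have hf' : f ∉ permsExtending (past ++ [v]) (hist ++ [pool.getD r z]) := by
        rw [mem_permsExtending_append, hget]
        rintro ⟨-, hr'⟩
        rw [← hiv] at hr'
        exact hr (Fin.ext ((h.nodup.getElem_inj_iff).1 hr').symm)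
      rw [extendLaw, dif_pos (h.nonempty_append hv (hmem r)), PMF.uniformOfFinset_apply,
        if_neg hf', mul_zero]
    · simp
  · rw [if_neg hf, Finset.sum_eq_zero]
    intro r _
    have hf' : f ∉ permsExtending (past ++ [v]) (hist ++ [pool.getD r z]) := by
      rw [mem_permsExtending_append]
      exact fun h => hf h.1
    rw [extendLaw, dif_pos (h.nonempty_append hv (hmem r)), PMF.uniformOfFinset_apply,
      if_neg hf', mul_zero]

/-- The value of a random permutation at an argument that occurred first at position `o`; the
values so far are `b.2`, and `b.1` has the unused values. -/
noncomputable def lazyStep (z : Fin N) (b : List (Fin N) × List (Fin N)) (o : ℕ) :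
    PMF (Fin N × List (Fin N) × List (Fin N)) :=
  if o < b.2.length then PMF.pure (b.2.getD o z, b.1, b.2 ++ [b.2.getD o z])
  -- The form `length - 1 + 1` makes the index type nonempty for every pool; at a new argument the
  -- pool is nonempty and this is just its length.
  else (PMF.uniformOfFintype (Fin (b.1.length - 1 + 1))).map fun r : Fin (b.1.length - 1 + 1) =>
    (b.1.getD r z, b.1.eraseIdx r, b.2 ++ [b.1.getD r z])

theorem length_of_mem_support_lazyStep {z : Fin N} {b : List (Fin N) × List (Fin N)} {o : ℕ}
    {r : Fin N × List (Fin N) × List (Fin N)} (h : r ∈ (lazyStep z b o).support) :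
    r.2.1.length ≤ b.1.length ∧ r.2.2.length = b.2.length + 1 := by
  rw [lazyStep] at h
  split_ifs at h
  · rw [PMF.mem_support_pure_iff] at h
    subst h
    simp
  · rw [PMF.mem_support_map_iff] at h
    obtain ⟨i, -, rfl⟩ := h
    exact ⟨List.length_eraseIdx_le .., by simp⟩

/-- All permutations that extend the history agree at `v`, so the repetition adds no condition. The
value is recorded again, to keep the positions in `hist` aligned with those in `past`. -/
theorem LazyState.lazyStep_of_mem {past pool hist : List (Fin N)} (h : LazyState past pool hist)
    {v : Fin N} (hv : v ∈ past) (z : Fin N) : ∃ y, lazyStep z (pool, hist) (past.idxOf v) =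
      PMF.pure (y, pool, hist ++ [y]) ∧ (∀ f ∈ permsExtending past hist, f v = y) ∧
        LazyState (past ++ [v]) pool (hist ++ [y]) ∧
          extendLaw (past ++ [v]) (hist ++ [y]) = extendLaw past hist := by
  have hi : past.idxOf v < hist.length := h.length_eq ▸ List.idxOf_lt_length_iff.2 hv
  have hval : ∀ f ∈ permsExtending past hist, f v = hist.getD (past.idxOf v) z := by
    intro f hf
    rw [List.getD_eq_getElem _ _ hi]
    have := mem_permsExtending.1 hf
    subst this
    simp
  have hset : permsExtending (past ++ [v]) (hist ++ [hist.getD (past.idxOf v) z]) =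
      permsExtending past hist := by
    ext f
    rw [mem_permsExtending_append]
    exact ⟨fun h => h.1, fun hf => ⟨hf, hval f hf⟩⟩
  refine ⟨_, by rw [lazyStep, if_pos hi], hval, ⟨hset ▸ h.nonempty, h.nodup, fun y => ?_⟩, ?_⟩
  · rw [h.mem_pool, List.mem_append, List.mem_singleton, not_or]
    refine ⟨fun hy => ⟨hy, ?_⟩, fun hy => hy.1⟩
    rintro rfl
    rw [List.getD_eq_getElem _ _ hi] at hy
    exact hy (List.getElem_mem _)
  · simp only [extendLaw, hset]

theorem LazyState.append {past pool hist : List (Fin N)} (h : LazyState past pool hist)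
    {v z : Fin N} (hv : v ∉ past) {r : ℕ} (hr : r < pool.length) :
    LazyState (past ++ [v]) (pool.eraseIdx r) (hist ++ [pool.getD r z]) := by
  rw [List.getD_eq_getElem _ _ hr]
  refine ⟨h.nonempty_append hv (List.getElem_mem _), h.nodup.sublist (List.eraseIdx_sublist _ _),
    fun y => ?_⟩
  rw [← h.nodup.erase_getElem _ hr, h.nodup.mem_erase_iff, h.mem_pool, List.mem_append,
    List.mem_singleton, not_or, and_comm]

/-- A random permutation can be sampled lazily. -/
theorem LazyState.bind_extendLaw {β : Type} {past pool hist : List (Fin N)}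
    (h : LazyState past pool hist) (z v : Fin N) (g : Fin N → Equiv.Perm (Fin N) → PMF β) :
    ((extendLaw past hist).bind fun f => g (f v) f) =
      (lazyStep z (pool, hist) (past.idxOf v)).bind fun r =>
        (extendLaw (past ++ [v]) r.2.2).bind (g r.1) := by
  by_cases hv : v ∈ past
  · obtain ⟨y, hy, hval, -, hlaw⟩ := h.lazyStep_of_mem hv z
    rw [hy, PMF.pure_bind, hlaw]
    refine PMF.bind_congr_support fun f hf => ?_
    rw [hval f ((mem_support_extendLaw h.nonempty).1 hf)]
  · obtain ⟨f₀, hf₀⟩ := h.nonempty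
    have hpos := List.length_pos_of_mem (h.apply_mem_pool hv hf₀)
    have hi : ¬ past.idxOf v < hist.length := by
      rw [h.length_eq, List.idxOf_lt_length_iff]
      exact hv
    rw [lazyStep, if_neg hi, PMF.bind_map, h.extendLaw_eq hv z (m := pool.length - 1) (by omega),
      PMF.bind_bind]
    refine congrArg (PMF.bind _) (funext fun r => PMF.bind_congr_support fun f hf => ?_)
    rw [mem_support_extendLaw (h.append hv (by omega)).nonempty, mem_permsExtending_append] at hf
    rw [hf.2]

theorem LazyState.of_mem_support {past pool hist : List (Fin N)}
    (h : LazyState past pool hist) (z v : Fin N) {r : Fin N × List (Fin N) × List (Fin N)}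
    (hr : r ∈ (lazyStep z (pool, hist) (past.idxOf v)).support) :
    LazyState (past ++ [v]) r.2.1 r.2.2 := by
  by_cases hv : v ∈ past
  · obtain ⟨y, hy, -, hst, -⟩ := h.lazyStep_of_mem hv z
    rw [hy, PMF.mem_support_pure_iff] at hr
    rw [hr]
    exact hst
  · obtain ⟨f₀, hf₀⟩ := h.nonempty
    have hpos := List.length_pos_of_mem (h.apply_mem_pool hv hf₀)
    have hi : ¬ past.idxOf v < hist.length := by
      rw [h.length_eq, List.idxOf_lt_length_iff]
      exact hv
    rw [lazyStep, if_neg hi, PMF.mem_support_map_iff] at hr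
    obtain ⟨i, -, rfl⟩ := hr
    exact h.append hv (by dsimp only; omega)

end

/-! ## The simulator that sees only repetitions -/

theorem FeasibleFun.getD {ι : Type} {s : ι → ℕ} {x : ι → Data} {α : ι → Type}
    {c : ∀ i, α i → Data} {l : ∀ i, List (α i)} {m : ι → ℕ} {a : ∀ i, α i}
    (hlen : FeasibleFun s x fun i => .num (l i).length)
    (hl : FeasibleFun s x fun i => codeList (c i) (l i)) (hm : FeasibleFun s x fun i => .num (m i))
    (ha : FeasibleFun s x fun i => c i (a i)) :
    FeasibleFun s x fun i => c i ((l i).getD (m i) (a i)) := by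
  refine FeasibleFun.by_cases (hm.lt hlen)
    (((hl.reindex _).nth (hm.reindex _) fun j => j.2).congr fun j => ?_)
    ((ha.reindex _).congr fun j => ?_)
  · rw [List.getD_eq_getElem _ _ j.2]
  · rw [List.getD_eq_default _ _ (not_lt.1 j.2)]

/-- The list is rebuilt: entries before position `m i` stay, the later ones are read one position
further on. -/
theorem FeasibleFun.eraseIdx {ι : Type} {s : ι → ℕ} {x : ι → Data} {α : ι → Type}
    {c : ∀ i, α i → Data} {l : ∀ i, List (α i)} {m : ι → ℕ}
    (hlen : FeasibleFun s x fun i => .num (l i).length)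
    (hl : FeasibleFun s x fun i => codeList (c i) (l i))
    (hm : FeasibleFun s x fun i => .num (m i)) :
    (FeasibleFun s x fun i => .num ((l i).eraseIdx (m i)).length) ∧
      FeasibleFun s x fun i => codeList (c i) ((l i).eraseIdx (m i)) := by
  have hlen' : FeasibleFun s x fun i => .num ((l i).eraseIdx (m i)).length := by
    refine FeasibleFun.by_cases (hm.lt hlen)
      (((hlen.sub (hlen.numeral 1)).reindex _).congr fun j => ?_)
      ((hlen.reindex _).congr fun j => ?_)
    · rw [List.length_eraseIdx, if_pos j.2]
    · rw [List.length_eraseIdx, if_neg j.2]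
  refine ⟨hlen', ?_⟩
  have hb : ∀ i, ((l i).eraseIdx (m i)).length ≤ (l i).length :=
    fun i => List.length_eraseIdx_le ..
  have := FeasibleFun.ofFn (c := c) (v := fun i j => ((l i).eraseIdx (m i))[j]) hlen'
    (hl.size_output.mono fun i => (hb i).trans (length_le_size_codeList _ _)) fun s' x' w v u => by
      have hlt : ∀ j : Σ i, Fin ((l i).eraseIdx (m i)).length, j.2 < (l j.1).length :=
        fun j => j.2.2.trans_le (hb j.1)
      refine FeasibleFun.by_cases (v.lt (w _ hm))
        ((((w _ hl).nth v hlt).reindex _).congr fun j => ?_)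
        ((((w _ hl).reindex _).nth ((v.add (v.numeral 1)).reindex _) fun j => ?_).congr fun j => ?_)
      · rw [Fin.getElem_fin, List.getElem_eraseIdx, dif_pos j.2]
      · have h₁ := j.1.2.2.trans_eq (List.length_eraseIdx ..)
        have h₂ := j.2
        split_ifs at h₁ <;> omega
      · simp [List.getElem_eraseIdx, j.2]
  exact this.congr fun i => congrArg _ (List.ofFn_getElem ..)

/-- The state of the lazy simulator. -/
def lazyCode {N : ℕ} (b : List (Fin N) × List (Fin N)) : Data :=
  .pair (.pair (.num b.1.length) (Coded.code b.1)) (.pair (.num b.2.length) (Coded.code b.2))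

theorem feasible_lazyStep {ι : Type} {s : ι → ℕ} {x : ι → Data} {N : ι → Size D}
    {b : ∀ i, List (Fin (N i).1) × List (Fin (N i).1)} {o : ι → ℕ}
    (hb : FeasibleFun s x fun i => lazyCode (b i)) (ho : FeasibleFun s x fun i => .num (o i)) :
    Feasible s x fun i => (lazyStep ⟨0, (N i).2.1⟩ (b i) (o i)).map fun r =>
      .pair (.num r.1) (lazyCode r.2) := by
  have hpl := hb.fst.fst
  have hp := hb.fst.snd
  have hhl := hb.snd.fst
  have hh := hb.snd.snd
  have happ : ∀ {ι' : Type} {s' : ι' → ℕ} {x' : ι' → Data} (φ : ι' → ι)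
      (y : ∀ j, Fin (N (φ j)).1) (_ : FeasibleFun s' x' fun j => .num (b (φ j)).2.length)
      (_ : FeasibleFun s' x' fun j => Coded.code (b (φ j)).2)
      (_ : FeasibleFun s' x' fun j => Coded.code (y j)),
      FeasibleFun s' x' fun j => .pair (.num ((b (φ j)).2 ++ [y j]).length)
        (Coded.code ((b (φ j)).2 ++ [y j])) := fun φ y hl h hy =>
    ((hl.add (hl.numeral 1)).congr fun j => by simp).pair
      (hl.append (c := fun _ => Coded.code) h hy)
  have hz : FeasibleFun s x fun i => Coded.code (⟨0, (N i).2.1⟩ : Fin (N i).1) := ho.numeral 0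
  refine Feasible.by_cases (P := fun i => o i < (b i).2.length) (ho.lt hhl) ?_ ?_
  · have hy := (FeasibleFun.getD (c := fun _ => Coded.code) hhl hh ho hz).reindex
      fun i : {i // o i < (b i).2.length} => i.1
    refine Feasible.congr (hy.pair (((hpl.pair hp).reindex _).pair
      (happ Subtype.val _ (hhl.reindex _) (hh.reindex _) hy))) fun i => ?_
    rw [lazyStep, if_pos i.2, PMF.pure_map]
    rfl
  · have hu := Feasible.uniformFin (n := fun i : {i // ¬ o i < (b i).2.length} =>
      (b i.1).1.length - 1 + 1)
      (((hpl.sub (hpl.numeral 1)).add (hpl.numeral 1)).reindex Subtype.val)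
    refine (hu.map (β := fun i : {i // ¬ o i < (b i).2.length} => Fin ((b i.1).1.length - 1 + 1))
      (g := fun i r => .pair (.num ((b i.1).1.getD r ⟨0, (N i.1).2.1⟩))
      (lazyCode ((b i.1).1.eraseIdx r, (b i.1).2 ++ [(b i.1).1.getD r ⟨0, (N i.1).2.1⟩])))
        fun s₁ x₁ w₁ v₁ u₁ => ?_).congr fun i => ?_
    · have w := fun f hf => w₁ _ (FeasibleFun.reindex (f := f) hf Subtype.val)
      have hy := FeasibleFun.getD (c := fun _ => Coded.code) (w _ hpl) (w _ hp) v₁ (w _ hz)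
      have he := FeasibleFun.eraseIdx (c := fun _ => Coded.code) (w _ hpl) (w _ hp) v₁
      exact hy.pair ((he.1.pair he.2).pair (happ _ _ (w _ hhl) (w _ hh) hy))
    · rw [lazyStep, if_neg i.2, PMF.map_comp]
      rfl

section

variable {D : Set ℕ} {𝒢 : BilinearGenerator} {F perm : KeyedPermutation D}
  {mask : MaskingAlgorithm D}

/-- The trapdoor and the new state of the lazy simulator. -/
noncomputable def lazyTrapdoor (κ : ℕ) (N : Size D) (b : List (Fin N.1) × List (Fin N.1)) (o : ℕ) :
    PMF ((Fin N.1 × BitVec κ) × Data) :=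
  (lazyStep ⟨0, N.2.1⟩ b o).bind fun r => (randomBits κ).map fun s => ((r.1, s), lazyCode r.2)

/-- The situations in which the lazy simulator may have to act. -/
structure LazyContext (D : Set ℕ) where
  κ : ℕ
  N : Size D
  b : List (Fin N.1) × List (Fin N.1)
  os : List ℕ
  o : ℕ
  length_pool : b.1.length ≤ N.1
  length_hist : b.2.length = os.length

/-- The input of the lazy simulator. -/
def LazyContext.input (i : LazyContext D) : Data :=
  Coded.code (i.κ, i.N, lazyCode i.b, i.os ++ [i.o])

theorem LazyContext.polyBdd_size :
    PolyBdd (fun i : LazyContext D => i.κ + i.N.1 + codeSize (i.os ++ [i.o]))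
      fun i => i.input.size := by
  let s := fun i : LazyContext D => i.κ + i.N.1 + codeSize (i.os ++ [i.o])
  have hs : PolyBdd s s := .self
  have hl : ∀ (i : LazyContext D) (l : List (Fin i.N.1)), l.length ≤ s i →
      (codeList Coded.code l).size ≤ s i * (s i + 2) + 1 := by
    intro i l hl
    refine (size_codeList_le (m := s i + 1) _ fun a _ => ?_).trans (Nat.add_le_add_right
      (Nat.mul_le_mul_right _ hl) _)
    have h₁ := (Nat.size_le_self _).trans a.2.le
    simp only [Coded.code, Data.size, s]
    omega
  refine (((hs.mul (.const 4)).add ((hs.mul (hs.add (.const 2))).mul (.const 2))).add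
    (.const 20)).mono fun i => ?_
  have h₀ := length_le_size_codeList Coded.code (i.os ++ [i.o])
  rw [List.length_append] at h₀
  have h₁ := Nat.size_le_self i.κ
  have h₂ := Nat.size_le_self i.N.1
  have h₃ := Nat.size_le_self i.b.1.length
  have h₄ := Nat.size_le_self i.b.2.length
  have h₅ := i.length_pool
  have h₆ := i.length_hist
  have hsi : s i = i.κ + i.N.1 + (codeList Coded.code (i.os ++ [i.o])).size := rfl
  have h₇ := hl i i.b.1 (by omega)
  have h₈ := hl i i.b.2 (by omega)
  have h₉ : i.input.size = (Nat.size i.κ + 1) + ((Nat.size i.N.1 + 1) +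
    ((((Nat.size i.b.1.length + 1) + (codeList Coded.code i.b.1).size + 1) +
      ((Nat.size i.b.2.length + 1) + (codeList Coded.code i.b.2).size + 1) + 1) +
        (codeList Coded.code (i.os ++ [i.o])).size + 1) + 1) + 1 := rfl
  -- The only nonlinear term of the estimate is treated as an unknown.
  generalize s i * (s i + 2) = q at *
  omega

theorem feasible_lazyTrapdoor (D : Set ℕ) :
    Feasible (fun i : LazyContext D => i.κ + i.N.1 + codeSize (i.os ++ [i.o]))
      LazyContext.input fun i => (lazyTrapdoor i.κ i.N i.b i.o).map Coded.code := by
  have hid := FeasibleFun.id (LazyContext.polyBdd_size (D := D))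
  have hb := hid.snd.snd.fst
  -- The current leakage is the last one of the list; its position is the length of the recorded
  -- history.
  have ho : FeasibleFun (fun i : LazyContext D => i.κ + i.N.1 + codeSize (i.os ++ [i.o]))
      LazyContext.input fun i => .num i.o :=
    (hid.snd.snd.snd.nth (c := fun _ => Coded.code) (l := fun i : LazyContext D => i.os ++ [i.o])
      hb.snd.fst fun i => by simp [i.length_hist]).congr fun i => by
        simp [i.length_hist]
        rfl
  have hκb : PolyBdd (fun i : LazyContext D => i.κ + i.N.1 + codeSize (i.os ++ [i.o]))
      fun i => i.κ := PolyBdd.self.mono fun i => by omega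
  refine ((feasible_lazyStep hb ho).bind (ν := fun i r => (randomBits i.κ).map fun s =>
    Coded.code ((r.1, s), lazyCode r.2)) fun s₁ x₁ w₁ v₁ u₁ => ?_).congr fun i => by
      simp only [lazyTrapdoor, PMF.map_bind, PMF.map_comp]
      rfl
  exact (Feasible.randomBits (w₁ _ hid.fst) (u₁ _ hκb)).map fun s₂ x₂ w₂ v₂ u₂ =>
    ((w₂ _ v₁.fst).pair v₂).pair (w₂ _ v₁.snd)

/-- The simulator that samples the positions of the vertices lazily. -/
noncomputable def lazySimulator (𝒢 : BilinearGenerator) (F perm : KeyedPermutation D)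
    (mask : MaskingAlgorithm D) (p : Prog) :
    (slpII 𝒢 F perm mask).Simulator (repetitionLeakage D) where
  build κ N := (zeroView 𝒢 F perm mask κ N).map fun V => (V, lazyCode (List.finRange N.1, []))
  trapdoor κ N st os :=
    haveI : Nonempty ((Fin N.1 × BitVec κ) × Data) := ⟨((⟨0, N.2.1⟩, 0), .num 0)⟩
    p.decodedLaw (β := (Fin N.1 × BitVec κ) × Data) (Coded.code (α := ℕ × Size D × Data × List ℕ)
      (κ, N, st, os))

theorem code_trapdoor_injective (κ N : ℕ) :
    Function.Injective (Coded.code : (Fin N × BitVec κ) × Data → Data) := by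
  rintro ⟨⟨a, s⟩, d⟩ ⟨⟨b, t⟩, e⟩ h
  have h : Data.pair (.pair (.num a) (.num s.toNat)) d =
    .pair (.pair (.num b) (.num t.toNat)) e := h
  obtain ⟨h₁, rfl⟩ := Data.pair.inj h
  obtain ⟨h₁, h₂⟩ := Data.pair.inj h₁
  rw [Fin.ext (Data.num.inj h₁), BitVec.eq_of_toNat_eq (Data.num.inj h₂)]

theorem lazySimulator_trapdoor {p : Prog}
    (hp : ∀ i : LazyContext D, p.law i.input = (lazyTrapdoor i.κ i.N i.b i.o).map Coded.code)
    (κ : ℕ) (N : Size D) (b : List (Fin N.1) × List (Fin N.1))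
    (os : List ((repetitionLeakage D).Out κ N)) (o : (repetitionLeakage D).Out κ N)
    (h₁ : b.1.length ≤ N.1) (h₂ : b.2.length = os.length) :
    (lazySimulator 𝒢 F perm mask p).trapdoor κ N (lazyCode b) (os ++ [o]) = lazyTrapdoor κ N b o :=
  haveI : Nonempty ((Fin N.1 × BitVec κ) × Data) := ⟨((⟨0, N.2.1⟩, 0), .num 0)⟩
  Prog.decodedLaw_eq (code_trapdoor_injective _ _) (hp ⟨κ, N, b, os, o, h₁, h₂⟩)

/-- Reachable states may come from arbitrary, even inconsistent leakage, so the history need not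
belong to any permutation. The two bounds on lengths persist nevertheless, and they are all that the
program requires. -/
theorem lazySimulator_reach {p : Prog}
    (hp : ∀ i : LazyContext D, p.law i.input = (lazyTrapdoor i.κ i.N i.b i.o).map Coded.code)
    {κ : ℕ} {N : Size D} {os : List ((repetitionLeakage D).Out κ N)} {st : Data}
    (h : (lazySimulator 𝒢 F perm mask p).Reach κ N os st) :
    ∃ b : List (Fin N.1) × List (Fin N.1), st = lazyCode b ∧ b.1.length ≤ N.1 ∧
      b.2.length = os.length := by
  induction h with
  | start V st h =>
    obtain ⟨_, _, h⟩ := (PMF.mem_support_map_iff _ _ _).1 h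
    exact ⟨_, (Prod.mk.inj h).2.symm, by simp, rfl⟩
  | step os st o τ st' _ h ih =>
    obtain ⟨b, rfl, h₁, h₂⟩ := ih
    rw [lazySimulator_trapdoor hp κ N b os o h₁ h₂] at h
    obtain ⟨r, hr, h⟩ := (PMF.mem_support_bind_iff _ _ _).1 h
    obtain ⟨s, -, h⟩ := (PMF.mem_support_map_iff _ _ _).1 h
    obtain ⟨h₃, h₄⟩ := length_of_mem_support_lazyStep hr
    refine ⟨r.2, (Prod.mk.inj h).2.symm, h₃.trans h₁, ?_⟩
    rw [h₄, List.length_append, List.length_singleton]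
    exact congrArg (· + 1) h₂

theorem lazySimulator_isPPT {p : Prog} {t : Polynomial ℕ}
    (hp : ∀ i : LazyContext D, p.law i.input = (lazyTrapdoor i.κ i.N i.b i.o).map Coded.code ∧
      p.CostLe i.input (t.eval (i.κ + i.N.1 + codeSize (i.os ++ [i.o])))) :
    (lazySimulator 𝒢 F perm mask p).IsPPT := by
  have hstate : ∀ (s : ℕ × Size D → ℕ) (x : ℕ × Size D → Data),
      (FeasibleFun s x fun i => .num i.2.1) → (PolyBdd s fun i => i.2.1) →
      FeasibleFun s x fun i => lazyCode (List.finRange i.2.1, []) := by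
    intro s x hN hNb
    have h := FeasibleFun.ofFn (c := fun _ => Coded.code) (v := fun (i : ℕ × Size D) j => j) hN hNb
      fun s' x' w v u => v
    refine ((hN.congr fun i => by simp).pair (h.congr fun i => ?_)).pair
      ((hN.numeral 0).pair (hN.numeral 0))
    exact congrArg _ (List.ofFn_id _)
  obtain ⟨pB, tB, hB⟩ := feasible_zeroView_pair 𝒢 F perm mask
    (st := fun _ N => lazyCode (List.finRange N.1, [])) hstate
  refine ⟨pB, p, tB + t, fun κ N => ⟨⟨(hB (κ, N)).1, (hB (κ, N)).2.mono (by simp)⟩, ?_⟩⟩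
  intro os st o hst
  obtain ⟨b, rfl, h₁, h₂⟩ := lazySimulator_reach (fun i => (hp i).1) hst
  let i : LazyContext D := ⟨κ, N, b, os, o, h₁, h₂⟩
  refine ⟨?_, (hp i).2.mono ?_⟩
  · rw [lazySimulator_trapdoor (fun i => (hp i).1) κ N b os o h₁ h₂]
    exact (hp i).1
  · rw [Polynomial.eval_add]
    exact Nat.le_add_left _ _

end

/-- The interaction with a random permutation is the one with lazily sampled positions. -/
theorem bind_extendLaw_iter {D : Set ℕ} {κ : ℕ} {N : Size D}
    (ask : List (Fin N.1 × BitVec κ) → Data → PMF (Fin N.1 × Data))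
    {answer : List (Fin N.1) × List ℕ × Data → Fin N.1 →
      PMF ((Fin N.1 × BitVec κ) × (List (Fin N.1) × List ℕ × Data))}
    (hans : ∀ (past : List (Fin N.1)) (b : List (Fin N.1) × List (Fin N.1)) (os : List ℕ)
      (v : Fin N.1), b.1.length ≤ N.1 → b.2.length = os.length →
      answer (past, os, lazyCode b) v = (lazyTrapdoor κ N b (past.idxOf v)).map fun τ =>
        (τ.1, (past ++ [v], os ++ [past.idxOf v], τ.2)))
    {past pool hist : List (Fin N.1)} {os : List ℕ} (h : LazyState past pool hist)
    (hos : hist.length = os.length) (τs : List (Fin N.1 × BitVec κ)) (st : Data) (k : ℕ) :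
    ((extendLaw past hist).bind fun f =>
      PMF.iter (fun b : List (Fin N.1 × BitVec κ) × Data => (ask b.1 b.2).bind fun r =>
        (randomBits κ).map fun s => (b.1 ++ [(f r.1, s)], r.2)) k (τs, st)) =
      (PMF.iter (interactRound ask answer) k (τs, st, past, os, lazyCode (pool, hist))).map
        fun b => (b.1, b.2.1) := by
  induction k generalizing past pool hist os τs st with
  | zero => simp only [PMF.iter, PMF.bind_const, PMF.pure_map]
  | succ k ih =>
    have hpool : pool.length ≤ N.1 := by
      simpa using h.nodup.length_le_card
    simp only [PMF.iter, interactRound, PMF.bind_bind, PMF.map_bind]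
    -- The question depends on earlier replies only, so it can be drawn before the permutation. Then
    -- `LazyState.bind_extendLaw` draws the value at the queried vertex first and conditions the
    -- permutation on it.
    rw [PMF.bind_comm]
    refine congrArg (PMF.bind _) (funext fun r => ?_)
    rw [hans past (pool, hist) os r.1 hpool hos, PMF.map_comp, PMF.bind_map, lazyTrapdoor,
      PMF.bind_bind]
    have := h.bind_extendLaw ⟨0, N.2.1⟩ r.1 fun y f => (randomBits κ).bind fun s =>
      PMF.iter (fun b : List (Fin N.1 × BitVec κ) × Data => (ask b.1 b.2).bind fun r =>
        (randomBits κ).map fun s => (b.1 ++ [(f r.1, s)], r.2)) k (τs ++ [(y, s)], r.2)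
    simp only [PMF.bind_map, Function.comp_def]
    refine this.trans (PMF.bind_congr_support fun q hq => ?_)
    have hq' := length_of_mem_support_lazyStep hq
    rw [PMF.bind_comm]
    refine congrArg (PMF.bind _) (funext fun s => ?_)
    exact ih (h.of_mem_support _ _ hq) (by simp only [List.length_append, hq'.2, hos]; rfl) _ _

section

variable {D : Set ℕ} {𝒢 : BilinearGenerator} {F perm : KeyedPermutation D}
  {mask : MaskingAlgorithm D}

/-- At the beginning there is no condition on the permutation and all values are unused, so the
conditional law `extendLaw` is the uniform one. -/
theorem ideal_lazySimulator {p : Prog}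
    (hp : ∀ i : LazyContext D, p.law i.input = (lazyTrapdoor i.κ i.N i.b i.o).map Coded.code)
    (A : (slpII 𝒢 F perm mask).Adversary) (κ : ℕ) :
    SLPScheme.ideal A (lazySimulator 𝒢 F perm mask p) κ =
      zeroGame A (fun _ N => PMF.uniformOfFintype (Equiv.Perm (Fin N.1))) κ := by
  rw [ideal_eq_play, zeroGame]
  refine congrArg (PMF.bind _) (funext fun G => ?_)
  refine (PMF.pure_bind _ _).trans ?_
  rw [show (lazySimulator 𝒢 F perm mask p).build κ G.1.N = (zeroView 𝒢 F perm mask κ G.1.N).map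
    fun V => (V, lazyCode (List.finRange G.1.N.1, [])) from rfl, PMF.bind_map]
  refine congrArg (PMF.bind _) (funext fun V => ?_)
  have h₀ : LazyState [] (List.finRange G.1.N.1) [] :=
    ⟨⟨1, by simp [mem_permsExtending]⟩, List.nodup_finRange _, by simp⟩
  have := bind_extendLaw_iter (fun τs st => A.query κ G.1.N st V τs)
    (answer := fun (s : (repetitionLeakage D).State κ G.1.N ×
      List ((repetitionLeakage D).Out κ G.1.N) × Data) v =>
        ((repetitionLeakage D).query κ G.1.N s.1 v).bind fun o =>
          ((lazySimulator 𝒢 F perm mask p).trapdoor κ G.1.N s.2.2 (s.2.1 ++ [o.1])).map fun τ =>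
            (τ.1, (o.2, s.2.1 ++ [o.1], τ.2)))
    (fun past b os v h₁ h₂ => (PMF.pure_bind _ _).trans (congrArg (PMF.map _)
      (lazySimulator_trapdoor hp κ G.1.N b os (past.idxOf v) h₁ h₂))) h₀ (os := []) rfl [] G.2
    (A.rounds.eval κ)
  rw [extendLaw_nil] at this
  simp only [play]
  refine ((PMF.bind_map (PMF.iter _ _ _) (fun b : List (Fin G.1.N.1 × BitVec κ) × Data × _ =>
    (b.1, b.2.1)) fun b : List (Fin G.1.N.1 × BitVec κ) × Data =>
      A.guess κ G.1.N b.2 V b.1).symm.trans ?_).trans (PMF.bind_bind _ _ _)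
  exact (congrArg (fun p => PMF.bind p _) this).symm

end

/-! ### The security claims -/

theorem theorem2 (D : Set ℕ) (𝒢 : BilinearGenerator) (F perm : KeyedPermutation D)
    (mask : MaskingAlgorithm D) (hBGN : 𝒢.BGNSemanticallySecure) (hF : IsPRP F) :
    (slpII 𝒢 F perm mask).LSecure (slpII 𝒢 F perm mask).trapdoorLeakage ∧
    (slpII 𝒢 F perm mask).LSecureWith (slpII 𝒢 F perm mask).trapdoorLeakage
      (zeroView 𝒢 F perm mask) ∧
    (slpII 𝒢 F perm mask).LSecureWith (repetitionLeakage D) (zeroView 𝒢 F perm mask) := by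
  have h : (slpII 𝒢 F perm mask).LSecureWith (slpII 𝒢 F perm mask).trapdoorLeakage
      (zeroView 𝒢 F perm mask) := fun A hA => by
    refine ⟨forwardSimulator 𝒢 F perm mask, forwardSimulator_isPPT, fun κ N => ?_, ?_⟩
    · exact (PMF.map_comp _ _ _).trans (PMF.map_id _)
    · rw [show SLPScheme.ideal A (forwardSimulator 𝒢 F perm mask) = _ from
        funext (ideal_forwardSimulator A)]
      -- The ideal game coincides with the zero game, so emptying the structures is the only loss.
      exact negligible_gap_real_zeroGame hBGN hF hA
  refine ⟨fun A hA => ?_, h, fun A hA => ?_⟩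
  · obtain ⟨S, hS, -, hgap⟩ := h A hA
    exact ⟨S, hS, hgap⟩
  · obtain ⟨p, t, hp⟩ := feasible_lazyTrapdoor D
    refine ⟨lazySimulator 𝒢 F perm mask p, lazySimulator_isPPT hp, fun κ N => ?_, ?_⟩
    · exact (PMF.map_comp _ _ _).trans (PMF.map_id _)
    · rw [show SLPScheme.ideal A (lazySimulator 𝒢 F perm mask p) = _ from
        funext (ideal_lazySimulator (fun i => (hp i).1) A)]
      -- Two losses add up here: that of emptying the structures and that of making the positions
      -- truly random.
      exact ((negligible_gap_real_zeroGame hBGN hF hA).add (negligible_gap_zeroGame hF hA)).mono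
        (gap_triangle _ _ _)
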